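/- A 3-CNF formula over $n$ variables is a finite set of clauses, each clause being a set of at most three literals over these variables. Ball-3-SAT is the problem: given $n$, a 3-CNF formula $F$ over $n$ variables, a truth assignment $\alpha \in \{0,1\}^n$ and a natural number $r$, decide whether there is an assignment $\beta$ that satisfies $F$ and differs from $\alpha$ on at most $r$ variables. 3-SAT is the problem: given $n$ and a 3-CNF formula $F$ over $n$ variables, decide whether $F$ has a satisfying assignment. Running time is measured on a deterministic random access machine with logarithmic cost (every operation is charged at least the bit lengths of the numbers and addresses involved). **Theorem.** Let $a = \frac{1+\sqrt{17}}{2} \approx 2.562$ be the largest real root of $x^2 - x - 4$. (1) There are a single deterministic algorithm and a polynomial $p$ such that the algorithm decides every instance $(n, F, \alpha, r)$ of Ball-3-SAT in time at most $p(n)\, a^r$, that is, in time $O^*(a^r)$. (2) There are a single deterministic algorithm and a polynomial $q$ such that the algorithm decides every instance $(n, F)$ of 3-SAT in time at most $q(n)\, 1.439^n$, that is, in time $O^*(1.439^n)$. -/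

import Mathlib

/-! ### Boolean formulas -/

/-- A literal over the variables `0, …, n - 1`: `(v, true)` is the variable `v` itself and
`(v, false)` is its negation. -/
abbrev Literal (n : ℕ) : Type := Fin n × Bool

/-- A truth assignment to the variables `0, …, n - 1`. -/
abbrev Assignment (n : ℕ) : Type := Fin n → Bool

/-- A 3-CNF formula over `n` variables, written down as a duplicate-free list of clauses. Each
clause is a duplicate-free list of at most three literals. -/
structure CNF3 (n : ℕ) where
  clauses : List (List (Literal n))
  clauses_nodup : clauses.Nodup
  literals_nodup : ∀ C ∈ clauses, C.Nodup
  width_le : ∀ C ∈ clauses, C.length ≤ 3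

/-- The assignment `α` satisfies `F`: every clause contains a literal that `α` makes true. -/
def CNF3.SatisfiedBy {n : ℕ} (F : CNF3 n) (α : Assignment n) : Prop :=
  ∀ C ∈ F.clauses, ∃ l ∈ C, α l.1 = l.2

/-- An instance of 3-SAT: a number of variables and a 3-CNF formula over them. -/
structure SatInstance where
  n : ℕ
  F : CNF3 n

/-- The yes-instances of 3-SAT. -/
def SatInstance.Yes (I : SatInstance) : Prop :=
  ∃ β : Assignment I.n, I.F.SatisfiedBy β

/-- An instance of Ball-3-SAT: a 3-CNF formula over `n` variables, an assignment to these variables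
and a radius. -/
structure BallInstance where
  n : ℕ
  F : CNF3 n
  α : Assignment n
  r : ℕ

/-- The yes-instances of Ball-3-SAT: the Hamming ball of radius `r` around `α` contains a
satisfying assignment. -/
def BallInstance.Yes (I : BallInstance) : Prop :=
  ∃ β : Assignment I.n, I.F.SatisfiedBy β ∧ hammingDist I.α β ≤ I.r

/-! ### Instances as finite sequences of natural numbers -/

/-- The variable `v` is written as `2 v + 1`, its negation as `2 v`. -/
def encodeLiteral {n : ℕ} (l : Literal n) : ℕ := 2 * (l.1 : ℕ) + l.2.toNat

/-- A clause is written as its number of literals followed by the literals. -/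
def encodeClause {n : ℕ} (C : List (Literal n)) : List ℕ :=
  C.length :: C.map encodeLiteral

/-- A formula is written as its number of clauses followed by the clauses. -/
def encodeFormula {n : ℕ} (F : CNF3 n) : List ℕ :=
  F.clauses.length :: F.clauses.flatMap encodeClause

/-- `n`, then the formula. -/
def SatInstance.encode (I : SatInstance) : List ℕ :=
  I.n :: encodeFormula I.F

/-- `n`, then `r`, then the `n` bits of the assignment, then the formula. -/
def BallInstance.encode (I : BallInstance) : List ℕ :=
  I.n :: I.r :: (List.ofFn fun i => (I.α i).toNat) ++ encodeFormula I.F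

/-! ### A deterministic random access machine with logarithmic cost

The machine has a read-only input, which is a finite sequence of natural numbers, and a working
memory `ℕ → ℕ`; both are addressed indirectly. Programs are structured (`while` programs). Every
elementary operation is charged at least the bit lengths of the numbers and addresses it handles;
multiplication and division are charged as in the schoolbook methods. -/

namespace RAM

/-- Contents of the working memory. -/
abbrev Mem : Type := ℕ → ℕ

/-- Expressions. -/
inductive Expr : Type
  /-- a constant -/
  | const (c : ℕ)
  /-- the input word at the computed address -/
  | inp (a : Expr)
  /-- the memory cell at the computed address -/
  | mem (a : Expr)
  | add (a b : Expr)
  /-- truncated subtraction -/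
  | sub (a b : Expr)
  | mul (a b : Expr)
  /-- integer division, rounded down (and `0` for the divisor `0`) -/
  | div (a b : Expr)

/-- The value of an expression, for the input `x` and the memory `M`. -/
def Expr.val (x : List ℕ) (M : Mem) : Expr → ℕ
  | .const c => c
  | .inp a => x.getD (a.val x M) 0
  | .mem a => M (a.val x M)
  | .add a b => a.val x M + b.val x M
  | .sub a b => a.val x M - b.val x M
  | .mul a b => a.val x M * b.val x M
  | .div a b => a.val x M / b.val x M

/-- The time it takes to evaluate an expression (`Nat.size` is the length of the binary
representation). -/
def Expr.cost (x : List ℕ) (M : Mem) : Expr → ℕ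
  | .const c => c.size + 1
  | .inp a => a.cost x M + (a.val x M).size + (x.getD (a.val x M) 0).size + 1
  | .mem a => a.cost x M + (a.val x M).size + (M (a.val x M)).size + 1
  | .add a b => a.cost x M + b.cost x M + (a.val x M).size + (b.val x M).size + 1
  | .sub a b => a.cost x M + b.cost x M + (a.val x M).size + (b.val x M).size + 1
  | .mul a b => a.cost x M + b.cost x M + ((a.val x M).size + 1) * ((b.val x M).size + 1)
  | .div a b => a.cost x M + b.cost x M + ((a.val x M).size + 1) * ((b.val x M).size + 1)

/-- Programs. -/
inductive Prog : Type
  /-- do nothing -/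
  | skip
  /-- write the value of `e` into the memory cell whose address is the value of `a` -/
  | store (a e : Expr)
  /-- one program after the other -/
  | seq (p q : Prog)
  /-- run `p` if the value of `e` is nonzero, and `q` otherwise -/
  | cond (e : Expr) (p q : Prog)
  /-- repeat `p` as long as the value of `e` is nonzero -/
  | loop (e : Expr) (p : Prog)

/-- `Exec x p M M' t`: on the input `x`, the program `p`, started with memory `M`, halts with memory
`M'` after time exactly `t`. -/
inductive Exec (x : List ℕ) : Prog → Mem → Mem → ℕ → Prop
  | skip (M : Mem) : Exec x .skip M M 1
  | store (a e : Expr) (M : Mem) :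
      Exec x (.store a e) M (Function.update M (a.val x M) (e.val x M))
        (a.cost x M + e.cost x M + (a.val x M).size + (e.val x M).size + 1)
  | seq {p q : Prog} {M M' M'' : Mem} {t u : ℕ} :
      Exec x p M M' t → Exec x q M' M'' u → Exec x (.seq p q) M M'' (t + u + 1)
  | cond_true {e : Expr} {p q : Prog} {M M' : Mem} {t : ℕ} :
      e.val x M ≠ 0 → Exec x p M M' t → Exec x (.cond e p q) M M' (e.cost x M + t + 1)
  | cond_false {e : Expr} {p q : Prog} {M M' : Mem} {t : ℕ} :
      e.val x M = 0 → Exec x q M M' t → Exec x (.cond e p q) M M' (e.cost x M + t + 1)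
  | loop_stop {e : Expr} {p : Prog} {M : Mem} :
      e.val x M = 0 → Exec x (.loop e p) M M (e.cost x M + 1)
  | loop_step {e : Expr} {p : Prog} {M M' M'' : Mem} {t u : ℕ} :
      e.val x M ≠ 0 → Exec x p M M' t → Exec x (.loop e p) M' M'' u →
      Exec x (.loop e p) M M'' (e.cost x M + t + u + 1)

/-- The machine is deterministic: the final memory and the running time are determined by the
program, the input and the initial memory. -/
theorem Exec.deterministic {x : List ℕ} {p : Prog} {M M₁ M₂ : Mem} {t₁ t₂ : ℕ}
    (h₁ : Exec x p M M₁ t₁) (h₂ : Exec x p M M₂ t₂) : M₁ = M₂ ∧ t₁ = t₂ := by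
  induction h₁ generalizing M₂ t₂ with
  | skip => cases h₂; exact ⟨rfl, rfl⟩
  | store => cases h₂; exact ⟨rfl, rfl⟩
  | seq _ _ ih ih' =>
    cases h₂ with
    | seq k k' =>
      obtain ⟨rfl, rfl⟩ := ih k
      obtain ⟨rfl, rfl⟩ := ih' k'
      exact ⟨rfl, rfl⟩
  | cond_true h _ ih =>
    cases h₂ with
    | cond_true _ k => obtain ⟨rfl, rfl⟩ := ih k; exact ⟨rfl, rfl⟩
    | cond_false h' _ => exact absurd h' h
  | cond_false h _ ih =>
    cases h₂ with
    | cond_true h' _ => exact absurd h h'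
    | cond_false _ k => obtain ⟨rfl, rfl⟩ := ih k; exact ⟨rfl, rfl⟩
  | loop_stop h =>
    cases h₂ with
    | loop_stop _ => exact ⟨rfl, rfl⟩
    | loop_step h' _ _ => exact absurd h h'
  | loop_step h _ _ ih ih' =>
    cases h₂ with
    | loop_stop h' => exact absurd h' h
    | loop_step _ k k' =>
      obtain ⟨rfl, rfl⟩ := ih k
      obtain ⟨rfl, rfl⟩ := ih' k'
      exact ⟨rfl, rfl⟩

/-- Started with empty memory on the input `x`, the program `p` halts within time `T` and answers
the question whether `Q` holds: cell `0` finally contains `1` if `Q` holds and `0` otherwise. -/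
def DecidesWithin (p : Prog) (x : List ℕ) (Q : Prop) (T : ℝ) : Prop :=
  ∃ (M : Mem) (t : ℕ), Exec x p (fun _ => 0) M t ∧ (t : ℝ) ≤ T ∧
    (Q → M 0 = 1) ∧ (¬ Q → M 0 = 0)

end RAM

/-- Ball-3-SAT is solved deterministically in time `O*(b ^ r)`: one program decides all instances
in time at most `b ^ r` times a fixed polynomial in the number of variables. -/
def BallSatInTime (b : ℝ) : Prop :=
  ∃ (p : RAM.Prog) (P : Polynomial ℕ), ∀ I : BallInstance,
    RAM.DecidesWithin p I.encode I.Yes ((P.eval I.n : ℕ) * b ^ I.r)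

/-- 3-SAT is solved deterministically in time `O*(b ^ n)`: one program decides all instances
in time at most `b ^ n` times a fixed polynomial in the number `n` of variables. -/
def SatInTime (b : ℝ) : Prop :=
  ∃ (p : RAM.Prog) (P : Polynomial ℕ), ∀ I : SatInstance,
    RAM.DecidesWithin p I.encode I.Yes ((P.eval I.n : ℕ) * b ^ I.n)

/-! ### Expression costs on the random access machine -/

/-! Both parts come from one branching algorithm whose tree is controlled by weights. Write `a` for
`ballBase`. A state that may still flip `k` variables weighs `a ^ k`, times factors for other debts,
and no branching step raises the total weight of the states (`potential_step`).

A variable flipped for good is frozen. Branching over the literals of a single false clause gives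
only `3 ^ k`; the gain comes from false clauses that intersect. If two of them share `x` free
variables and have `y` and `z` private ones, a solution flips a shared variable or one private
variable on each side: `x` branches of cost one and `y * z` branches of cost two. The worst case `x
= 1`, `y = z = 2` is balanced by `1 / a + 4 / a ^ 2 = 1`, the equation that defines `a`. A false
clause with at most two free variables costs no more than `2 / a < 1`.

When no such pair is left, every false clause has three free variables, and two false clauses have
disjoint or equal variable sets. A maximal family of `m` disjoint ones is collected. Every solution
flips a variable in each member, so `m` units of budget are set aside, one flip per member. Which
variable is flipped is guessed by a covering code of words in `{0, 1, 2}` that tolerates two kinds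
of error: the flipped variable is wrong (a switch, of weight 10), or it is right but another one has
to be flipped as well (an extra flip, of weight `4 / a`, besides its unit of budget). The code costs
about `(3 / 1.2) ^ m = 2.5 ^ m`, less than the `a ^ m` set aside.

Then a local search repairs clauses that are false under the current assignment. Relative to the
weight of the state, a free literal costs `1 / a`, a frozen one `0`, the flipped variable of a
member `2 / 10`, another variable of a member `1 / 10 + 1 / 4`. One literal always costs at most `1
/ 5`: if no variable of the clause were frozen or currently flipped, the clause would be false
without the flips of the members, so it would contain a whole active member, flipped variable
included. Since `1 / 5 + 2 / a < 1`, the weight does not grow.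

For 3-SAT the starting assignment is itself chosen by a covering code whose words have individual
radii; the cost per variable is any number above `2 / (1 + 1 / a)`, which is slightly below 1.439.
Both codes come from `exists_code`, the greedy set cover compared with a product-weighted fractional
cover.

Correctness consists of invariants (`step_spec`), soundness (`reach_step`, `accept_spec`) and
completeness (`good_step`: some child still leads to a given solution). The depth of the tree is
linear in `n`, so the weights bound the number of steps of a depth-first search (`DFS.search`). The
machine executes one such step in polynomial time, recomputing the current node from its path; this
rests on a small language of bounded loops (`Pr.comp_exec`) in which every stored number stays below
a capacity polynomial in `n`. -/

theorem Nat.size_le_self (n : ℕ) : n.size ≤ n := Nat.size_le.2 Nat.lt_two_pow_self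

theorem Nat.size_add_le (a b : ℕ) : (a + b).size ≤ a.size + b.size + 1 := by
  rw [Nat.size_le]
  have ha := Nat.lt_size_self a
  have hb := Nat.lt_size_self b
  have h1 : 2 ^ a.size ≤ 2 ^ (a.size + b.size) := Nat.pow_le_pow_right (by norm_num) (by omega)
  have h2 : 2 ^ b.size ≤ 2 ^ (a.size + b.size) := Nat.pow_le_pow_right (by norm_num) (by omega)
  rw [pow_succ]
  omega

theorem Nat.size_mul_le (a b : ℕ) : (a * b).size ≤ a.size + b.size := by
  rw [Nat.size_le, pow_add]
  exact Nat.mul_lt_mul'' (Nat.lt_size_self a) (Nat.lt_size_self b)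

namespace RAM

theorem Exec.loop_exit {x : List ℕ} {e : Expr} {p : Prog} {M : Mem} (h : e.val x M = 0) :
    Exec x (.loop e p) M M (e.cost x M + 1) := by
  constructor
  exact h

/-- Every input access has the form `inp (b + o)`. -/
def Expr.Shifted (o : ℕ) : Expr → Prop
  | .const _ => True
  | .inp a => match a with
    | .add b (.const c) => c = o ∧ b.Shifted o
    | _ => False
  | .mem a => a.Shifted o
  | .add a b => a.Shifted o ∧ b.Shifted o
  | .sub a b => a.Shifted o ∧ b.Shifted o
  | .mul a b => a.Shifted o ∧ b.Shifted o
  | .div a b => a.Shifted o ∧ b.Shifted o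

/-- All memory cells, and all input words from position `o` on, are at most `V`. -/
structure Bounded (o V : ℕ) (x : List ℕ) (M : Mem) : Prop where
  inp : ∀ i, o ≤ i → x.getD i 0 ≤ V
  mem : ∀ a, M a ≤ V

/-- Cells and input words have at most `V` bits, crudely, and the bit length of a result is at most
the sum of those of the operands plus one. Hence lengths are linear and costs quadratic in `V + 1`.
The condition `Shifted o` keeps leading input words, such as an unbounded radius, out of the
estimate. -/
theorem Expr.cost_le (o : ℕ) : ∀ e : Expr, e.Shifted o → ∃ C : ℕ, ∀ V x M, Bounded o V x M →
    (e.val x M).size ≤ C * (V + 1) ∧ e.cost x M ≤ C * (V + 1) ^ 2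
  | .const c, _ => ⟨c.size + 1, fun V x M _ => by
      simp only [Expr.val, Expr.cost]
      have e1 : 1 ≤ (V + 1) ^ 2 := Nat.one_le_pow _ _ (by omega)
      exact ⟨by nlinarith, by nlinarith⟩⟩
  | .inp (.add b (.const c)), h => by
      obtain ⟨rfl, h⟩ := h
      obtain ⟨C, hC⟩ := cost_le c b h
      refine ⟨3 * C + 3 * c.size + 6, fun V x M hB => ?_⟩
      obtain ⟨h1, h2⟩ := hC V x M hB
      have h3 := hB.inp (b.val x M + c) (by omega)
      have h4 := (Nat.size_le_self (x.getD (b.val x M + c) 0)).trans h3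
      have h5 := Nat.size_add_le (b.val x M) c
      simp only [Expr.val, Expr.cost]
      have e1 : C * (V + 1) ≤ C * (V + 1) ^ 2 := Nat.mul_le_mul_left _ (Nat.le_self_pow (by norm_num) _)
      have e2 : V + 1 ≤ (V + 1) ^ 2 := Nat.le_self_pow (by norm_num) _
      have e3 : c.size ≤ c.size * (V + 1) ^ 2 := Nat.le_mul_of_pos_right _ (by positivity)
      exact ⟨by nlinarith, by nlinarith⟩
  | .mem a, h => by
      obtain ⟨C, hC⟩ := cost_le o a h
      refine ⟨2 * C + 2, fun V x M hB => ?_⟩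
      obtain ⟨h1, h2⟩ := hC V x M hB
      have h4 := (Nat.size_le_self _).trans (hB.mem (a.val x M))
      simp only [Expr.val, Expr.cost]
      have e1 : C * (V + 1) ≤ C * (V + 1) ^ 2 := Nat.mul_le_mul_left _ (Nat.le_self_pow (by norm_num) _)
      have e2 : V + 1 ≤ (V + 1) ^ 2 := Nat.le_self_pow (by norm_num) _
      exact ⟨by nlinarith, by nlinarith⟩
  | .add a b, h => by
      obtain ⟨C, hC⟩ := cost_le o a h.1
      obtain ⟨D, hD⟩ := cost_le o b h.2
      refine ⟨2 * C + 2 * D + 1, fun V x M hB => ?_⟩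
      obtain ⟨h1, h2⟩ := hC V x M hB
      obtain ⟨h3, h4⟩ := hD V x M hB
      have h5 := Nat.size_add_le (a.val x M) (b.val x M)
      simp only [Expr.val, Expr.cost]
      have e1 : C * (V + 1) ≤ C * (V + 1) ^ 2 := Nat.mul_le_mul_left _ (Nat.le_self_pow (by norm_num) _)
      have e2 : D * (V + 1) ≤ D * (V + 1) ^ 2 := Nat.mul_le_mul_left _ (Nat.le_self_pow (by norm_num) _)
      exact ⟨by nlinarith, by nlinarith⟩
  | .sub a b, h => by
      obtain ⟨C, hC⟩ := cost_le o a h.1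
      obtain ⟨D, hD⟩ := cost_le o b h.2
      refine ⟨2 * C + 2 * D + 1, fun V x M hB => ?_⟩
      obtain ⟨h1, h2⟩ := hC V x M hB
      obtain ⟨h3, h4⟩ := hD V x M hB
      have h5 := Nat.size_le_size (Nat.sub_le (a.val x M) (b.val x M))
      simp only [Expr.val, Expr.cost]
      have e1 : C * (V + 1) ≤ C * (V + 1) ^ 2 := Nat.mul_le_mul_left _ (Nat.le_self_pow (by norm_num) _)
      have e2 : D * (V + 1) ≤ D * (V + 1) ^ 2 := Nat.mul_le_mul_left _ (Nat.le_self_pow (by norm_num) _)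
      exact ⟨by nlinarith, by nlinarith⟩
  | .mul a b, h => by
      obtain ⟨C, hC⟩ := cost_le o a h.1
      obtain ⟨D, hD⟩ := cost_le o b h.2
      refine ⟨C + D + (C + 1) * (D + 1), fun V x M hB => ?_⟩
      obtain ⟨h1, h2⟩ := hC V x M hB
      obtain ⟨h3, h4⟩ := hD V x M hB
      have h5 := Nat.size_mul_le (a.val x M) (b.val x M)
      simp only [Expr.val, Expr.cost]
      have e1 : (a.val x M).size + 1 ≤ (C + 1) * (V + 1) := by nlinarith
      have e2 : (b.val x M).size + 1 ≤ (D + 1) * (V + 1) := by nlinarith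
      have e3 := Nat.mul_le_mul e1 e2
      refine ⟨?_, by nlinarith⟩
      calc _ ≤ (C + D) * (V + 1) := by nlinarith
        _ ≤ _ := Nat.mul_le_mul_right _ (by omega)
  | .div a b, h => by
      obtain ⟨C, hC⟩ := cost_le o a h.1
      obtain ⟨D, hD⟩ := cost_le o b h.2
      refine ⟨C + D + (C + 1) * (D + 1), fun V x M hB => ?_⟩
      obtain ⟨h1, h2⟩ := hC V x M hB
      obtain ⟨h3, h4⟩ := hD V x M hB
      have h5 := Nat.size_le_size (Nat.div_le_self (a.val x M) (b.val x M))
      simp only [Expr.val, Expr.cost]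
      have e1 : (a.val x M).size + 1 ≤ (C + 1) * (V + 1) := by nlinarith
      have e2 : (b.val x M).size + 1 ≤ (D + 1) * (V + 1) := by nlinarith
      have e3 := Nat.mul_le_mul e1 e2
      refine ⟨?_, by nlinarith⟩
      calc _ ≤ C * (V + 1) := by omega
        _ ≤ _ := Nat.mul_le_mul_right _ (by omega)

theorem store_le (o : ℕ) {a e : Expr} (ha : a.Shifted o) (he : e.Shifted o) :
    ∃ C : ℕ, ∀ V x M, Bounded o V x M → ∃ t ≤ C * (V + 1) ^ 2,
      Exec x (.store a e) M (Function.update M (a.val x M) (e.val x M)) t := by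
  obtain ⟨C, hC⟩ := a.cost_le o ha
  obtain ⟨D, hD⟩ := e.cost_le o he
  refine ⟨2 * C + 2 * D + 1, fun V x M hB => ⟨_, ?_, Exec.store a e M⟩⟩
  obtain ⟨h1, h2⟩ := hC V x M hB
  obtain ⟨h3, h4⟩ := hD V x M hB
  have e1 : C * (V + 1) ≤ C * (V + 1) ^ 2 := Nat.mul_le_mul_left _ (Nat.le_self_pow (by norm_num) _)
  have e2 : D * (V + 1) ≤ D * (V + 1) ^ 2 := Nat.mul_le_mul_left _ (Nat.le_self_pow (by norm_num) _)
  nlinarith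

end RAM

/-! ### A language of bounded loops over named arrays -/

namespace HL

/-- Finitely many arrays of natural numbers, addressed by their number and an index. -/
abbrev Store : Type := ℕ → ℕ → ℕ

/-- Write `v` into the cell `i` of the array `k`. -/
def Store.set (S : Store) (k i v : ℕ) : Store := Function.update S k (Function.update (S k) i v)

theorem Store.set_ne (S : Store) {k l : ℕ} (i v : ℕ) (h : l ≠ k) : S.set k i v l = S l := by
  simp [Store.set, h]

theorem Store.set_eq (S : Store) (k i v : ℕ) : S.set k i v k = Function.update (S k) i v := by
  simp [Store.set]

theorem Store.set_apply (S : Store) (k i v l j : ℕ) :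
    S.set k i v l j = if l = k ∧ j = i then v else S l j := by
  by_cases h : l = k
  · subst h; by_cases h' : j = i <;> simp [Store.set, h']
  · simp [S.set_ne i v h, h]

/-- Expressions. -/
inductive Ex : Type
  | const (c : ℕ)
  /-- the cell of the array `k` at the computed index -/
  | get (k : ℕ) (e : Ex)
  | inp (e : Ex)
  | add (a b : Ex)
  | sub (a b : Ex)
  | mul (a b : Ex)
  | div (a b : Ex)
  /-- the minimum with the cell `0` of the array `0` -/
  | cap (e : Ex)
  | eq (a b : Ex)
  | lt (a b : Ex)
  | ite (c a b : Ex)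

@[simp] def Ex.eval (y : ℕ → ℕ) (S : Store) : Ex → ℕ
  | .const c => c
  | .get k e => S k (e.eval y S)
  | .inp e => y (e.eval y S)
  | .add a b => a.eval y S + b.eval y S
  | .sub a b => a.eval y S - b.eval y S
  | .mul a b => a.eval y S * b.eval y S
  | .div a b => a.eval y S / b.eval y S
  | .cap e => min (e.eval y S) (S 0 0)
  | .eq a b => if a.eval y S = b.eval y S then 1 else 0
  | .lt a b => if a.eval y S < b.eval y S then 1 else 0
  | .ite c a b => if c.eval y S ≠ 0 then a.eval y S else b.eval y S

/-- The value is at most `V` if the constants, the store and the input are. -/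
@[simp] def Ex.Small (V : ℕ) : Ex → Prop
  | .const c => c ≤ V
  | .get _ _ => True
  | .inp _ => True
  -- Sums and products may exceed the bound, so a stored value has to wrap them in `cap`. Inside
  -- indices and comparisons they are unrestricted.
  | .add _ _ => False
  | .sub a _ => a.Small V
  | .mul _ _ => False
  | .div a _ => a.Small V
  | .cap _ => True
  | .eq _ _ => True
  | .lt _ _ => True
  | .ite _ a b => a.Small V ∧ b.Small V

/-- Only arrays with numbers below `K` are used. -/
@[simp] def Ex.Below (K : ℕ) : Ex → Prop
  | .const _ => True
  | .get k e => k < K ∧ e.Below K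
  | .inp e => e.Below K
  | .add a b => a.Below K ∧ b.Below K
  | .sub a b => a.Below K ∧ b.Below K
  | .mul a b => a.Below K ∧ b.Below K
  | .div a b => a.Below K ∧ b.Below K
  | .cap e => e.Below K
  | .eq a b => a.Below K ∧ b.Below K
  | .lt a b => a.Below K ∧ b.Below K
  | .ite c a b => c.Below K ∧ a.Below K ∧ b.Below K

theorem Ex.eval_le {V : ℕ} {y : ℕ → ℕ} {S : Store} (hV : 1 ≤ V) (hy : ∀ i, y i ≤ V)
    (hS : ∀ k i, S k i ≤ V) : ∀ e : Ex, e.Small V → e.eval y S ≤ V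
  | .const _, h => h
  | .get k _, _ => hS k _
  | .inp _, _ => hy _
  | .sub a _, h => (Nat.sub_le _ _).trans (eval_le hV hy hS a h)
  | .div a _, h => (Nat.div_le_self _ _).trans (eval_le hV hy hS a h)
  | .cap _, _ => (min_le_right _ _).trans (hS 0 0)
  | .eq _ _, _ => by simp only [Ex.eval]; split <;> omega
  | .lt _ _, _ => by simp only [Ex.eval]; split <;> omega
  | .ite _ a b, h => by
    simp only [Ex.eval]; split
    exacts [eval_le hV hy hS a h.1, eval_le hV hy hS b h.2]

/-- Translation to machine expressions: array `k` is stored in the cells `K * i + k`, and the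
first `o` input words are skipped. -/
def Ex.comp (o K : ℕ) : Ex → RAM.Expr
  | .const c => .const c
  | .get k e => .mem (.add (.mul (.const K) (e.comp o K)) (.const k))
  | .inp e => .inp (.add (e.comp o K) (.const o))
  | .add a b => .add (a.comp o K) (b.comp o K)
  | .sub a b => .sub (a.comp o K) (b.comp o K)
  | .mul a b => .mul (a.comp o K) (b.comp o K)
  | .div a b => .div (a.comp o K) (b.comp o K)
  -- Machine expressions cannot branch, so truncated subtraction does the work: `x - (x - c)` is the
  -- minimum, and `1 - (1 - x)` is the truth value of `x ≠ 0`.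
  | .cap e => .sub (e.comp o K) (.sub (e.comp o K) (.mem (.const 0)))
  | .eq a b => .sub (.const 1) (.add (.sub (a.comp o K) (b.comp o K)) (.sub (b.comp o K) (a.comp o K)))
  | .lt a b => .sub (.const 1) (.sub (.const 1) (.sub (b.comp o K) (a.comp o K)))
  | .ite c a b => .add (.mul (.sub (.const 1) (.sub (.const 1) (c.comp o K))) (a.comp o K))
      (.mul (.sub (.const 1) (c.comp o K)) (b.comp o K))

theorem Ex.comp_shifted (o K : ℕ) : ∀ e : Ex, (e.comp o K).Shifted o
  | .const _ => trivial
  | .get _ e => ⟨⟨trivial, comp_shifted o K e⟩, trivial⟩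
  | .inp e => ⟨rfl, comp_shifted o K e⟩
  | .add a b => ⟨comp_shifted o K a, comp_shifted o K b⟩
  | .sub a b => ⟨comp_shifted o K a, comp_shifted o K b⟩
  | .mul a b => ⟨comp_shifted o K a, comp_shifted o K b⟩
  | .div a b => ⟨comp_shifted o K a, comp_shifted o K b⟩
  | .cap e => ⟨comp_shifted o K e, comp_shifted o K e, trivial⟩
  | .eq a b => ⟨trivial, ⟨comp_shifted o K a, comp_shifted o K b⟩, comp_shifted o K b,
      comp_shifted o K a⟩
  | .lt a b => ⟨trivial, trivial, comp_shifted o K b, comp_shifted o K a⟩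
  | .ite c a b => ⟨⟨⟨trivial, trivial, comp_shifted o K c⟩, comp_shifted o K a⟩,
      ⟨trivial, comp_shifted o K c⟩, comp_shifted o K b⟩

/-- The memory `M` represents the store `S`. -/
def Represents (K : ℕ) (M : RAM.Mem) (S : Store) : Prop := ∀ k < K, ∀ i, M (K * i + k) = S k i

/-- From position `o` on, the input `x` reads `y`. -/
def Reads (o : ℕ) (x : List ℕ) (y : ℕ → ℕ) : Prop := ∀ i, x.getD (i + o) 0 = y i

theorem Ex.comp_val {o K : ℕ} (hK : 0 < K) {x : List ℕ} {y : ℕ → ℕ} {M : RAM.Mem} {S : Store}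
    (hx : Reads o x y) (hM : Represents K M S) :
    ∀ e : Ex, e.Below K → (e.comp o K).val x M = e.eval y S
  | .const _, _ => rfl
  | .get k e, h => by simp [comp, RAM.Expr.val, comp_val hK hx hM e h.2, hM k h.1]
  | .inp e, h => by
    simp only [comp, RAM.Expr.val, comp_val hK hx hM e h, Ex.eval]; exact hx _
  | .add a b, h => by simp [comp, RAM.Expr.val, comp_val hK hx hM a h.1, comp_val hK hx hM b h.2]
  | .sub a b, h => by simp [comp, RAM.Expr.val, comp_val hK hx hM a h.1, comp_val hK hx hM b h.2]
  | .mul a b, h => by simp [comp, RAM.Expr.val, comp_val hK hx hM a h.1, comp_val hK hx hM b h.2]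
  | .div a b, h => by simp [comp, RAM.Expr.val, comp_val hK hx hM a h.1, comp_val hK hx hM b h.2]
  | .cap e, h => by
    have := hM 0 hK 0
    simp only [mul_zero, add_zero] at this
    simp only [comp, RAM.Expr.val, comp_val hK hx hM e h, this, Ex.eval]
    omega
  | .eq a b, h => by
    simp only [comp, RAM.Expr.val, comp_val hK hx hM a h.1, comp_val hK hx hM b h.2, Ex.eval]
    split <;> omega
  | .lt a b, h => by
    simp only [comp, RAM.Expr.val, comp_val hK hx hM a h.1, comp_val hK hx hM b h.2, Ex.eval]
    split <;> omega
  | .ite c a b, h => by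
    simp only [comp, RAM.Expr.val, comp_val hK hx hM c h.1, comp_val hK hx hM a h.2.1,
      comp_val hK hx hM b h.2.2, Ex.eval]
    split
    · have h1 : 1 - (1 - c.eval y S) = 1 := by omega
      have h2 : 1 - c.eval y S = 0 := by omega
      rw [h2]; simp
    · have h1 : c.eval y S = 0 := by omega
      simp [h1]

/-- Programs. -/
inductive Pr : Type
  | skip
  /-- write the value of `e` into the array `k` at the index `i` -/
  | set (k : ℕ) (i e : Ex)
  | seq (p q : Pr)
  | ite (e : Ex) (p q : Pr)
  /-- run `p` for `N - 1, …, 0` in the cell `0` of the array `k`, where `N` is the value of `e` -/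
  | loop (k : ℕ) (e : Ex) (p : Pr)

/-- The counter is written before each round and is `0` at the end, exactly as the machine loop
leaves it. -/
def loopDown (f : Store → Store) (k : ℕ) : ℕ → Store → Store
  | 0, S => S.set k 0 0
  | N + 1, S => loopDown f k N (f (S.set k 0 N))

@[simp] def Pr.den (y : ℕ → ℕ) : Pr → Store → Store
  | .skip, S => S
  | .set k i e, S => S.set k (i.eval y S) (e.eval y S)
  | .seq p q, S => q.den y (p.den y S)
  | .ite e p q, S => if e.eval y S ≠ 0 then p.den y S else q.den y S
  | .loop k e p, S => loopDown (p.den y) k (e.eval y S) S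

/-- The program does not write to the array `k`. -/
@[simp] def Pr.Keeps (k : ℕ) : Pr → Prop
  | .skip => True
  | .set l _ _ => k ≠ l
  | .seq p q => p.Keeps k ∧ q.Keeps k
  | .ite _ p q => p.Keeps k ∧ q.Keeps k
  | .loop l _ p => k ≠ l ∧ p.Keeps k

/-- Well-formed programs: the values written are at most `V`, and loops do not change their
counters. -/
@[simp] def Pr.Ok (K V : ℕ) : Pr → Prop
  | .skip => True
  | .set k i e => k < K ∧ i.Below K ∧ e.Below K ∧ e.Small V
  | .seq p q => p.Ok K V ∧ q.Ok K V
  | .ite e p q => e.Below K ∧ p.Ok K V ∧ q.Ok K V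
  | .loop k e p => k < K ∧ e.Below K ∧ e.Small V ∧ p.Keeps k ∧ p.Ok K V

theorem loopDown_keeps {f : Store → Store} {k l : ℕ} (h : l ≠ k) (hf : ∀ S, f S l = S l) :
    ∀ N S, loopDown f k N S l = S l
  | 0, S => by rw [loopDown, S.set_ne _ _ h]
  | N + 1, S => by rw [loopDown, loopDown_keeps h hf, hf, S.set_ne _ _ h]

theorem Pr.den_keeps {y : ℕ → ℕ} {k : ℕ} : ∀ (p : Pr), p.Keeps k → ∀ S, p.den y S k = S k
  | .skip, _, _ => rfl
  | .set l _ _, h, S => S.set_ne _ _ h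
  | .seq p q, h, S => by simp only [Pr.den]; rw [den_keeps q h.2, den_keeps p h.1]
  | .ite _ p q, h, S => by simp only [Pr.den]; split; exacts [den_keeps p h.1 S, den_keeps q h.2 S]
  | .loop l _ p, h, S => loopDown_keeps h.1 (den_keeps p h.2) _ _

/-- An invariant rule for loops. -/
theorem loopDown_induction {f : Store → Store} {k : ℕ} (I : ℕ → Store → Prop)
    (step : ∀ i S, I (i + 1) S → I i (f (S.set k 0 i)))
    (last : ∀ S, I 0 S → I 0 (S.set k 0 0)) : ∀ N S, I N S → I 0 (loopDown f k N S)
  | 0, S, h => last S h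
  | N + 1, S, h => loopDown_induction I step last N _ (step N S h)

/-- Translation to machine programs. -/
def Pr.comp (o K : ℕ) : Pr → RAM.Prog
  | .skip => .skip
  | .set k i e => .store (.add (.mul (.const K) (i.comp o K)) (.const k)) (e.comp o K)
  | .seq p q => .seq (p.comp o K) (q.comp o K)
  | .ite e p q => .cond (e.comp o K) (p.comp o K) (q.comp o K)
  | .loop k e p => .seq (.store (.const k) (e.comp o K)) (.loop (.mem (.const k))
      (.seq (.store (.const k) (.sub (.mem (.const k)) (.const 1))) (p.comp o K)))

/-- Division by `K` with remainder recovers index and array number from an address, so different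
cells never collide. -/
theorem Represents.update {K k : ℕ} {M : RAM.Mem} {S : Store} (h : Represents K M S) (hk : k < K)
    (i v : ℕ) : Represents K (Function.update M (K * i + k) v) (S.set k i v) := by
  intro l hl j
  rw [Store.set_apply, Function.update_apply, h l hl j]
  have : K * j + l = K * i + k ↔ l = k ∧ j = i := by
    constructor
    · intro e
      have e1 := congrArg (· % K) e
      have e2 := congrArg (· / K) e
      simp only [Nat.mul_add_mod, Nat.mod_eq_of_lt hl, Nat.mod_eq_of_lt hk] at e1
      simp only [Nat.mul_add_div (by omega : 0 < K), Nat.div_eq_of_lt hl, Nat.div_eq_of_lt hk] at e2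
      omega
    · rintro ⟨rfl, rfl⟩; rfl
  simp only [this]

theorem Represents.bounded {o K V : ℕ} (hK : 0 < K) {x : List ℕ} {y : ℕ → ℕ} {M : RAM.Mem}
    {S : Store} (hx : Reads o x y) (hM : Represents K M S) (hy : ∀ i, y i ≤ V)
    (hS : ∀ k i, S k i ≤ V) : RAM.Bounded o V x M where
  inp i hi := by rw [← Nat.sub_add_cancel hi, hx]; exact hy _
  mem a := by
    rw [← Nat.div_add_mod a K, hM _ (Nat.mod_lt _ hK)]
    exact hS _ _

theorem Store.set_le {V : ℕ} {S : Store} (hS : ∀ k i, S k i ≤ V) {v : ℕ} (hv : v ≤ V)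
    (k i l j : ℕ) : S.set k i v l j ≤ V := by
  rw [Store.set_apply]; split; exacts [hv, hS l j]

/-- A setting in which programs are run: the store `S`, represented by `M`, and the input are
bounded by `V`. -/
structure Setting (o K V : ℕ) (x : List ℕ) (y : ℕ → ℕ) (M : RAM.Mem) (S : Store) : Prop where
  reads : Reads o x y
  represents : Represents K M S
  input_le : ∀ i, y i ≤ V
  store_le : ∀ k i, S k i ≤ V
  one_le : 1 ≤ V

theorem Setting.bounded {o K V : ℕ} (hK : 0 < K) {x : List ℕ} {y : ℕ → ℕ} {M : RAM.Mem} {S : Store}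
    (h : Setting o K V x y M S) : RAM.Bounded o V x M :=
  h.represents.bounded hK h.reads h.input_le h.store_le

/-- Well-formed programs are translated to programs that run in polynomial time. -/
theorem Pr.comp_exec (o K : ℕ) (hK : 0 < K) : ∀ p : Pr, ∃ C D : ℕ, ∀ V x y M S,
    p.Ok K V → Setting o K V x y M S → ∃ M' t, RAM.Exec x (p.comp o K) M M' t ∧
      Setting o K V x y M' (p.den y S) ∧ t ≤ C * (V + 1) ^ D
  | .skip => ⟨1, 0, fun V x y M S _ h => ⟨M, 1, .skip M, h, by simp⟩⟩
  | .set k i e => by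
    obtain ⟨C, hC⟩ := RAM.store_le o
      (a := .add (.mul (.const K) (i.comp o K)) (.const k)) (e := e.comp o K)
      ⟨⟨trivial, i.comp_shifted o K⟩, trivial⟩ (e.comp_shifted o K)
    refine ⟨C, 2, fun V x y M S hp h => ?_⟩
    obtain ⟨t, ht, hE⟩ := hC V x M (h.bounded hK)
    simp only [RAM.Expr.val, i.comp_val hK h.reads h.represents hp.2.1,
      e.comp_val hK h.reads h.represents hp.2.2.1] at hE
    exact ⟨_, t, hE, ⟨h.reads, h.represents.update hp.1 _ _, h.input_le,
      Store.set_le h.store_le (e.eval_le h.one_le h.input_le h.store_le hp.2.2.2) _ _, h.one_le⟩, ht⟩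
  | .seq p q => by
    obtain ⟨C, D, hp⟩ := comp_exec o K hK p
    obtain ⟨C', D', hq⟩ := comp_exec o K hK q
    refine ⟨C + C' + 1, D + D', fun V x y M S hok h => ?_⟩
    obtain ⟨M', t, h1, h2, h3⟩ := hp V x y M S hok.1 h
    obtain ⟨M'', u, k1, k2, k3⟩ := hq V x y M' _ hok.2 h2
    refine ⟨M'', _, .seq h1 k1, k2, ?_⟩
    have e1 : (V + 1) ^ D ≤ (V + 1) ^ (D + D') := Nat.pow_le_pow_right (by omega) (by omega)
    have e2 : (V + 1) ^ D' ≤ (V + 1) ^ (D + D') := Nat.pow_le_pow_right (by omega) (by omega)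
    have e3 : 1 ≤ (V + 1) ^ (D + D') := Nat.one_le_pow _ _ (by omega)
    nlinarith
  | .ite e p q => by
    obtain ⟨C, D, hp⟩ := comp_exec o K hK p
    obtain ⟨C', D', hq⟩ := comp_exec o K hK q
    obtain ⟨B, hB⟩ := (e.comp o K).cost_le o (e.comp_shifted o K)
    refine ⟨B + C + C' + 1, 2 + D + D', fun V x y M S hok h => ?_⟩
    have e1 : (V + 1) ^ D ≤ (V + 1) ^ (2 + D + D') := Nat.pow_le_pow_right (by omega) (by omega)
    have e2 : (V + 1) ^ D' ≤ (V + 1) ^ (2 + D + D') := Nat.pow_le_pow_right (by omega) (by omega)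
    have e3 : (V + 1) ^ 2 ≤ (V + 1) ^ (2 + D + D') := Nat.pow_le_pow_right (by omega) (by omega)
    have e4 : 1 ≤ (V + 1) ^ (2 + D + D') := Nat.one_le_pow _ _ (by omega)
    have hc := (hB V x M (h.bounded hK)).2
    have hv := e.comp_val hK h.reads h.represents hok.1
    by_cases he : e.eval y S ≠ 0
    · obtain ⟨M', t, h1, h2, h3⟩ := hp V x y M S hok.2.1 h
      refine ⟨M', _, .cond_true (by rwa [hv]) h1, by simpa [he] using h2, ?_⟩
      nlinarith
    · obtain ⟨M', t, h1, h2, h3⟩ := hq V x y M S hok.2.2 h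
      push Not at he
      refine ⟨M', _, .cond_false (by rwa [hv]) h1, by simpa [he] using h2, ?_⟩
      nlinarith
  | .loop k e p => by
    obtain ⟨C, D, hp⟩ := comp_exec o K hK p
    obtain ⟨A, hA⟩ := RAM.store_le o (a := .const k) (e := e.comp o K) trivial (e.comp_shifted o K)
    obtain ⟨A', hA'⟩ := RAM.store_le o (a := .const k) (e := .sub (.mem (.const k)) (.const 1))
      trivial ⟨trivial, trivial⟩
    obtain ⟨B, hB⟩ := (RAM.Expr.mem (.const k)).cost_le o trivial
    refine ⟨A + A' + B + C + B + 4, D + 3, fun V x y M S hok h => ?_⟩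
    obtain ⟨hk, heb, hes, hkeep, hpok⟩ := hok
    -- The machine tests and decrements the counter cell itself. As the body keeps that array, the
    -- value `N` means exactly `N` remaining rounds.
    have hw : ∀ N ≤ V, ∀ M S, Setting o K V x y M S → S k 0 = N → ∃ M' t,
        RAM.Exec x (.loop (.mem (.const k)) (.seq (.store (.const k)
          (.sub (.mem (.const k)) (.const 1))) (p.comp o K))) M M' t ∧
        Setting o K V x y M' (loopDown (p.den y) k N S) ∧
        t ≤ (N + 1) * ((A' + B + C + 3) * (V + 1) ^ (D + 2)) := by
      intro N
      have e1 : (V + 1) ^ D ≤ (V + 1) ^ (D + 2) := Nat.pow_le_pow_right (by omega) (by omega)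
      have e2 : (V + 1) ^ 2 ≤ (V + 1) ^ (D + 2) := Nat.pow_le_pow_right (by omega) (by omega)
      have e3 : 1 ≤ (V + 1) ^ (D + 2) := Nat.one_le_pow _ _ (by omega)
      induction N with
      | zero =>
        intro _ M S h hS
        have hv : (RAM.Expr.mem (.const k)).val x M = 0 := by
          simpa [RAM.Expr.val, hS] using h.represents k hk 0
        refine ⟨M, _, .loop_exit hv, ?_, ?_⟩
        · have : S.set k 0 0 = S := by
            funext l j
            rw [Store.set_apply]
            split_ifs with hc
            · rw [hc.1, hc.2, hS]
            · rfl
          rwa [loopDown, this]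
        · have := (hB V x M (h.bounded hK)).2
          nlinarith
      | succ N ih =>
        intro hN M S h hS
        have hm : M k = N + 1 := by simpa [hS] using h.represents k hk 0
        have hv : (RAM.Expr.mem (.const k)).val x M ≠ 0 := by simp [RAM.Expr.val, hm]
        obtain ⟨t, ht, hE⟩ := hA' V x M (h.bounded hK)
        simp only [RAM.Expr.val, hm, Nat.add_sub_cancel] at hE
        have hset : Setting o K V x y (Function.update M k N) (S.set k 0 N) :=
          ⟨h.reads, by simpa using h.represents.update hk 0 N, h.input_le,
            Store.set_le h.store_le (by omega) _ _, h.one_le⟩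
        obtain ⟨M', u, h1, h2, h3⟩ := hp V x y _ _ hpok hset
        have hk' : p.den y (S.set k 0 N) k 0 = N := by
          rw [Pr.den_keeps p hkeep, Store.set_apply, if_pos ⟨rfl, rfl⟩]
        obtain ⟨M'', w, k1, k2, k3⟩ := ih (by omega) M' _ h2 hk'
        refine ⟨M'', _, .loop_step hv (.seq hE h1) k1, k2, ?_⟩
        have := (hB V x M (h.bounded hK)).2
        nlinarith
    obtain ⟨t, ht, hE⟩ := hA V x M (h.bounded hK)
    simp only [RAM.Expr.val, e.comp_val hK h.reads h.represents heb] at hE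
    have hN := e.eval_le h.one_le h.input_le h.store_le hes
    have hset : Setting o K V x y (Function.update M k (e.eval y S)) (S.set k 0 (e.eval y S)) :=
      ⟨h.reads, by simpa using h.represents.update hk 0 (e.eval y S), h.input_le,
        Store.set_le h.store_le hN _ _, h.one_le⟩
    obtain ⟨M', u, h1, h2, h3⟩ := hw _ hN _ _ hset (by rw [Store.set_apply, if_pos ⟨rfl, rfl⟩])
    -- Storing the initial counter has no counterpart in `loopDown`, but it is overwritten at once.
    have hl : loopDown (p.den y) k (e.eval y S) (S.set k 0 (e.eval y S)) =
        loopDown (p.den y) k (e.eval y S) S := by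
      have hss : ∀ a b, (S.set k 0 a).set k 0 b = S.set k 0 b := by
        intro a b
        funext l j
        simp only [Store.set_apply]
        split_ifs <;> rfl
      cases e.eval y S <;> simp only [loopDown, hss]
    refine ⟨M', _, .seq hE h1, by rw [Pr.den, ← hl]; exact h2, ?_⟩
    have e2 : (V + 1) ^ 2 ≤ (V + 1) ^ (D + 3) := Nat.pow_le_pow_right (by omega) (by omega)
    have e3 : 1 ≤ (V + 1) ^ (D + 3) := Nat.one_le_pow _ _ (by omega)
    have e4 : (e.eval y S + 1) * ((A' + B + C + 3) * (V + 1) ^ (D + 2)) ≤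
        (A' + B + C + 3) * (V + 1) ^ (D + 3) := by
      rw [pow_succ (V + 1) (D + 2)]
      calc _ ≤ (V + 1) * ((A' + B + C + 3) * (V + 1) ^ (D + 2)) := Nat.mul_le_mul_right _ (by omega)
        _ = _ := by ring
    nlinarith

end HL


/-! ### The search procedure -/

/-- The larger root of `x ^ 2 - x - 4`. -/
noncomputable def ballBase : ℝ := (1 + √17) / 2

theorem ballBase_sq : ballBase ^ 2 = ballBase + 4 := by
  have h : √17 ^ 2 = (17 : ℝ) := Real.sq_sqrt (by norm_num)
  rw [ballBase]; linarith

theorem lt_ballBase : 2.5615 < ballBase := by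
  have h : (4.123 : ℝ) < √17 := Real.lt_sqrt_of_sq_lt (by norm_num)
  rw [ballBase]; linarith

theorem ballBase_lt : ballBase < 2.5616 := by
  have h : √17 < 4.1232 := (Real.sqrt_lt' (by norm_num)).2 (by norm_num)
  rw [ballBase]; linarith

theorem ballBase_pos : 0 < ballBase := by linarith [lt_ballBase]

namespace Search

/-- A formula whose clauses are padded to three literals, and two families of covering codes. The
`q`-th literal of the clause `z` is `lit (3 * z + q)`; the literal `2 * n` is always false. -/
structure Data where
  n : ℕ
  c : ℕ
  lit : ℕ → ℕ
  cap : ℕ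
  /-- block length, size, radii and words of the code for assignments -/
  tA : ℕ
  sizeA : ℕ
  rad : ℕ → ℕ
  bit : ℕ → ℕ
  /-- block length, size, numbers of switches and of extra flips, and words of the code for families
  of disjoint clauses -/
  tC : ℕ
  sizeC : ℕ
  sw : ℕ → ℕ
  ex : ℕ → ℕ
  pos : ℕ → ℕ

/-- The states of the search. A variable `v` with `mark v = 0` is free, with `mark v = 1` it has been
flipped for good, and with `mark v = o + 2` it belongs to the family member `o`, which consists of the
variables `tv (3 * o + p)` for `p < 3`, and of which the variable with `p = rp o` is currently
flipped. -/
structure St where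
  ph : ℕ
  st : ℕ
  k : ℕ
  s : ℕ
  j : ℕ
  g : ℕ
  i : ℕ
  m : ℕ
  val : ℕ → ℕ
  mark : ℕ → ℕ
  tv : ℕ → ℕ
  rp : ℕ → ℕ

/-- The least `z < N` with `P z`, if there is one. -/
noncomputable def scan (P : ℕ → Prop) : ℕ → ℕ → ℕ
  | 0, r => r
  | i + 1, r => open Classical in scan P i (if P i then i else r)

noncomputable def first (P : ℕ → Prop) (N : ℕ) : ℕ := scan P N N

theorem scan_spec (P : ℕ → Prop) : ∀ i r, (scan P i r = r ∧ ∀ z < i, ¬ P z) ∨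
    (scan P i r < i ∧ P (scan P i r))
  | 0, r => by simp [scan]
  | i + 1, r => by
    by_cases h : P i
    · simp only [scan, h, if_true]
      rcases scan_spec P i i with ⟨h1, _⟩ | ⟨h1, h2⟩
      · exact .inr (by rw [h1]; exact ⟨by omega, h⟩)
      · exact .inr ⟨by omega, h2⟩
    · simp only [scan, h, if_false]
      rcases scan_spec P i r with ⟨h1, h2⟩ | ⟨h1, h2⟩
      · refine .inl ⟨h1, fun z hz => ?_⟩
        rcases Nat.lt_succ_iff_lt_or_eq.1 hz with hz | rfl
        exacts [h2 z hz, h]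
      · exact .inr ⟨by omega, h2⟩

theorem first_spec {P : ℕ → Prop} {N : ℕ} (h : first P N < N) : P (first P N) := by
  rcases scan_spec P N N with ⟨h1, _⟩ | ⟨_, h2⟩
  · rw [first] at h; omega
  · exact h2

theorem of_first {P : ℕ → Prop} {N : ℕ} (h : ¬ first P N < N) {z : ℕ} (hz : z < N) : ¬ P z := by
  rcases scan_spec P N N with ⟨_, h1⟩ | ⟨h1, _⟩
  · exact h1 z hz
  · rw [first] at h; omega

variable (I : Data)

/-- The variable of the `q`-th literal of the clause `z`. -/
def Data.v (z q : ℕ) : ℕ := I.lit (3 * z + q) / 2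

/-- The variable `x` occurs in the clause `z`. -/
def Data.Mem (z x : ℕ) : Prop := I.v z 0 = x ∨ I.v z 1 = x ∨ I.v z 2 = x

def LitFalse (f : ℕ → ℕ) (l : ℕ) : Prop := f (l / 2) ≠ l % 2

/-- All literals of the clause `z` are false under `f`. -/
def Data.False (f : ℕ → ℕ) (z : ℕ) : Prop :=
  LitFalse f (I.lit (3 * z)) ∧ LitFalse f (I.lit (3 * z + 1)) ∧ LitFalse f (I.lit (3 * z + 2))

/-- `b` is the variable of a literal of the clause `z` and free. -/
def Data.Shared (mark : ℕ → ℕ) (y z q : ℕ) : Prop := mark (I.v y q) = 0 ∧ I.Mem z (I.v y q)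

def Data.Private (mark : ℕ → ℕ) (y z q : ℕ) : Prop := mark (I.v y q) = 0 ∧ ¬ I.Mem z (I.v y q)

/-- The false clauses `y` and `z` share a free variable, and `z` does not contain all free variables
of `y`; or `y = z` contains a variable that is not free. -/
def Data.Pair (val mark : ℕ → ℕ) (y z : ℕ) : Prop :=
  I.False val y ∧ I.False val z ∧
    ((y = z ∧ (mark (I.v y 0) ≠ 0 ∨ mark (I.v y 1) ≠ 0 ∨ mark (I.v y 2) ≠ 0)) ∨
    ((I.Shared mark y z 0 ∨ I.Shared mark y z 1 ∨ I.Shared mark y z 2) ∧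
      (I.Private mark y z 0 ∨ I.Private mark y z 1 ∨ I.Private mark y z 2)))

/-- The clause `z` is false and all its variables are free. -/
def Data.Fresh (val mark : ℕ → ℕ) (z : ℕ) : Prop :=
  I.False val z ∧ mark (I.v z 0) = 0 ∧ mark (I.v z 1) = 0 ∧ mark (I.v z 2) = 0

namespace St

def dead (σ : St) : St := { σ with st := 1 }

/-- The current assignment. -/
def cur (σ : St) (x : ℕ) : ℕ :=
  if 2 ≤ σ.mark x ∧ σ.tv (3 * (σ.mark x - 2) + σ.rp (σ.mark x - 2)) = x then 1 - σ.val x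
  else σ.val x

/-- Flip `x` for good. -/
def fix (σ : St) (x : ℕ) : St :=
  { σ with val := Function.update σ.val x (1 - σ.val x), mark := Function.update σ.mark x 1 }

/-- Remove the member `o` from the family. -/
def release (σ : St) (o : ℕ) : St :=
  { σ with
    mark := Function.update (Function.update (Function.update σ.mark (σ.tv (3 * o)) 0)
      (σ.tv (3 * o + 1)) 0) (σ.tv (3 * o + 2)) 0
    -- The position `3` marks a member that is no longer active.
    rp := Function.update σ.rp o 3 }

end St

open Classical in
/-- Choose the values of the variables, block by block. -/
noncomputable def stepInit (d : ℕ) (σ : St) : St :=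
  if σ.i < I.n then
    if σ.i % I.tA = 0 then
      if d < I.sizeA then
        { σ with
          k := min (σ.k + I.rad d) I.cap, g := d
          val := Function.update σ.val σ.i (I.bit (d * I.tA + σ.i % I.tA)), i := min (σ.i + 1) I.cap }
      else σ.dead
    else if d = 0 then
      { σ with
        val := Function.update σ.val σ.i (I.bit (σ.g * I.tA + σ.i % I.tA)), i := min (σ.i + 1) I.cap }
    else σ.dead
  else if d = 0 then { σ with ph := 1, i := 0 } else σ.dead

open Classical in
/-- Branch on a pair of intersecting false clauses. -/
noncomputable def stepPair (d : ℕ) (σ : St) : St :=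
  let w := first (fun w => I.Pair σ.val σ.mark (w / I.c) (w % I.c)) (min (I.c * I.c) I.cap)
  if w < min (I.c * I.c) I.cap then
    let y := w / I.c
    let z := w % I.c
    let a := I.v y (d / 3)
    let b := I.v z (d % 3)
    if d < 9 ∧ σ.mark a = 0 ∧ σ.mark b = 0 then
      if a = b then
        if 1 ≤ σ.k then { σ.fix a with k := σ.k - 1 } else σ.dead
      else if ¬ I.Mem z a ∧ ¬ I.Mem y b ∧ 2 ≤ σ.k then { (σ.fix a).fix b with k := σ.k - 2 }
      else σ.dead
    else σ.dead
  else if d = 0 then { σ with ph := 2 } else σ.dead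

open Classical in
/-- Collect the family of disjoint false clauses. -/
noncomputable def stepFamily (d : ℕ) (σ : St) : St :=
  let z := first (I.Fresh σ.val σ.mark) I.c
  if z < I.c then
    if d = 0 ∧ 1 ≤ σ.k then
      let M := min (σ.m + 2) I.cap
      { σ with
        k := σ.k - 1, m := min (σ.m + 1) I.cap
        tv := Function.update (Function.update (Function.update σ.tv (3 * σ.m) (I.v z 0))
          (3 * σ.m + 1) (I.v z 1)) (3 * σ.m + 2) (I.v z 2)
        mark := Function.update (Function.update (Function.update σ.mark (I.v z 0) M)
          (I.v z 1) M) (I.v z 2) M }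
    else σ.dead
  else if d = 0 then { σ with ph := 3, i := 0 } else σ.dead

open Classical in
/-- Choose which variables of the family members are flipped, block by block. -/
noncomputable def stepCode (d : ℕ) (σ : St) : St :=
  if σ.i < σ.m then
    if σ.i % I.tC = 0 then
      if d < I.sizeC then
        { σ with
          s := min (σ.s + I.sw d) I.cap, j := min (σ.j + I.ex d) I.cap, g := d
          rp := Function.update σ.rp σ.i (I.pos (d * I.tC + σ.i % I.tC)), i := min (σ.i + 1) I.cap }
      else σ.dead
    else if d = 0 then
      { σ with
        rp := Function.update σ.rp σ.i (I.pos (σ.g * I.tC + σ.i % I.tC)), i := min (σ.i + 1) I.cap }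
    else σ.dead
  else if d = 0 then { σ with ph := 4 } else σ.dead

open Classical in
/-- Local search: repair a false clause. -/
noncomputable def stepSearch (d : ℕ) (σ : St) : St :=
  let z := first (I.False σ.cur) I.c
  if z < I.c then
    if d < 6 then
      let x := I.v z (d / 2)
      if σ.mark x = 0 then
        if d % 2 = 0 ∧ 1 ≤ σ.k then { σ.fix x with k := σ.k - 1 } else σ.dead
      else if σ.mark x = 1 then σ.dead
      else
        let o := σ.mark x - 2
        let w := σ.tv (3 * o + σ.rp o)
        -- The flip of `w` exists in `cur` only, so releasing the member undoes it. The two choices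
        -- flip either of the other variables for good.
        if w = x then
          if 1 ≤ σ.s then
            { (σ.release o).fix (σ.tv (3 * o + (σ.rp o + 1 + d % 2) % 3)) with s := σ.s - 1 }
          else σ.dead
        else if d % 2 = 0 then
          if 1 ≤ σ.s then { (σ.release o).fix x with s := σ.s - 1 } else σ.dead
        -- Both `x` and `w` are flipped for good. One of the two flips was paid for when the member
        -- was formed, so the budget drops by one only.
        else if 1 ≤ σ.k ∧ 1 ≤ σ.j then
          { ((σ.release o).fix x).fix w with k := σ.k - 1, j := σ.j - 1 }
        else σ.dead
    else σ.dead
  else if d = 0 then { σ with st := 2 } else σ.dead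

/-- The state after the choice `d`. The state with `st = 1` is a dead end, the one with `st = 2`
accepts. -/
noncomputable def step (d : ℕ) (σ : St) : St :=
  if σ.ph = 0 then stepInit I d σ
  else if σ.ph = 1 then stepPair I d σ
  else if σ.ph = 2 then stepFamily I d σ
  else if σ.ph = 3 then stepCode I d σ
  else stepSearch I d σ

end Search


/-! ### The potential: no step of the search increases the total weight -/

namespace Search

open Finset

variable (I : Data)

/-- The properties of the data on which the search relies. The number `B` is the cost of the code for
assignments per variable. -/
structure Data.Valid (B : ℝ) : Prop where
  lit_le : ∀ z < I.c, ∀ q < 3, I.lit (3 * z + q) ≤ 2 * I.n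
  nodup : ∀ z < I.c, ∀ q < 3, ∀ q' < 3, I.lit (3 * z + q) = I.lit (3 * z + q') →
    I.lit (3 * z + q) < 2 * I.n → q = q'
  sq_le : I.c * I.c ≤ I.cap
  n_le : I.n + I.tA + I.tC + 3 ≤ I.cap
  tA_pos : 0 < I.tA
  tC_pos : 0 < I.tC
  bit_le : ∀ x, I.bit x ≤ 1
  pos_lt : ∀ x, I.pos x < 3
  coverA : ∀ β : ℕ → ℕ, (∀ q, β q ≤ 1) → ∃ d < I.sizeA,
    #{q ∈ range I.tA | I.bit (d * I.tA + q) ≠ β q} ≤ I.rad d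
  coverC : ∀ Q : ℕ → ℕ → Prop, (∀ q, ∃ p < 3, Q q p) → ∃ d < I.sizeC, open Classical in
    #{q ∈ range I.tC | ¬ Q q (I.pos (d * I.tC + q))} ≤ I.sw d ∧
    #{q ∈ range I.tC | Q q (I.pos (d * I.tC + q)) ∧ 2 ≤ #{p ∈ range 3 | Q q p}} ≤ I.ex d
  costA : ∑ d ∈ range I.sizeA, ballBase ^ I.rad d ≤ B ^ I.tA
  costC : ∑ d ∈ range I.sizeC, 10 ^ I.sw d * (4 / ballBase) ^ I.ex d ≤ ballBase ^ I.tC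
  one_le : 1 ≤ B

variable {I}

theorem Data.mem_iff {z x : ℕ} : I.Mem z x ↔ ∃ q < 3, I.v z q = x := by
  constructor
  · rintro (h | h | h)
    exacts [⟨0, by norm_num, h⟩, ⟨1, by norm_num, h⟩, ⟨2, by norm_num, h⟩]
  · rintro ⟨q, hq, h⟩
    interval_cases q
    exacts [.inl h, .inr (.inl h), .inr (.inr h)]

theorem Data.v_mem {z q : ℕ} (hq : q < 3) : I.Mem z (I.v z q) := Data.mem_iff.2 ⟨q, hq, rfl⟩

theorem Data.false_iff {f : ℕ → ℕ} {z : ℕ} :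
    I.False f z ↔ ∀ q < 3, LitFalse f (I.lit (3 * z + q)) := by
  constructor
  · rintro ⟨h0, h1, h2⟩ q hq
    interval_cases q
    exacts [h0, h1, h2]
  · intro h
    exact ⟨h 0 (by norm_num), h 1 (by norm_num), h 2 (by norm_num)⟩

/-- The remaining length of the current block, before the `i`-th entry. -/
def rem (t i : ℕ) : ℕ := if i % t = 0 then t else i % t

theorem succ_mod {t : ℕ} (ht : 0 < t) (i : ℕ) :
    (i + 1) % t = if i % t + 1 = t then 0 else i % t + 1 := by
  have h := Nat.div_add_mod i t
  have hl := Nat.mod_lt i ht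
  have : (i + 1) % t = (i % t + 1) % t := by
    conv_lhs => rw [← h, add_assoc, Nat.mul_add_mod]
  rw [this]
  split_ifs with h1
  · rw [h1, Nat.mod_self]
  · exact Nat.mod_eq_of_lt (by omega)

theorem rem_succ {t : ℕ} (ht : 0 < t) (i : ℕ) : rem t (i + 1) = i % t + 1 := by
  rw [rem, succ_mod ht]
  by_cases h : i % t + 1 = t <;> simp [h]

/-- The properties of reachable states. -/
structure Inv (I : Data) (σ : St) : Prop where
  ph : σ.ph ≤ 4
  val_le : ∀ x, σ.val x ≤ 1
  val_n : σ.val I.n = 1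
  mark_n : σ.mark I.n = 1
  start : σ.ph = 0 → ∀ x, x ≠ I.n → σ.mark x = 0
  early : σ.ph ≤ 1 → σ.m = 0 ∧ ∀ x, σ.mark x ≤ 1
  owned : 2 ≤ σ.ph → ∀ x, 2 ≤ σ.mark x → σ.mark x - 2 < σ.m ∧
    (∃ p < 3, σ.tv (3 * (σ.mark x - 2) + p) = x) ∧ (σ.ph = 4 → σ.rp (σ.mark x - 2) < 3)
  tri : 2 ≤ σ.ph → ∀ o < σ.m, (σ.ph = 4 → σ.rp o < 3) → ∀ p < 3,
    σ.tv (3 * o + p) < I.n ∧ σ.mark (σ.tv (3 * o + p)) = o + 2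
  inj : 2 ≤ σ.ph → ∀ o < σ.m, (σ.ph = 4 → σ.rp o < 3) → ∀ p < 3, ∀ p' < 3,
    σ.tv (3 * o + p) = σ.tv (3 * o + p') → p = p'
  code : σ.ph = 3 → σ.i ≤ σ.m ∧ ∀ o < σ.i, σ.rp o < 3
  -- This is what the exhausted pair phase leaves: false clauses contain no frozen variable, in
  -- particular no padding, and a false clause that meets another one contains all its variables. By
  -- `origin` the members of the family come from such clauses.
  full : σ.ph = 2 → ∀ z < I.c, I.False σ.val z → ∀ q < 3, σ.mark (I.v z q) ≠ 1
  apart : σ.ph = 2 → ∀ y < I.c, ∀ z < I.c, I.False σ.val y → I.False σ.val z → ∀ q < 3,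
    I.Mem z (I.v y q) → ∀ q' < 3, I.Mem z (I.v y q')
  origin : σ.ph = 2 → ∀ o < σ.m, ∃ z < I.c, I.False σ.val z ∧ ∀ p < 3, σ.tv (3 * o + p) = I.v z p
  -- The condition on which the local search rests. It survives because a permanent flip freezes its
  -- variable, so no new clause satisfies the premises, and because a member is released only
  -- together with freezing one of its variables.
  covers : 3 ≤ σ.ph → ∀ z < I.c, I.False σ.val z → (∀ q < 3, σ.mark (I.v z q) ≠ 1) →
    ∃ o < σ.m, (σ.ph = 4 → σ.rp o < 3) ∧ ∀ p < 3, I.Mem z (σ.tv (3 * o + p))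
  m_le : σ.m ≤ I.n

/-- The bound for the number of leaves below a state. -/
noncomputable def potential (I : Data) (B : ℝ) (σ : St) : ℝ :=
  if σ.st = 0 then
    10 ^ σ.s * (4 / ballBase) ^ σ.j * ballBase ^ σ.k *
      (if σ.ph = 0 then ballBase ^ I.tC * B ^ (I.n - σ.i + rem I.tA σ.i)
      else if σ.ph = 1 then ballBase ^ I.tC
      else if σ.ph = 2 then ballBase ^ (σ.m + I.tC)
      else if σ.ph = 3 then ballBase ^ (σ.m - σ.i + rem I.tC σ.i) else 1)
  else 0

theorem one_le_four_div : 1 ≤ 4 / ballBase := by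
  rw [le_div_iff₀ ballBase_pos]; linarith [ballBase_lt]

theorem one_le_ballBase : 1 ≤ ballBase := by linarith [lt_ballBase]

theorem one_le_potential {B : ℝ} (hB : 1 ≤ B) {σ : St} (h : σ.st = 0) : 1 ≤ potential I B σ := by
  have h1 : ∀ x : ℝ, 1 ≤ x → ∀ m : ℕ, 1 ≤ x ^ m := fun x hx m => one_le_pow₀ hx
  rw [potential, if_pos h]
  refine one_le_mul_of_one_le_of_one_le (one_le_mul_of_one_le_of_one_le
    (one_le_mul_of_one_le_of_one_le (h1 _ (by norm_num) _) (h1 _ one_le_four_div _))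
    (h1 _ one_le_ballBase _)) ?_
  split_ifs
  exacts [one_le_mul_of_one_le_of_one_le (h1 _ one_le_ballBase _) (h1 _ hB _),
    h1 _ one_le_ballBase _, h1 _ one_le_ballBase _, h1 _ one_le_ballBase _, le_rfl]

theorem potential_nonneg {B : ℝ} (hB : 1 ≤ B) (σ : St) : 0 ≤ potential I B σ := by
  by_cases h : σ.st = 0
  · exact zero_le_one.trans (one_le_potential hB h)
  · rw [potential, if_neg h]

theorem potential_dead {B : ℝ} (σ : St) : potential I B σ.dead = 0 := by simp [potential, St.dead]

theorem sum_le_of_ne_zero {f : ℕ → ℝ} {N : ℕ} (hN : 0 < N) (h : ∀ d, d ≠ 0 → f d = 0) :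
    ∑ d ∈ range N, f d = f 0 :=
  sum_eq_single 0 (fun d _ hd => h d hd) (fun h => absurd (mem_range.2 hN) h)

/-- The factor by which a step of the block code, whose entries cost `f`, increases the potential. -/
theorem sum_block_le {f : ℕ → ℝ} {size N : ℕ} (hN : size ≤ N) {g : ℕ → ℝ} {A C : ℝ} (hA : 0 ≤ A)
    (hf : ∀ d < size, g d ≤ A * f d) (hg : ∀ d, ¬ d < size → g d = 0)
    (hC : ∑ d ∈ range size, f d ≤ C) : ∑ d ∈ range N, g d ≤ A * C := by
  have : ∑ d ∈ range N, g d = ∑ d ∈ range size, g d := by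
    symm
    apply sum_subset (range_subset_range.2 hN)
    intro d _ hd
    exact hg d (by simpa using hd)
  rw [this]
  calc _ ≤ ∑ d ∈ range size, A * f d := sum_le_sum fun d hd => hf d (mem_range.1 hd)
    _ = A * ∑ d ∈ range size, f d := by rw [mul_sum]
    _ ≤ A * C := mul_le_mul_of_nonneg_left hC hA

/-- A block is charged in full when its code word is chosen: the exponent `n - i + tA` then drops to
`n - i`, which pays for the sum over all words by `costA`. While the word is being copied, `n - i +
i % tA` is constant, namely `n` minus the start of the block. The surplus of at most one block
covers a last block that is incomplete. -/
theorem potential_stepInit {B : ℝ} (hI : I.Valid B) {N : ℕ} (hN : I.sizeA ≤ N) (hN0 : 0 < N) {σ : St}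
    (hst : σ.st = 0) (hph : σ.ph = 0) :
    ∑ d ∈ range N, potential I B (stepInit I d σ) ≤ potential I B σ := by
  have hB := hI.one_le
  have hcap := hI.n_le
  by_cases hi : σ.i < I.n
  · have hmin : min (σ.i + 1) I.cap = σ.i + 1 := by omega
    by_cases hmod : σ.i % I.tA = 0
    · have hR : rem I.tA σ.i = I.tA := by simp [rem, hmod]
      have hS : rem I.tA (σ.i + 1) = 1 := by rw [rem_succ hI.tA_pos, hmod]
      have hP : potential I B σ = (10 ^ σ.s * (4 / ballBase) ^ σ.j * ballBase ^ σ.k * ballBase ^ I.tC *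
          B ^ (I.n - σ.i)) * B ^ I.tA := by
        simp only [potential, hst, hph, hR, if_true, pow_add]; ring
      rw [hP]
      have := ballBase_pos
      refine sum_block_le (f := fun d => ballBase ^ I.rad d) hN (by positivity)
        (fun d hd => ?_) (fun d hd => ?_) hI.costA
      · have e1 : I.n - (σ.i + 1) + 1 = I.n - σ.i := by omega
        simp only [stepInit, hi, hmod, hd, if_true, potential, hst, hph, hmin, hS, e1]
        have e2 : ballBase ^ min (σ.k + I.rad d) I.cap ≤ ballBase ^ σ.k * ballBase ^ I.rad d := by
          rw [← pow_add]; exact pow_le_pow_right₀ one_le_ballBase (min_le_left _ _)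
        calc _ ≤ 10 ^ σ.s * (4 / ballBase) ^ σ.j * (ballBase ^ σ.k * ballBase ^ I.rad d) *
            (ballBase ^ I.tC * B ^ (I.n - σ.i)) := by gcongr
          _ = _ := by ring
      · simp only [stepInit, hi, hmod, hd, if_true, if_false, potential_dead]
    · rw [sum_le_of_ne_zero hN0]
      · simp only [stepInit, hi, hmod, if_true, if_false, potential, hst, hph, hmin,
          rem_succ hI.tA_pos]
        have e1 : I.n - (σ.i + 1) + (σ.i % I.tA + 1) = I.n - σ.i + rem I.tA σ.i := by
          simp only [rem, hmod, if_false]; omega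
        rw [e1]
      · intro d hd
        simp only [stepInit, hi, hmod, hd, if_true, if_false, potential_dead]
  · rw [sum_le_of_ne_zero hN0]
    · simp only [stepInit, hi, if_true, if_false, potential, hst, hph, one_ne_zero]
      have := ballBase_pos
      refine mul_le_mul_of_nonneg_left ?_ (by positivity)
      exact le_mul_of_one_le_right (by positivity) (one_le_pow₀ hB)
    · intro d hd
      simp only [stepInit, hi, hd, if_false, potential_dead]

/-- The same bookkeeping by blocks, now financed by the factor `ballBase ^ m` that the family phase
has saved up. -/
theorem potential_stepCode {B : ℝ} (hI : I.Valid B) {N : ℕ} (hN : I.sizeC ≤ N) (hN0 : 0 < N) {σ : St}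
    (h : Inv I σ) (hst : σ.st = 0) (hph : σ.ph = 3) :
    ∑ d ∈ range N, potential I B (stepCode I d σ) ≤ potential I B σ := by
  have hB := hI.one_le
  have hcap := hI.n_le
  have hm := h.m_le
  by_cases hi : σ.i < σ.m
  · have hmin : min (σ.i + 1) I.cap = σ.i + 1 := by omega
    by_cases hmod : σ.i % I.tC = 0
    · have hR : rem I.tC σ.i = I.tC := by simp [rem, hmod]
      have hS : rem I.tC (σ.i + 1) = 1 := by rw [rem_succ hI.tC_pos, hmod]
      have hP : potential I B σ = (10 ^ σ.s * (4 / ballBase) ^ σ.j * ballBase ^ σ.k *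
          ballBase ^ (σ.m - σ.i)) * ballBase ^ I.tC := by
        simp only [potential, hst, hph, hR, if_true, pow_add]; norm_num; ring
      rw [hP]
      have := ballBase_pos
      have h4 := one_le_four_div
      refine sum_block_le (f := fun d => 10 ^ I.sw d * (4 / ballBase) ^ I.ex d) hN (by positivity)
        (fun d hd => ?_) (fun d hd => ?_) hI.costC
      · have e1 : σ.m - (σ.i + 1) + 1 = σ.m - σ.i := by omega
        simp only [stepCode, hi, hmod, hd, if_true, potential, hst, hph, hmin, hS, e1]
        have e2 : (4 / ballBase) ^ min (σ.j + I.ex d) I.cap ≤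
            (4 / ballBase) ^ σ.j * (4 / ballBase) ^ I.ex d := by
          rw [← pow_add]; exact pow_le_pow_right₀ h4 (min_le_left _ _)
        have e3 : (10 : ℝ) ^ min (σ.s + I.sw d) I.cap ≤ 10 ^ σ.s * 10 ^ I.sw d := by
          rw [← pow_add]; exact pow_le_pow_right₀ (by norm_num) (min_le_left _ _)
        norm_num
        calc _ ≤ (10 ^ σ.s * 10 ^ I.sw d) * ((4 / ballBase) ^ σ.j * (4 / ballBase) ^ I.ex d) *
            ballBase ^ σ.k * ballBase ^ (σ.m - σ.i) := by gcongr
          _ = _ := by ring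
      · simp only [stepCode, hi, hmod, hd, if_true, if_false, potential_dead]
    · rw [sum_le_of_ne_zero hN0]
      · simp only [stepCode, hi, hmod, if_true, if_false, potential, hst, hph, hmin,
          rem_succ hI.tC_pos]
        have e1 : σ.m - (σ.i + 1) + (σ.i % I.tC + 1) = σ.m - σ.i + rem I.tC σ.i := by
          simp only [rem, hmod, if_false]; omega
        norm_num [e1]
      · intro d hd
        simp only [stepCode, hi, hmod, hd, if_true, if_false, potential_dead]
  · rw [sum_le_of_ne_zero hN0]
    · simp only [stepCode, hi, if_true, if_false, potential, hst, hph]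
      have := ballBase_pos
      refine mul_le_mul_of_nonneg_left ?_ (by positivity)
      norm_num
      exact one_le_pow₀ one_le_ballBase
    · intro d hd
      simp only [stepCode, hi, hd, if_false, potential_dead]

/-- There is no branching here: a unit of budget moves from `k` to `m`, and both exponents have the
base `ballBase`. -/
theorem potential_stepFamily {B : ℝ} {N : ℕ} (hN0 : 0 < N) {σ : St}
    (hst : σ.st = 0) (hph : σ.ph = 2) :
    ∑ d ∈ range N, potential I B (stepFamily I d σ) ≤ potential I B σ := by
  have hb := ballBase_pos
  rw [sum_le_of_ne_zero hN0]
  · by_cases hz : first (I.Fresh σ.val σ.mark) I.c < I.c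
    · by_cases hk : 1 ≤ σ.k
      · simp only [stepFamily, hz, hk, if_true, potential, hst, hph, and_self]
        norm_num
        have e1 : ballBase ^ σ.k = ballBase ^ (σ.k - 1) * ballBase := by
          rw [← pow_succ]; congr 1; omega
        rw [e1]
        calc _ ≤ 10 ^ σ.s * (4 / ballBase) ^ σ.j * ballBase ^ (σ.k - 1) *
            ballBase ^ (σ.m + 1 + I.tC) := by
              gcongr
              · exact one_le_ballBase
              · exact min_le_left _ _
          _ = _ := by ring
      · simp only [stepFamily, hz, hk, if_true, and_false, if_false, potential_dead]
        rw [potential, if_pos hst, hph]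
        norm_num
        positivity
    · simp only [stepFamily, hz, if_false, if_true, potential, hst, hph]
      norm_num [rem]
  · intro d hd
    simp only [stepFamily, hd, false_and, if_false]
    split_ifs <;> exact potential_dead σ

theorem sum_range_nine (f : ℕ → ℝ) :
    ∑ d ∈ range 9, f d = ∑ p ∈ range 3, ∑ q ∈ range 3, f (3 * p + q) := by
  simp [sum_range_succ]; ring

theorem sum_le_of_lt {f : ℕ → ℝ} {M N : ℕ} (hN : M ≤ N) (h : ∀ d, ¬ d < M → f d = 0) :
    ∑ d ∈ range N, f d = ∑ d ∈ range M, f d := by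
  symm
  apply sum_subset (range_subset_range.2 hN)
  intro d _ hd
  exact h d (by simpa using hd)

/-- The branching on a pair of intersecting sets. -/
theorem sum_pair_le {A B : Finset ℕ} (hA : #A ≤ 3) (hB : #B ≤ 3) (h : #(A ∩ B) ≤ 2)
    (h' : #(A ∩ B) = 0 → #A = 0) :
    ∑ a ∈ A, ∑ b ∈ B, (if a = b then 1 / ballBase
      else if a ∉ B ∧ b ∉ A then 1 / ballBase ^ 2 else 0) ≤ (1 : ℝ) := by
  have hb := ballBase_pos
  have e : ∀ a ∈ A, ∑ b ∈ B, (if a = b then 1 / ballBase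
      else if a ∉ B ∧ b ∉ A then 1 / ballBase ^ 2 else 0) =
      if a ∈ B then 1 / ballBase else #(B \ A) * (1 / ballBase ^ 2) := by
    intro a ha
    split_ifs with hab
    · rw [sum_eq_single_of_mem a hab]
      · simp
      · intro b _ hne
        simp [hab, hne.symm]
    · rw [← sum_filter_add_sum_filter_not B (· ∈ A), sum_eq_zero, zero_add]
      · rw [sum_congr rfl (g := fun _ => 1 / ballBase ^ 2), sum_const, nsmul_eq_mul]
        · congr 3
          ext b; simp
        · intro b hb
          rw [mem_filter] at hb
          rw [if_neg (by rintro rfl; exact hab hb.1), if_pos ⟨hab, hb.2⟩]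
      · intro b hb
        rw [mem_filter] at hb
        rw [if_neg (by rintro rfl; exact hab hb.1), if_neg (fun h => h.2 hb.2)]
  rw [sum_congr rfl e, sum_ite, sum_const, sum_const, filter_mem_eq_inter]
  have e2 : {a ∈ A | a ∉ B} = A \ B := by ext; simp
  rw [e2]
  have c1 := card_sdiff_add_card_inter A B
  have c2 := card_sdiff_add_card_inter B A
  rw [inter_comm B A] at c2
  have hsq := ballBase_sq
  have hlt := lt_ballBase
  -- Here `x` counts the common and `y`, `z` the private elements. The case `x = 1`, `y = z = 2` is
  -- tight by `ballBase_sq`; for `x = 2` one needs `2 * ballBase + 1 ≤ ballBase + 4`.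
  have key : ∀ x y z : ℕ, x ≤ 2 → (x = 0 → y = 0) → y + x ≤ 3 → z + x ≤ 3 →
      x • (1 / ballBase) + y • (z * (1 / ballBase ^ 2)) ≤ (1 : ℝ) := by
    intro x y z hx hy h1 h2
    have hsum : x • (1 / ballBase) + y • (z * (1 / ballBase ^ 2)) =
        (x * ballBase + y * z) / ballBase ^ 2 := by
      simp only [nsmul_eq_mul]; field_simp
    rw [hsum, div_le_one (by positivity), hsq]
    have hyz : y * z ≤ (3 - x) * (3 - x) := Nat.mul_le_mul (by omega) (by omega)
    rcases Nat.eq_zero_or_pos x with rfl | hx0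
    · simp [hy rfl]; linarith
    · interval_cases x
      · have : ((y * z : ℕ) : ℝ) ≤ 4 := by exact_mod_cast hyz
        push_cast at this ⊢
        linarith
      · have : ((y * z : ℕ) : ℝ) ≤ 1 := by exact_mod_cast hyz
        push_cast at this ⊢
        linarith [ballBase_lt]
  exact key _ _ _ h (fun h0 => by have := h' h0; omega) (by omega) (by omega)

/-- Two false literals on one variable have the same sign, hence are equal, and equal literals occur
twice only as padding, whose variable is `n`. -/
theorem v_inj {B : ℝ} (hI : I.Valid B) {f : ℕ → ℕ} (hf : ∀ x, f x ≤ 1) {z : ℕ} (hz : z < I.c)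
    (hF : I.False f z) {q q' : ℕ} (hq : q < 3) (hq' : q' < 3) (hn : I.v z q ≠ I.n)
    (h : I.v z q = I.v z q') : q = q' := by
  have h1 := Data.false_iff.1 hF q hq
  have h2 := Data.false_iff.1 hF q' hq'
  have h3 := hI.lit_le z hz q hq
  unfold LitFalse at h1 h2
  unfold Data.v at h hn
  rw [← h] at h2
  have h4 := hf (I.lit (3 * z + q) / 2)
  exact hI.nodup z hz q hq q' hq' (by omega) (by omega)

theorem pair_lt {I : Data} {B : ℝ} (hI : I.Valid B) {w : ℕ} (hw : w < min (I.c * I.c) I.cap) :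
    w / I.c < I.c ∧ w % I.c < I.c := by
  have h1 := hI.sq_le
  rw [min_eq_left h1] at hw
  have hc : 0 < I.c := by
    rcases Nat.eq_zero_or_pos I.c with h | h
    · rw [h] at hw; omega
    · exact h
  exact ⟨Nat.div_lt_of_lt_mul hw, Nat.mod_lt _ hc⟩

-- The choice `d` names a literal of `y` by its quotient and one of `z` by its remainder modulo 3.
-- Dropping the pairs that are neither equal nor private on both sides leaves the sum of
-- `sum_pair_le` over the sets of free variables; `v_inj` permits the passage from positions to
-- variables. For `y = z` a non-free variable bounds the set by two elements; otherwise `Shared` and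
-- `Private` make the intersection nonempty and proper.
open Classical in
set_option maxHeartbeats 1000000 in
theorem potential_stepPair {B : ℝ} (hI : I.Valid B) {N : ℕ} (hN : 9 ≤ N) {σ : St}
    (h : Inv I σ) (hst : σ.st = 0) (hph : σ.ph = 1) :
    ∑ d ∈ range N, potential I B (stepPair I d σ) ≤ potential I B σ := by
  have hb := ballBase_pos
  set w := first (fun w => I.Pair σ.val σ.mark (w / I.c) (w % I.c)) (min (I.c * I.c) I.cap) with hwdef
  by_cases hw : w < min (I.c * I.c) I.cap
  swap
  · rw [sum_le_of_ne_zero (by omega)]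
    · simp only [stepPair, ← hwdef, hw, if_false, if_true, potential, hst, hph, (h.early (by omega)).1]
      norm_num
    · intro d hd
      simp only [stepPair, ← hwdef, hw, hd, if_false, potential_dead]
  · set y := w / I.c with hy
    set z := w % I.c with hz
    obtain ⟨hyc, hzc⟩ := pair_lt hI hw
    have hpair : I.Pair σ.val σ.mark y z := first_spec hw
    obtain ⟨hFy, hFz, hcase⟩ := hpair
    have hstep : ∀ d, stepPair I d σ = if d < 9 ∧ σ.mark (I.v y (d / 3)) = 0 ∧
        σ.mark (I.v z (d % 3)) = 0 then
        if I.v y (d / 3) = I.v z (d % 3) then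
          if 1 ≤ σ.k then { σ.fix (I.v y (d / 3)) with k := σ.k - 1 } else σ.dead
        else if ¬ I.Mem z (I.v y (d / 3)) ∧ ¬ I.Mem y (I.v z (d % 3)) ∧ 2 ≤ σ.k then
          { (σ.fix (I.v y (d / 3))).fix (I.v z (d % 3)) with k := σ.k - 2 }
        else σ.dead
      else σ.dead := by
      intro d
      simp only [stepPair, ← hwdef, hw, if_true, ← hy, ← hz]
    rw [sum_le_of_lt hN, sum_range_nine]
    swap
    · intro d hd
      rw [hstep, if_neg fun h => hd h.1, potential_dead]
    have hnn : ∀ x, σ.mark x = 0 → x ≠ I.n := fun x hx hn => by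
      rw [hn, h.mark_n] at hx; omega
    let S : ℕ → Finset ℕ := fun y => ((range 3).filter fun p => σ.mark (I.v y p) = 0).image (I.v y)
    have hSm : ∀ y x, x ∈ S y ↔ σ.mark x = 0 ∧ I.Mem y x := by
      intro y x
      simp only [S, mem_image, mem_filter, mem_range, Data.mem_iff]
      constructor
      · rintro ⟨p, ⟨hp, hm⟩, rfl⟩; exact ⟨hm, p, hp, rfl⟩
      · rintro ⟨hm, p, hp, rfl⟩; exact ⟨p, ⟨hp, hm⟩, rfl⟩
    have hsum : ∀ (y : ℕ) (hy : y < I.c) (hF : I.False σ.val y) (f : ℕ → ℝ),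
        ∑ p ∈ range 3, (if σ.mark (I.v y p) = 0 then f (I.v y p) else 0) = ∑ x ∈ S y, f x := by
      intro y hy hF f
      rw [← sum_filter, sum_image]
      intro p hp p' hp' he
      simp only [coe_filter, mem_range, Set.mem_ofPred_eq] at hp hp'
      exact v_inj hI h.val_le hy hF hp.1 hp'.1 (hnn _ hp.2) he
    have hScard : ∀ y, #(S y) ≤ 3 := fun y => card_image_le.trans
      ((card_filter_le _ _).trans (by simp))
    set P := potential I B σ with hP
    have hP0 : 0 ≤ P := potential_nonneg hI.one_le σ
    have hk1 : ∀ e, e ≤ σ.k → ∀ τ : St, τ.st = σ.st → τ.ph = σ.ph → τ.k = σ.k - e → τ.s = σ.s →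
        τ.j = σ.j → potential I B τ = P * (1 / ballBase ^ e) := by
      intro e he τ h1 h2 h3 h4 h5
      have : ballBase ^ σ.k = ballBase ^ (σ.k - e) * ballBase ^ e := by
        rw [← pow_add]; congr 1; omega
      simp only [hP, potential, h1, h2, h3, h4, h5, hst, hph, if_true, this]
      norm_num
      field_simp
    calc _ ≤ ∑ p ∈ range 3, ∑ q ∈ range 3, P * (if σ.mark (I.v y p) = 0 then
          if σ.mark (I.v z q) = 0 then (if I.v y p = I.v z q then 1 / ballBase
            else if I.v y p ∉ S z ∧ I.v z q ∉ S y then 1 / ballBase ^ 2 else 0) else 0 else 0) := by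
          refine sum_le_sum fun p hp => sum_le_sum fun q hq => ?_
          rw [mem_range] at hp hq
          rw [hstep, show (3 * p + q) / 3 = p by omega, show (3 * p + q) % 3 = q by omega]
          by_cases hp0 : σ.mark (I.v y p) = 0
          swap
          · rw [if_neg fun h => hp0 h.2.1, potential_dead, if_neg hp0, mul_zero]
          by_cases hq0 : σ.mark (I.v z q) = 0
          swap
          · rw [if_neg fun h => hq0 h.2.2, potential_dead, if_pos hp0, if_neg hq0, mul_zero]
          rw [if_pos ⟨by omega, hp0, hq0⟩, if_pos hp0, if_pos hq0]
          by_cases he : I.v y p = I.v z q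
          · rw [if_pos he, if_pos he]
            split_ifs with hk
            · rw [hk1 1 hk] <;> simp [St.fix]
            · rw [potential_dead]; positivity
          · rw [if_neg he, if_neg he]
            have m1 : I.v y p ∉ S z ↔ ¬ I.Mem z (I.v y p) := by rw [hSm]; tauto
            have m2 : I.v z q ∉ S y ↔ ¬ I.Mem y (I.v z q) := by rw [hSm]; tauto
            by_cases hc : ¬ I.Mem z (I.v y p) ∧ ¬ I.Mem y (I.v z q)
            · rw [if_pos (⟨m1.2 hc.1, m2.2 hc.2⟩ : I.v y p ∉ S z ∧ I.v z q ∉ S y)]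
              split_ifs with hk
              · rw [hk1 2 hk.2.2] <;> simp [St.fix]
              · rw [potential_dead]; positivity
            · rw [if_neg fun h => hc ⟨h.1, h.2.1⟩, if_neg fun h => hc ⟨m1.1 h.1, m2.1 h.2⟩,
                potential_dead, mul_zero]
      _ = P * ∑ a ∈ S y, ∑ b ∈ S z, (if a = b then 1 / ballBase
            else if a ∉ S z ∧ b ∉ S y then 1 / ballBase ^ 2 else 0) := by
          rw [← hsum y hyc hFy, mul_sum]
          refine sum_congr rfl fun p _ => ?_
          rw [← mul_sum]
          congr 1
          split_ifs with hp0
          · rw [← hsum z hzc hFz]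
          · simp
      _ ≤ P * 1 := by
          refine mul_le_mul_of_nonneg_left (sum_pair_le (hScard y) (hScard z) ?_ ?_) hP0
          · rcases hcase with ⟨hyz, hm⟩ | ⟨_, hm⟩
            · rw [← hyz, inter_self]
              have h1 : #(S y) ≤ #((range 3).filter fun p => σ.mark (I.v y p) = 0) := card_image_le
              have h2 : #((range 3).filter fun p => σ.mark (I.v y p) = 0) < #(range 3) := by
                apply card_lt_card
                rw [filter_ssubset]
                rcases hm with hm | hm | hm
                exacts [⟨0, by simp, hm⟩, ⟨1, by simp, hm⟩, ⟨2, by simp, hm⟩]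
              rw [card_range] at h2
              omega
            · have : S y ∩ S z ⊂ S y := by
                refine (ssubset_iff_of_subset inter_subset_left).2 ?_
                have : ∀ q < 3, I.Private σ.mark y z q → ∃ x ∈ S y, x ∉ S y ∩ S z := by
                  intro q hq hpr
                  refine ⟨I.v y q, (hSm _ _).2 ⟨hpr.1, Data.v_mem hq⟩, fun hx => ?_⟩
                  exact hpr.2 ((hSm _ _).1 (mem_inter.1 hx).2).2
                rcases hm with hm | hm | hm
                exacts [this 0 (by norm_num) hm, this 1 (by norm_num) hm, this 2 (by norm_num) hm]
              have := card_lt_card this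
              have := hScard y
              omega
          · intro h0
            rcases hcase with ⟨hyz, hm⟩ | ⟨hm, _⟩
            · rwa [← hyz, inter_self] at h0
            · exfalso
              rw [card_eq_zero] at h0
              have : ∀ q < 3, I.Shared σ.mark y z q → _root_.False := by
                intro q hq hpr
                have : I.v y q ∈ S y ∩ S z := mem_inter.2 ⟨(hSm _ _).2 ⟨hpr.1, Data.v_mem hq⟩,
                  (hSm _ _).2 hpr⟩
                rw [h0] at this
                simp at this
              rcases hm with hm | hm | hm
              exacts [this 0 (by norm_num) hm, this 1 (by norm_num) hm, this 2 (by norm_num) hm]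
      _ = P := mul_one _

/-- A switch divides the weight by 10, and an extra flip by `ballBase * (4 / ballBase) = 4`. So the
literals cost `1 / ballBase`, `0`, `2 / 10` or `1 / 10 + 1 / 4 = 7 / 20`; one of the three costs at
most `1 / 5` and the others at most `0.3904`. -/
theorem potential_stepSearch {B : ℝ} (hI : I.Valid B) {N : ℕ} (hN : 6 ≤ N) {σ : St}
    (h : Inv I σ) (hst : σ.st = 0) (hph : σ.ph = 4) :
    ∑ d ∈ range N, potential I B (stepSearch I d σ) ≤ potential I B σ := by
  have hb := ballBase_pos
  set P := potential I B σ with hP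
  have hP0 : 0 ≤ P := potential_nonneg hI.one_le σ
  set z := first (I.False σ.cur) I.c with hzdef
  by_cases hz : z < I.c
  swap
  · rw [sum_le_of_ne_zero (by omega)]
    · simp only [stepSearch, ← hzdef, hz, if_false, if_true, potential]
      norm_num
      exact hP0
    · intro d hd
      simp only [stepSearch, ← hzdef, hz, hd, if_false, potential_dead]
  have hF : I.False σ.cur z := first_spec hz
  -- the cost of the literal `q` with the option `e`
  have hk : ∀ e f g, e ≤ σ.k → f ≤ σ.s → g ≤ σ.j → ∀ τ : St, τ.st = σ.st → τ.ph = σ.ph →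
      τ.k = σ.k - e → τ.s = σ.s - f → τ.j = σ.j - g →
      potential I B τ = P * (1 / (ballBase ^ e * 10 ^ f * (4 / ballBase) ^ g)) := by
    intro e f g he hf hg τ h1 h2 h3 h4 h5
    have e1 : ballBase ^ σ.k = ballBase ^ (σ.k - e) * ballBase ^ e := by
      rw [← pow_add]; congr 1; omega
    have e2 : (10 : ℝ) ^ σ.s = 10 ^ (σ.s - f) * 10 ^ f := by
      rw [← pow_add]; congr 1; omega
    have e3 : (4 / ballBase) ^ σ.j = (4 / ballBase) ^ (σ.j - g) * (4 / ballBase) ^ g := by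
      rw [← pow_add]; congr 1; omega
    simp only [hP, potential, h1, h2, h3, h4, h5, hst, hph, if_true, e1, e2, e3]
    norm_num
    field_simp
  let cost : ℕ → ℝ := fun q => if σ.mark (I.v z q) = 0 then 1 / ballBase
    else if σ.mark (I.v z q) = 1 then 0
    else if σ.tv (3 * (σ.mark (I.v z q) - 2) + σ.rp (σ.mark (I.v z q) - 2)) = I.v z q then 1 / 5
    else 7 / 20
  have hq : ∀ q < 3, potential I B (stepSearch I (2 * q) σ) +
      potential I B (stepSearch I (2 * q + 1) σ) ≤ P * cost q := by
    intro q hq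
    simp only [stepSearch, ← hzdef, hz, if_true, show 2 * q < 6 by omega, show 2 * q + 1 < 6 by omega,
      show 2 * q / 2 = q by omega, show (2 * q + 1) / 2 = q by omega, show 2 * q % 2 = 0 by omega,
      show (2 * q + 1) % 2 = 1 by omega, cost, one_ne_zero, false_and, if_false, true_and, add_zero]
    by_cases h0 : σ.mark (I.v z q) = 0
    · simp only [h0, if_true, potential_dead, add_zero]
      split_ifs with hk1
      · rw [hk 1 0 0 hk1 (by omega) (by omega)] <;> simp [St.fix]
      · rw [potential_dead]; positivity
    · by_cases h1 : σ.mark (I.v z q) = 1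
      · simp [h1, potential_dead]
      · simp only [h0, h1, if_false]
        by_cases hw : σ.tv (3 * (σ.mark (I.v z q) - 2) + σ.rp (σ.mark (I.v z q) - 2)) = I.v z q
        · simp only [hw, if_true]
          split_ifs with hs
          · rw [hk 0 1 0 (by omega) hs (by omega), hk 0 1 0 (by omega) hs (by omega)] <;>
              simp [St.fix, St.release]
            linarith
          · rw [potential_dead]; linarith
        · simp only [hw, if_false]
          have l1 : potential I B (if 1 ≤ σ.s then
              { (σ.release (σ.mark (I.v z q) - 2)).fix (I.v z q) with s := σ.s - 1 } else σ.dead) ≤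
              P * (1 / 10) := by
            split_ifs with hs
            · rw [hk 0 1 0 (by omega) hs (by omega)] <;> simp [St.fix, St.release]
            · rw [potential_dead]; positivity
          have l2 : potential I B (if 1 ≤ σ.k ∧ 1 ≤ σ.j then
              { ((σ.release (σ.mark (I.v z q) - 2)).fix (I.v z q)).fix
                (σ.tv (3 * (σ.mark (I.v z q) - 2) + σ.rp (σ.mark (I.v z q) - 2))) with
                k := σ.k - 1, j := σ.j - 1 } else σ.dead) ≤ P * (1 / 4) := by
            split_ifs with hs
            · rw [hk 1 0 1 hs.1 (by omega) hs.2] <;> simp [St.fix, St.release]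
              rw [show ballBase / 4 * ballBase⁻¹ = 4⁻¹ by field_simp]
            · rw [potential_dead]; positivity
          linarith
  rw [sum_le_of_lt hN]
  swap
  · intro d hd
    simp only [stepSearch, ← hzdef, hz, if_true, hd, if_false, potential_dead]
  have hall : ∑ d ∈ range 6, potential I B (stepSearch I d σ) ≤ P * (cost 0 + cost 1 + cost 2) := by
    have h0 := hq 0 (by norm_num)
    have h1 := hq 1 (by norm_num)
    have h2 := hq 2 (by norm_num)
    norm_num at h0 h1 h2
    simp only [sum_range_succ, sum_range_zero]
    linarith
  have hinv : 1 / ballBase ≤ 0.3904 := by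
    rw [div_le_iff₀ hb]; linarith [lt_ballBase]
  have hinv' : 7 / 20 ≤ 1 / ballBase := by
    rw [le_div_iff₀ hb]; linarith [ballBase_lt]
  have hmax : ∀ q, cost q ≤ 0.3904 := by
    intro q
    simp only [cost]
    split_ifs <;> linarith
  -- Otherwise no variable of the clause is frozen or currently flipped, so the clause is false
  -- under `val` as well. By `covers` it contains all variables of an active member, one of which is
  -- currently flipped.
  have hmin : (∃ q < 3, cost q ≤ 1 / 5) := by
    by_contra hne
    push Not at hne
    have hm : ∀ q < 3, σ.mark (I.v z q) ≠ 1 ∧ σ.cur (I.v z q) = σ.val (I.v z q) := by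
      intro q hq
      have := hne q hq
      simp only [cost] at this
      split_ifs at this with c1 c2 c3
      · exact ⟨by omega, by simp [St.cur, c1]⟩
      · norm_num at this
      · norm_num at this
      · exact ⟨c2, by simp [St.cur, c3]⟩
    have hFv : I.False σ.val z := by
      rw [Data.false_iff] at hF ⊢
      intro q hq
      have h1 := hF q hq
      have h2 := (hm q hq).2
      unfold LitFalse at h1 ⊢
      rw [Data.v] at h2
      rwa [h2] at h1
    obtain ⟨o, ho, hr, hmem⟩ := h.covers (by omega) z hz hFv fun q hq => (hm q hq).1
    have hr := hr hph
    obtain ⟨q, hq, he⟩ := Data.mem_iff.1 (hmem (σ.rp o) hr)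
    have hmk := (h.tri (by omega) o ho (fun _ => hr) _ hr).2
    rw [← he] at hmk
    have := hne q hq
    simp only [cost, hmk] at this
    rw [if_neg (by omega), if_neg (by omega), if_pos (by rw [Nat.add_sub_cancel]; exact he.symm)] at this
    norm_num at this
  have : cost 0 + cost 1 + cost 2 ≤ 1 := by
    obtain ⟨q, hq, hc⟩ := hmin
    have m0 := hmax 0
    have m1 := hmax 1
    have m2 := hmax 2
    interval_cases q <;> linarith
  calc _ ≤ _ := hall
    _ ≤ P * 1 := mul_le_mul_of_nonneg_left this hP0
    _ = P := mul_one P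

theorem potential_step {B : ℝ} (hI : I.Valid B) {N : ℕ} (hN : 9 ≤ N) (hNA : I.sizeA ≤ N)
    (hNC : I.sizeC ≤ N) {σ : St} (h : Inv I σ) (hst : σ.st = 0) :
    ∑ d ∈ range N, potential I B (step I d σ) ≤ potential I B σ := by
  have hph := h.ph
  unfold step
  split_ifs with h0 h1 h2 h3
  exacts [potential_stepInit hI hNA (by omega) hst h0, potential_stepPair hI hN h hst h1,
    potential_stepFamily (by omega) hst h2, potential_stepCode hI hNC (by omega) h hst h3,
    potential_stepSearch hI (by omega) h hst (by omega)]

end Search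


/-! ### Preservation of the invariants, and termination -/

namespace Search

open Finset

variable {I : Data}

theorem Inv.of_early {σ : St} (hph : σ.ph ≤ 1) (val_le : ∀ x, σ.val x ≤ 1) (val_n : σ.val I.n = 1)
    (mark_n : σ.mark I.n = 1) (start : σ.ph = 0 → ∀ x, x ≠ I.n → σ.mark x = 0) (hm : σ.m = 0)
    (hmark : ∀ x, σ.mark x ≤ 1) : Inv I σ where
  ph := by omega
  val_le := val_le
  val_n := val_n
  mark_n := mark_n
  start := start
  early _ := ⟨hm, hmark⟩
  owned h := by omega
  tri h := by omega
  inj h := by omega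
  code h := by omega
  full h := by omega
  apart h := by omega
  origin h := by omega
  covers h := by omega
  m_le := by omega

/-- A number that decreases in every step. -/
def fuel (I : Data) (σ : St) : ℕ :=
  -- Every phase has its own slot of length `n + 2`, so entering the next phase lowers the number
  -- whatever the counters are. Within a phase, entries to be written, variables not yet frozen, or
  -- free variables are counted.
  if σ.ph = 0 then 4 * (I.n + 2) + (I.n - σ.i)
  else if σ.ph = 1 then 3 * (I.n + 2) + #{x ∈ range I.n | σ.mark x ≠ 1}
  else if σ.ph = 2 then 2 * (I.n + 2) + #{x ∈ range I.n | σ.mark x = 0}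
  else if σ.ph = 3 then (I.n + 2) + (σ.m - σ.i)
  else #{x ∈ range I.n | σ.mark x ≠ 1}

theorem fuel_search {σ : St} (h : σ.ph = 4) : fuel I σ = #{x ∈ range I.n | σ.mark x ≠ 1} := by
  simp [fuel, h]

theorem card_filter_range_le (n : ℕ) (P : ℕ → Prop) [DecidablePred P] : #{x ∈ range n | P x} ≤ n :=
  (card_filter_le _ _).trans (by simp)

theorem fuel_le (h : Inv I σ) : fuel I σ ≤ 5 * (I.n + 2) := by
  have h1 := card_filter_range_le I.n (fun x => σ.mark x ≠ 1)
  have h2 := card_filter_range_le I.n (fun x => σ.mark x = 0)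
  have h3 := h.m_le
  unfold fuel
  split_ifs <;> omega

theorem stepInit_spec {B : ℝ} (hI : I.Valid B) {σ : St} (h : Inv I σ) (hph : σ.ph = 0) {d : ℕ}
    (hd : (stepInit I d σ).st = 0) :
    Inv I (stepInit I d σ) ∧ fuel I (stepInit I d σ) < fuel I σ := by
  have hcap := hI.n_le
  have hval : σ.i < I.n → ∀ y, (∀ x, Function.update σ.val σ.i (I.bit y) x ≤ 1) ∧
      Function.update σ.val σ.i (I.bit y) I.n = 1 := by
    intro hi y
    refine ⟨fun x => ?_, ?_⟩
    · rw [Function.update_apply]; split_ifs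
      exacts [hI.bit_le y, h.val_le x]
    · rw [Function.update_apply, if_neg (by omega), h.val_n]
  unfold stepInit at hd ⊢
  split_ifs at hd ⊢ with h1 h2 h3 h4 h5 <;> try (simp [St.dead] at hd; done)
  · refine ⟨.of_early (by simp [hph]) (hval h1 _).1 (hval h1 _).2 h.mark_n h.start
      (h.early (by omega)).1 (h.early (by omega)).2, ?_⟩
    simp only [fuel, hph, if_true]; omega
  · refine ⟨.of_early (by simp [hph]) (hval h1 _).1 (hval h1 _).2 h.mark_n h.start
      (h.early (by omega)).1 (h.early (by omega)).2, ?_⟩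
    simp only [fuel, hph, if_true]; omega
  · refine ⟨.of_early (by simp) h.val_le h.val_n h.mark_n (by simp)
      (h.early (by omega)).1 (h.early (by omega)).2, ?_⟩
    have := card_filter_range_le I.n (fun x => σ.mark x ≠ 1)
    simp only [fuel, hph, if_true]; norm_num at this ⊢; omega

theorem St.fix_mark (σ : St) (x y : ℕ) : (σ.fix x).mark y = if y = x then 1 else σ.mark y := by
  simp [St.fix, Function.update_apply]

theorem St.fix_val (σ : St) (x y : ℕ) :
    (σ.fix x).val y = if y = x then 1 - σ.val x else σ.val y := by
  simp [St.fix, Function.update_apply]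

open Classical in
theorem St.release_mark (σ : St) (o y : ℕ) : (σ.release o).mark y =
    if ∃ p < 3, y = σ.tv (3 * o + p) then 0 else σ.mark y := by
  have : (∃ p < 3, y = σ.tv (3 * o + p)) ↔
      y = σ.tv (3 * o + 2) ∨ y = σ.tv (3 * o + 1) ∨ y = σ.tv (3 * o) := by
    constructor
    · rintro ⟨p, hp, h⟩
      interval_cases p
      exacts [.inr (.inr h), .inr (.inl h), .inl h]
    · rintro (h | h | h)
      exacts [⟨2, by norm_num, h⟩, ⟨1, by norm_num, h⟩, ⟨0, by norm_num, h⟩]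
  simp only [this, St.release, Function.update_apply]
  split_ifs <;> first | rfl | tauto

theorem card_fixed_lt {n x : ℕ} {f g : ℕ → ℕ} (hx : x < n) (hfx : f x ≠ 1) (hgx : g x = 1)
    (hfg : ∀ y, f y = 1 → g y = 1) : #{y ∈ range n | g y ≠ 1} < #{y ∈ range n | f y ≠ 1} := by
  apply card_lt_card
  rw [ssubset_iff_of_subset]
  · exact ⟨x, by simp [hx, hfx], by simp [hgx]⟩
  · intro y hy
    rw [mem_filter] at hy ⊢
    exact ⟨hy.1, fun h => hy.2 (hfg y h)⟩

theorem v_le {B : ℝ} (hI : I.Valid B) {z q : ℕ} (hz : z < I.c) (hq : q < 3) : I.v z q ≤ I.n := by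
  have := hI.lit_le z hz q hq
  unfold Data.v; omega

theorem Inv.ne_n {σ : St} (h : Inv I σ) {x : ℕ} (hx : σ.mark x ≠ 1) : x ≠ I.n := by
  rintro rfl; exact hx h.mark_n

theorem v_lt {B : ℝ} (hI : I.Valid B) {σ : St} (h : Inv I σ) {z q : ℕ} (hz : z < I.c) (hq : q < 3)
    (hx : σ.mark (I.v z q) ≠ 1) : I.v z q < I.n :=
  lt_of_le_of_ne (v_le hI hz hq) (h.ne_n hx)

theorem St.fix_val_le {σ : St} (h : ∀ y, σ.val y ≤ 1) (x y : ℕ) : (σ.fix x).val y ≤ 1 := by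
  rw [St.fix_val]; split_ifs
  exacts [Nat.sub_le _ _, h y]

theorem stepPair_spec {B : ℝ} (hI : I.Valid B) {σ : St} (h : Inv I σ) (hph : σ.ph = 1) {d : ℕ}
    (hd : (stepPair I d σ).st = 0) :
    Inv I (stepPair I d σ) ∧ fuel I (stepPair I d σ) < fuel I σ := by
  obtain ⟨hm0, hmark⟩ := h.early (by omega)
  have hfix : ∀ (τ : St) (x : ℕ), τ.ph = 1 → Inv I τ → τ.mark x = 0 → ∀ k, ∃ h : x ≠ I.n,
      Inv I { τ.fix x with k := k } := by
    intro τ x hτ h hx k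
    obtain ⟨hm0, hmark⟩ := h.early (by omega)
    have hxn := h.ne_n (by omega : τ.mark x ≠ 1)
    refine ⟨hxn, .of_early (by simp [St.fix, hτ]) (St.fix_val_le h.val_le x) ?_ ?_
      (by simp [St.fix, hτ]) hm0 fun y => ?_⟩
    · change (τ.fix x).val I.n = 1
      rw [St.fix_val, if_neg hxn.symm, h.val_n]
    · change (τ.fix x).mark I.n = 1
      rw [St.fix_mark, if_neg hxn.symm, h.mark_n]
    · change (τ.fix x).mark y ≤ 1
      rw [St.fix_mark]; split_ifs
      exacts [le_rfl, hmark y]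
  unfold stepPair at hd ⊢
  dsimp only at hd ⊢
  set w := first (fun w => I.Pair σ.val σ.mark (w / I.c) (w % I.c)) (min (I.c * I.c) I.cap) with hwdef
  split_ifs at hd ⊢ with h1 h2 h3 h4 h5 h6 <;> try (simp [St.dead] at hd; done)
  · obtain ⟨hyc, hzc⟩ := pair_lt hI h1
    obtain ⟨hne, hinv⟩ := hfix σ _ hph h h2.2.1 (σ.k - 1)
    refine ⟨hinv, ?_⟩
    have hlt := v_lt hI h hyc (by omega : d / 3 < 3) (by rw [h2.2.1]; norm_num)
    have := card_fixed_lt (f := σ.mark) (g := (σ.fix (I.v (w / I.c) (d / 3))).mark) hlt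
      (by rw [h2.2.1]; norm_num) (by rw [St.fix_mark, if_pos rfl])
      (fun y hy => by rw [St.fix_mark, hy]; simp)
    simp only [fuel, St.fix, hph] at this ⊢
    norm_num at this ⊢
    exact this
  · obtain ⟨hyc, hzc⟩ := pair_lt hI h1
    obtain ⟨hne, hinv⟩ := hfix σ _ hph h h2.2.1 σ.k
    obtain ⟨hne', hinv'⟩ := hfix (σ.fix (I.v (w / I.c) (d / 3))) (I.v (w % I.c) (d % 3))
      (by simp [St.fix, hph]) hinv (by rw [St.fix_mark, if_neg (Ne.symm h3), h2.2.2]) (σ.k - 2)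
    refine ⟨hinv', ?_⟩
    have hlt := v_lt hI h hyc (by omega : d / 3 < 3) (by rw [h2.2.1]; norm_num)
    have := card_fixed_lt (f := σ.mark)
      (g := ((σ.fix (I.v (w / I.c) (d / 3))).fix (I.v (w % I.c) (d % 3))).mark) hlt
      (by rw [h2.2.1]; norm_num) (by rw [St.fix_mark, St.fix_mark]; simp)
      (fun y hy => by rw [St.fix_mark, St.fix_mark, hy]; simp)
    simp only [fuel, St.fix, hph] at this ⊢
    norm_num at this ⊢
    exact this
  · have hnp : ∀ y < I.c, ∀ z < I.c, ¬ I.Pair σ.val σ.mark y z := by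
      intro y hy z hz
      have hc : 0 < I.c := by omega
      have := of_first h1 (z := I.c * y + z) (by rw [min_eq_left hI.sq_le]; nlinarith)
      rwa [Nat.mul_add_div hc, Nat.mul_add_mod, Nat.div_eq_of_lt hz, Nat.mod_eq_of_lt hz,
        add_zero] at this
    have hfull : ∀ z < I.c, I.False σ.val z → ∀ q < 3, σ.mark (I.v z q) = 0 := by
      intro z hz hF q hq
      by_contra hne
      refine hnp z hz z hz ⟨hF, hF, .inl ⟨rfl, ?_⟩⟩
      interval_cases q
      exacts [.inl hne, .inr (.inl hne), .inr (.inr hne)]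
    have or3 : ∀ (P : ℕ → Prop) (q : ℕ), q < 3 → P q → P 0 ∨ P 1 ∨ P 2 := by
      intro P q hq hP
      interval_cases q
      exacts [.inl hP, .inr (.inl hP), .inr (.inr hP)]
    refine ⟨⟨by simp, h.val_le, h.val_n, h.mark_n, by simp, by simp, ?_, ?_, ?_, by simp, ?_, ?_, ?_,
      by simp, h.m_le⟩, ?_⟩
    · intro _ x hx
      have := hmark x
      simp at hx; omega
    · intro _ o ho
      simp only [hm0] at ho; omega
    · intro _ o ho
      simp only [hm0] at ho; omega
    · intro _ z hz hF q hq
      simp only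
      rw [hfull z hz hF q hq]; norm_num
    · intro _ y hy z hz hFy hFz q hq hM q' hq'
      by_contra hne
      refine hnp y hy z hz ⟨hFy, hFz, .inr ⟨or3 _ q hq ⟨hfull y hy hFy q hq, hM⟩,
        or3 _ q' hq' ⟨hfull y hy hFy q' hq', hne⟩⟩⟩
    · intro _ o ho
      simp only [hm0] at ho; omega
    · have := card_filter_range_le I.n (fun x => σ.mark x = 0)
      simp only [fuel, hph]
      norm_num at this ⊢
      omega

theorem stepFamily_spec {B : ℝ} (hI : I.Valid B) {σ : St} (h : Inv I σ) (hph : σ.ph = 2) {d : ℕ}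
    (hd : (stepFamily I d σ).st = 0) :
    Inv I (stepFamily I d σ) ∧ fuel I (stepFamily I d σ) < fuel I σ := by
  have hcap := hI.n_le
  have hmle := h.m_le
  have h2 : 2 ≤ σ.ph := by omega
  have hne4 : σ.ph ≠ 4 := by omega
  unfold stepFamily at hd ⊢
  dsimp only at hd ⊢
  set z := first (I.Fresh σ.val σ.mark) I.c with hzdef
  split_ifs at hd ⊢ with h1 h3 h3 <;> try (simp [St.dead] at hd; done)
  · obtain ⟨hF, hfr⟩ : I.Fresh σ.val σ.mark z := first_spec h1
    have hfr : ∀ q < 3, σ.mark (I.v z q) = 0 := by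
      intro q hq
      interval_cases q
      exacts [hfr.1, hfr.2.1, hfr.2.2]
    have hlt : ∀ q < 3, I.v z q < I.n := fun q hq => v_lt hI h h1 hq (by rw [hfr q hq]; norm_num)
    rw [show min (σ.m + 1) I.cap = σ.m + 1 by omega, show min (σ.m + 2) I.cap = σ.m + 2 by omega]
    set mk := Function.update (Function.update (Function.update σ.mark (I.v z 0) (σ.m + 2))
      (I.v z 1) (σ.m + 2)) (I.v z 2) (σ.m + 2) with hmk
    set tv := Function.update (Function.update (Function.update σ.tv (3 * σ.m) (I.v z 0))
      (3 * σ.m + 1) (I.v z 1)) (3 * σ.m + 2) (I.v z 2) with htv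
    have hmk_in : ∀ q < 3, mk (I.v z q) = σ.m + 2 := by
      intro q hq
      simp only [hmk, Function.update_apply]
      interval_cases q <;> simp
    have hmk_out : ∀ y, (∀ q < 3, y ≠ I.v z q) → mk y = σ.mark y := by
      intro y hy
      simp only [hmk, Function.update_apply, hy 0 (by norm_num), hy 1 (by norm_num),
        hy 2 (by norm_num), if_false]
    have hmk_cases : ∀ y, (∃ q < 3, y = I.v z q) ∨ mk y = σ.mark y := by
      intro y
      by_cases hy : ∃ q < 3, y = I.v z q
      · exact .inl hy
      · push Not at hy; exact .inr (hmk_out y hy)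
    have htv_new : ∀ p < 3, tv (3 * σ.m + p) = I.v z p := by
      intro p hp
      simp only [htv, Function.update_apply]
      interval_cases p <;> simp
    have htv_old : ∀ o < σ.m, ∀ p < 3, tv (3 * o + p) = σ.tv (3 * o + p) := by
      intro o ho p hp
      simp only [htv, Function.update_apply]
      rw [if_neg (by omega), if_neg (by omega), if_neg (by omega)]
    have htri : ∀ o < σ.m + 1, ∀ p < 3, tv (3 * o + p) < I.n ∧ mk (tv (3 * o + p)) = o + 2 := by
      intro o ho p hp
      rcases Nat.lt_succ_iff_lt_or_eq.1 ho with ho | rfl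
      · rw [htv_old o ho p hp]
        obtain ⟨t1, t2⟩ := h.tri h2 o ho (fun h => absurd h hne4) p hp
        refine ⟨t1, ?_⟩
        rw [hmk_out _ fun q hq he => ?_, t2]
        rw [he, hfr q hq] at t2; omega
      · rw [htv_new p hp]
        exact ⟨hlt p hp, hmk_in p hp⟩
    -- The mark of a variable identifies its member, so the first variables of the members are
    -- distinct.
    have hnew_le : σ.m + 1 ≤ I.n := by
      have := card_le_card_of_injOn (s := range (σ.m + 1)) (t := range I.n) (fun o => tv (3 * o + 0))
        (fun o ho => by
          have := (htri o (by simpa using ho) 0 (by norm_num)).1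
          simpa using this)
        (fun o ho o' ho' he => by
          have e1 := (htri o (by simpa using ho) 0 (by norm_num)).2
          have e2 := (htri o' (by simpa using ho') 0 (by norm_num)).2
          simp only at he
          rw [he, e2] at e1; omega)
      simpa using this
    refine ⟨⟨by simp [hph], h.val_le, h.val_n, ?_, by simp [hph], by simp [hph], ?_, ?_, ?_,
      by simp [hph], ?_, ?_, ?_, by simp [hph], hnew_le⟩, ?_⟩
    · change mk I.n = 1
      rw [hmk_out _ fun q hq he => ?_, h.mark_n]
      have := hlt q hq; omega
    · intro _ x hx
      refine ⟨?_, ?_, fun h => absurd h hne4⟩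
      · change mk x - 2 < σ.m + 1
        rcases hmk_cases x with ⟨q, hq, rfl⟩ | he
        · rw [hmk_in q hq]; omega
        · change 2 ≤ mk x at hx
          rw [he] at hx ⊢
          have := (h.owned h2 x hx).1
          omega
      · change ∃ p < 3, tv (3 * (mk x - 2) + p) = x
        rcases hmk_cases x with ⟨q, hq, rfl⟩ | he
        · rw [hmk_in q hq]; exact ⟨q, hq, htv_new q hq⟩
        · change 2 ≤ mk x at hx
          rw [he] at hx ⊢
          obtain ⟨o1, ⟨p, hp, o2⟩, _⟩ := h.owned h2 x hx
          exact ⟨p, hp, by rw [htv_old _ o1 p hp, o2]⟩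
    · intro _ o ho _ p hp
      exact htri o ho p hp
    · intro _ o ho _ p hp p' hp' he
      change tv _ = tv _ at he
      rcases Nat.lt_succ_iff_lt_or_eq.1 ho with ho | rfl
      · rw [htv_old o ho p hp, htv_old o ho p' hp'] at he
        exact h.inj h2 o ho (fun h => absurd h hne4) p hp p' hp' he
      · rw [htv_new p hp, htv_new p' hp'] at he
        exact v_inj hI h.val_le h1 hF hp hp' (by have := hlt p hp; omega) he
    · intro _ y hy hFy q hq
      change mk _ ≠ 1
      rcases hmk_cases (I.v y q) with ⟨q', hq', he⟩ | he
      · rw [he, hmk_in q' hq']; omega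
      · rw [he]; exact h.full hph y hy hFy q hq
    · intro _; exact h.apart hph
    · intro _ o ho
      change ∃ z < I.c, I.False σ.val z ∧ ∀ p < 3, tv (3 * o + p) = I.v z p
      rcases Nat.lt_succ_iff_lt_or_eq.1 ho with ho | rfl
      · obtain ⟨y, hy, hFy, he⟩ := h.origin hph o ho
        exact ⟨y, hy, hFy, fun p hp => by rw [htv_old o ho p hp, he p hp]⟩
      · exact ⟨z, h1, hF, htv_new⟩
    · have : #{x ∈ range I.n | mk x = 0} < #{x ∈ range I.n | σ.mark x = 0} := by
        apply card_lt_card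
        rw [ssubset_iff_of_subset]
        · exact ⟨I.v z 0, by simp [hlt 0, hfr 0], by simp [hmk_in 0]⟩
        · intro y hy
          rw [mem_filter] at hy ⊢
          refine ⟨hy.1, ?_⟩
          rcases hmk_cases y with ⟨q', hq', he⟩ | he
          · rw [he, hmk_in q' hq'] at hy; omega
          · rw [← he]; exact hy.2
      simp only [fuel, hph]
      norm_num at this ⊢
      exact this
  · refine ⟨⟨by simp, h.val_le, h.val_n, h.mark_n, by simp, by simp, ?_, ?_, ?_, by simp, by simp,
      by simp, by simp, ?_, h.m_le⟩, ?_⟩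
    · intro _ x hx
      obtain ⟨o1, o2, _⟩ := h.owned h2 x hx
      exact ⟨o1, o2, by simp⟩
    · intro _ o ho _
      exact h.tri h2 o ho fun h => absurd h hne4
    · intro _ o ho _
      exact h.inj h2 o ho fun h => absurd h hne4
    -- Maximality of the family: the clause is not fresh and has no frozen variable, so it contains
    -- a variable of some member. It therefore meets the false clause from which that member came,
    -- and by `apart` contains it entirely.
    · intro _ z hz hF hm
      have hnf := of_first h1 hz
      have : ∃ q < 3, σ.mark (I.v z q) ≠ 0 := by
        by_contra hne
        push Not at hne
        exact hnf ⟨hF, hne 0 (by norm_num), hne 1 (by norm_num), hne 2 (by norm_num)⟩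
      obtain ⟨q, hq, hne⟩ := this
      have hne1 := hm q hq
      obtain ⟨o1, ⟨p, hp, o2⟩, _⟩ := h.owned h2 (I.v z q) (by change σ.mark _ ≠ 1 at hne1; omega)
      refine ⟨_, o1, by simp, fun p' hp' => ?_⟩
      obtain ⟨y, hy, hFy, he⟩ := h.origin hph _ o1
      change I.Mem z (σ.tv _)
      rw [he p' hp']
      refine h.apart hph y hy z hz hFy hF p hp ?_ p' hp'
      rw [← he p hp, o2]
      exact Data.v_mem hq
    · simp only [fuel, hph]
      norm_num
      omega

theorem stepCode_spec {B : ℝ} (hI : I.Valid B) {σ : St} (h : Inv I σ) (hph : σ.ph = 3) {d : ℕ}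
    (hd : (stepCode I d σ).st = 0) :
    Inv I (stepCode I d σ) ∧ fuel I (stepCode I d σ) < fuel I σ := by
  have hcap := hI.n_le
  have hmle := h.m_le
  have h2 : 2 ≤ σ.ph := by omega
  have hne4 : σ.ph ≠ 4 := by omega
  obtain ⟨him, hrp⟩ := h.code hph
  have key : σ.i < σ.m → ∀ s j g y, Inv I { σ with
      s := s, j := j, g := g, rp := Function.update σ.rp σ.i (I.pos y), i := σ.i + 1 } := by
    intro hi s j g y
    refine ⟨by simp [hph], h.val_le, h.val_n, h.mark_n, by simp [hph], by simp [hph], ?_, ?_, ?_, ?_,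
      by simp [hph], by simp [hph], by simp [hph], ?_, h.m_le⟩
    · intro _ x hx
      obtain ⟨o1, o2, _⟩ := h.owned h2 x hx
      exact ⟨o1, o2, by simp [hph]⟩
    · intro _ o ho _
      exact h.tri h2 o ho fun h => absurd h hne4
    · intro _ o ho _
      exact h.inj h2 o ho fun h => absurd h hne4
    · intro _
      refine ⟨hi, fun o ho => ?_⟩
      simp only [Function.update_apply] at ho ⊢
      split_ifs with he
      · exact hI.pos_lt y
      · exact hrp o (by omega)
    · intro _ z hz hF hm
      obtain ⟨o, ho, _, hmem⟩ := h.covers (by omega) z hz hF hm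
      exact ⟨o, ho, by simp [hph], hmem⟩
  have hmin : σ.i < σ.m → min (σ.i + 1) I.cap = σ.i + 1 := by omega
  unfold stepCode at hd ⊢
  split_ifs at hd ⊢ with h1 h2 h3 h4 h5 <;> try (simp [St.dead] at hd; done)
  · rw [hmin h1]
    refine ⟨key h1 _ _ _ _, ?_⟩
    simp only [fuel, hph]; norm_num; omega
  · rw [hmin h1]
    refine ⟨key h1 σ.s σ.j σ.g _, ?_⟩
    simp only [fuel, hph]; norm_num; omega
  · have him' : σ.i = σ.m := by omega
    refine ⟨⟨by simp, h.val_le, h.val_n, h.mark_n, by simp, by simp, ?_, ?_, ?_, by simp, by simp,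
      by simp, by simp, ?_, h.m_le⟩, ?_⟩
    · intro _ x hx
      obtain ⟨o1, o2, _⟩ := h.owned h2 x hx
      exact ⟨o1, o2, fun _ => hrp _ (by rw [him']; exact o1)⟩
    · intro _ o ho _
      exact h.tri h2 o ho fun h => absurd h hne4
    · intro _ o ho _
      exact h.inj h2 o ho fun h => absurd h hne4
    · intro _ z hz hF hm
      obtain ⟨o, ho, _, hmem⟩ := h.covers (by omega) z hz hF hm
      exact ⟨o, ho, fun _ => hrp o (by rw [him']; exact ho), hmem⟩
    · have := card_filter_range_le I.n (fun x => σ.mark x ≠ 1)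
      simp only [fuel, hph]
      norm_num at this ⊢
      omega

/-- A clause without frozen variables that is false after the flip avoids `x`, so it was false
before, and the old `covers` applies. -/
theorem Inv.fix_free {σ : St} (h : Inv I σ) (hph : σ.ph = 4) {x : ℕ} (hx : σ.mark x = 0)
    (k j s : ℕ) : Inv I { σ.fix x with k := k, j := j, s := s } := by
  have h2 : 2 ≤ σ.ph := by omega
  have hxn := h.ne_n (by omega : σ.mark x ≠ 1)
  refine ⟨by simp [St.fix, hph], St.fix_val_le h.val_le x, ?_, ?_, by simp [St.fix, hph],
    by simp [St.fix, hph], ?_, ?_, ?_, by simp [St.fix, hph], by simp [St.fix, hph],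
    by simp [St.fix, hph], by simp [St.fix, hph], ?_, h.m_le⟩
  · change (σ.fix x).val I.n = 1
    rw [St.fix_val, if_neg hxn.symm, h.val_n]
  · change (σ.fix x).mark I.n = 1
    rw [St.fix_mark, if_neg hxn.symm, h.mark_n]
  · intro _ y hy
    have hm : (σ.fix x).mark y = σ.mark y := by
      change 2 ≤ (σ.fix x).mark y at hy
      rw [St.fix_mark] at hy ⊢
      split_ifs at hy ⊢
      · omega
      · rfl
    change 2 ≤ (σ.fix x).mark y at hy
    change (σ.fix x).mark y - 2 < σ.m ∧ (∃ p < 3, σ.tv (3 * ((σ.fix x).mark y - 2) + p) = y) ∧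
      (_ → σ.rp ((σ.fix x).mark y - 2) < 3)
    rw [hm] at hy ⊢
    exact h.owned h2 y hy
  · intro _ o ho hr p hp
    obtain ⟨t1, t2⟩ := h.tri h2 o ho hr p hp
    refine ⟨t1, ?_⟩
    change (σ.fix x).mark (σ.tv _) = o + 2
    rw [St.fix_mark, if_neg fun he => ?_, t2]
    rw [he] at t2; omega
  · intro _ o ho hr
    exact h.inj h2 o ho hr
  · intro _ z hz hF hm
    have hmx : ∀ q < 3, I.v z q ≠ x := by
      intro q hq he
      refine hm q hq ?_
      change (σ.fix x).mark _ = 1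
      rw [St.fix_mark, if_pos he]
    refine h.covers (by omega) z hz ?_ fun q hq => ?_
    · rw [Data.false_iff] at hF ⊢
      intro q hq
      have h1 := hF q hq
      unfold LitFalse at h1 ⊢
      change (σ.fix x).val _ ≠ _ at h1
      rw [St.fix_val, if_neg (show ¬ I.lit (3 * z + q) / 2 = x from hmx q hq)] at h1
      exact h1
    · have h1 := hm q hq
      change (σ.fix x).mark _ ≠ 1 at h1
      rwa [St.fix_mark, if_neg (hmx q hq)] at h1

-- Releasing a member could by itself destroy `covers`. One of its variables is frozen at the same
-- time, however, so the clauses that relied on this member no longer satisfy the premises.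
open Classical in
theorem Inv.release_fix {σ : St} (h : Inv I σ) (hph : σ.ph = 4) {o p : ℕ} (ho : o < σ.m)
    (hr : σ.rp o < 3) (hp : p < 3) (k j s : ℕ) :
    Inv I { (σ.release o).fix (σ.tv (3 * o + p)) with k := k, j := j, s := s } := by
  have h2 : 2 ≤ σ.ph := by omega
  have htri := h.tri h2 o ho (fun _ => hr)
  set x := σ.tv (3 * o + p) with hx
  have hmark : ∀ y, ((σ.release o).fix x).mark y =
      if y = x then 1 else if ∃ p < 3, y = σ.tv (3 * o + p) then 0 else σ.mark y := by
    intro y; rw [St.fix_mark, St.release_mark]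
  have hrp : ∀ o', ((σ.release o).fix x).rp o' = if o' = o then 3 else σ.rp o' := by
    intro o'; simp [St.fix, St.release, Function.update_apply]
  have hval : ∀ y, ((σ.release o).fix x).val y = if y = x then 1 - σ.val x else σ.val y := by
    intro y; rw [St.fix_val]; rfl
  have hn : ∀ p < 3, I.n ≠ σ.tv (3 * o + p) := by
    intro p hp he
    have := (htri p hp).1
    omega
  have hout : ∀ y, σ.mark y ≠ o + 2 → ((σ.release o).fix x).mark y = σ.mark y := by
    intro y hy
    rw [hmark, if_neg, if_neg]
    · rintro ⟨p, hp, rfl⟩; exact hy (htri p hp).2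
    · rintro rfl; exact hy (htri p hp).2
  refine ⟨by simp [St.fix, St.release, hph], St.fix_val_le (σ := σ.release o) h.val_le x, ?_, ?_,
    by simp [St.fix, St.release, hph],
    by simp [St.fix, St.release, hph], ?_, ?_, ?_, by simp [St.fix, St.release, hph],
    by simp [St.fix, St.release, hph], by simp [St.fix, St.release, hph],
    by simp [St.fix, St.release, hph], ?_, h.m_le⟩
  · change ((σ.release o).fix x).val I.n = 1
    rw [hval, if_neg (hn p hp), h.val_n]
  · change ((σ.release o).fix x).mark I.n = 1
    rw [hout _ (by rw [h.mark_n]; omega), h.mark_n]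
  · intro _ y hy
    change 2 ≤ ((σ.release o).fix x).mark y at hy
    have hne : σ.mark y ≠ o + 2 := by
      intro he
      have hy2 : 2 ≤ σ.mark y := by omega
      obtain ⟨_, ⟨p', hp', he'⟩, _⟩ := h.owned h2 y hy2
      rw [he, Nat.add_sub_cancel] at he'
      rw [hmark] at hy
      split_ifs at hy with c1 c2
      · omega
      · omega
      · exact c2 ⟨p', hp', he'.symm⟩
    change ((σ.release o).fix x).mark y - 2 < σ.m ∧
      (∃ p < 3, σ.tv (3 * (((σ.release o).fix x).mark y - 2) + p) = y) ∧
      (_ → ((σ.release o).fix x).rp (((σ.release o).fix x).mark y - 2) < 3)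
    rw [hout y hne] at hy ⊢
    obtain ⟨o1, o2, o3⟩ := h.owned h2 y hy
    refine ⟨o1, o2, fun _ => ?_⟩
    rw [hrp, if_neg (by omega)]
    exact o3 hph
  · intro _ o' ho' hr' p' hp'
    have hr' := hr' hph
    change ((σ.release o).fix x).rp o' < 3 at hr'
    rw [hrp] at hr'
    split_ifs at hr' with hoo
    · omega
    obtain ⟨t1, t2⟩ := h.tri h2 o' ho' (fun _ => hr') p' hp'
    refine ⟨t1, ?_⟩
    change ((σ.release o).fix x).mark (σ.tv (3 * o' + p')) = o' + 2
    rw [hout _ (by rw [t2]; omega), t2]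
  · intro _ o' ho' hr'
    have hr' := hr' hph
    change ((σ.release o).fix x).rp o' < 3 at hr'
    rw [hrp] at hr'
    split_ifs at hr' with hoo
    · omega
    exact h.inj h2 o' ho' (fun _ => hr')
  · intro _ z hz hF hm
    have hmx : ∀ q < 3, I.v z q ≠ x := by
      intro q hq he
      refine hm q hq ?_
      change ((σ.release o).fix x).mark _ = 1
      rw [hmark, if_pos he]
    obtain ⟨o', ho', hr', hmem⟩ := h.covers (by omega) z hz (by
      rw [Data.false_iff] at hF ⊢
      intro q hq
      have h1 := hF q hq
      unfold LitFalse at h1 ⊢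
      change ((σ.release o).fix x).val _ ≠ _ at h1
      rw [hval, if_neg (show ¬ I.lit (3 * z + q) / 2 = x from hmx q hq)] at h1
      exact h1) (fun q hq h1 => hm q hq (by
        change ((σ.release o).fix x).mark _ = 1
        rw [hout _ (by rw [h1]; omega), h1]))
    refine ⟨o', ho', fun _ => ?_, hmem⟩
    change ((σ.release o).fix x).rp o' < 3
    rw [hrp, if_neg]
    · exact hr' hph
    · rintro rfl
      obtain ⟨q, hq, he⟩ := Data.mem_iff.1 (hmem p hp)
      exact hmx q hq he

theorem stepSearch_spec {B : ℝ} (hI : I.Valid B) {σ : St} (h : Inv I σ) (hph : σ.ph = 4) {d : ℕ}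
    (hd : (stepSearch I d σ).st = 0) :
    Inv I (stepSearch I d σ) ∧ fuel I (stepSearch I d σ) < fuel I σ := by
  have h2 : 2 ≤ σ.ph := by omega
  unfold stepSearch at hd ⊢
  dsimp only at hd ⊢
  set z := first (I.False σ.cur) I.c with hzdef
  set x := I.v z (d / 2) with hx
  set o := σ.mark x - 2 with ho
  split_ifs at hd ⊢ with h1 h3 h4 h5 h6 h7 h8 h9 h10 h11 h12 <;>
    first
    | (simp only [St.dead] at hd; exact absurd hd one_ne_zero)
    | (exact absurd hd (show ¬ (2 : ℕ) = 0 from two_ne_zero))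
    | skip
  · refine ⟨h.fix_free hph h4 _ _ _, ?_⟩
    have hlt := v_lt hI h h1 (by omega : d / 2 < 3) (by rw [h4]; norm_num)
    have := card_fixed_lt (f := σ.mark) (g := (σ.fix x).mark) hlt
      (by rw [h4]; norm_num) (by rw [St.fix_mark, if_pos rfl])
      (fun y hy => by rw [St.fix_mark, hy]; simp)
    simp only [fuel, St.fix, hph] at this ⊢
    norm_num at this ⊢
    exact this
  all_goals
    have hx2 : 2 ≤ σ.mark x := by omega
    obtain ⟨o1, ⟨p, hp, o2⟩, o3⟩ := h.owned h2 x hx2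
    have o3 := o3 hph
    have htri := h.tri h2 _ o1 (fun _ => o3)
    have hcard : ∀ y p', p' < 3 → y = σ.tv (3 * o + p') →
        #{x ∈ range I.n | ((σ.release o).fix y).mark x ≠ 1} < #{x ∈ range I.n | σ.mark x ≠ 1} := by
      rintro y p' hp' rfl
      refine card_fixed_lt (htri p' hp').1 (by rw [(htri p' hp').2]; omega)
        (by rw [St.fix_mark, if_pos rfl]) fun y hy => ?_
      rw [St.fix_mark, St.release_mark]
      split_ifs with c1 c2
      · rfl
      · obtain ⟨p2, hp2, rfl⟩ := c2
        rw [(htri p2 hp2).2] at hy; omega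
      · exact hy
  · refine ⟨h.release_fix hph o1 o3 (Nat.mod_lt _ (by norm_num)) _ _ _, ?_⟩
    have := hcard _ ((σ.rp o + 1 + d % 2) % 3) (Nat.mod_lt _ (by norm_num)) rfl
    rw [fuel_search hph, fuel_search (by simp [St.fix, St.release, hph])]
    exact this
  · have hinv := h.release_fix hph o1 o3 hp σ.k σ.j (σ.s - 1)
    rw [o2] at hinv
    refine ⟨hinv, ?_⟩
    have := hcard x p hp o2.symm
    rw [fuel_search hph, fuel_search (by simp [St.fix, St.release, hph])]
    exact this
  · have hinv := h.release_fix hph o1 o3 hp σ.k σ.j σ.s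
    rw [o2] at hinv
    have hw : ((σ.release o).fix x).mark (σ.tv (3 * o + σ.rp o)) = 0 := by
      rw [St.fix_mark, if_neg h7, St.release_mark, if_pos ⟨_, o3, rfl⟩]
    refine ⟨hinv.fix_free (by simp [St.fix, St.release, hph]) hw _ _ _, ?_⟩
    have := hcard x p hp o2.symm
    have h3 : #{y ∈ range I.n | (((σ.release o).fix x).fix (σ.tv (3 * o + σ.rp o))).mark y ≠ 1} ≤
        #{y ∈ range I.n | ((σ.release o).fix x).mark y ≠ 1} := by
      apply card_le_card
      intro y hy
      rw [mem_filter] at hy ⊢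
      refine ⟨hy.1, fun h => hy.2 ?_⟩
      rw [St.fix_mark, h]; simp
    rw [fuel_search hph, fuel_search (by simp [St.fix, St.release, hph])]
    exact h3.trans_lt this

/-- The invariants are preserved, and the fuel decreases. -/
theorem step_spec {B : ℝ} (hI : I.Valid B) {σ : St} (h : Inv I σ) {d : ℕ}
    (hd : (step I d σ).st = 0) : Inv I (step I d σ) ∧ fuel I (step I d σ) < fuel I σ := by
  have hph := h.ph
  unfold step at hd ⊢
  split_ifs at hd ⊢ with h0 h1 h2 h3
  exacts [stepInit_spec hI h h0 hd, stepPair_spec hI h h1 hd, stepFamily_spec hI h h2 hd,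
    stepCode_spec hI h h3 hd, stepSearch_spec hI h (by omega) hd]

end Search


namespace Search

open Finset

variable {I : Data}

/-! #### Soundness -/

/-- The number of variables below `n` on which two assignments differ. -/
def ham (n : ℕ) (f g : ℕ → ℕ) : ℕ := #{x ∈ range n | f x ≠ g x}

theorem ham_fix_le (n : ℕ) (f : ℕ → ℕ) (σ : St) (x : ℕ) :
    ham n f (σ.fix x).val ≤ ham n f σ.val + 1 := by
  have : {y ∈ range n | f y ≠ (σ.fix x).val y} ⊆ insert x {y ∈ range n | f y ≠ σ.val y} := by
    intro y hy
    rw [mem_filter] at hy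
    rw [mem_insert, mem_filter]
    by_cases h : y = x
    · exact .inl h
    · rw [St.fix_val, if_neg h] at hy
      exact .inr hy
  exact (card_le_card this).trans (card_insert_le _ _)

/-- The number of flipped variables of family members. -/
def flipped (σ : St) : ℕ := if σ.ph = 4 then #{o ∈ range σ.m | σ.rp o < 3} else σ.m

theorem card_act_lt {σ : St} {o : ℕ} (ho : o < σ.m) (hr : σ.rp o < 3) :
    #{o' ∈ range σ.m | (σ.release o).rp o' < 3} + 1 ≤ #{o' ∈ range σ.m | σ.rp o' < 3} := by
  apply Nat.succ_le_of_lt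
  apply card_lt_card
  rw [ssubset_iff_of_subset]
  · exact ⟨o, by simp [ho, hr], by rw [mem_filter]; simp [St.release]⟩
  · intro y hy
    rw [mem_filter] at hy ⊢
    refine ⟨hy.1, ?_⟩
    have := hy.2
    simp only [St.release, Function.update_apply] at this
    split_ifs at this
    · omega
    · exact this

/-- The distance from `α` that the search can still reach. -/
theorem reach_step (α : ℕ → ℕ) {σ : St} (h : Inv I σ) {d : ℕ}
    (hph : σ.ph ≠ 0) (hd : (step I d σ).st = 0) : (step I d σ).ph ≠ 0 ∧
    ham I.n α (step I d σ).val + (step I d σ).k + flipped (step I d σ) ≤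
      ham I.n α σ.val + σ.k + flipped σ := by
  have h4 := h.ph
  unfold step at hd ⊢
  rw [if_neg hph] at hd ⊢
  split_ifs at hd ⊢ with h1 h2 h3
  · unfold stepPair at hd ⊢
    dsimp only at hd ⊢
    split_ifs at hd ⊢ <;>
    first
    | (simp only [St.dead] at hd; exact absurd hd one_ne_zero)
    | skip
    · rename_i h5 h6 h7 h8
      have := ham_fix_le I.n α σ (I.v (first (fun w => I.Pair σ.val σ.mark (w / I.c) (w % I.c)) (min (I.c * I.c) I.cap) / I.c) (d / 3))
      refine ⟨by simpa [St.fix], ?_⟩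
      simp only [flipped, h1] at this ⊢
      simp only [St.fix, h1] at this ⊢
      omega
    · rename_i h5 h6 h7 h8
      set w := first (fun w => I.Pair σ.val σ.mark (w / I.c) (w % I.c)) (min (I.c * I.c) I.cap)
      have e1 := ham_fix_le I.n α σ (I.v (w / I.c) (d / 3))
      have e2 := ham_fix_le I.n α (σ.fix (I.v (w / I.c) (d / 3))) (I.v (w % I.c) (d % 3))
      refine ⟨by simpa [St.fix], ?_⟩
      simp only [flipped, St.fix, h1] at e1 e2 ⊢
      omega
    · refine ⟨by simp, ?_⟩
      simp only [flipped, h1]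
      simp
  · unfold stepFamily at hd ⊢
    dsimp only at hd ⊢
    split_ifs at hd ⊢ <;>
    first
    | (simp only [St.dead] at hd; exact absurd hd one_ne_zero)
    | skip
    -- The unit taken from `k` reappears as a member in `flipped`.
    · refine ⟨hph, ?_⟩
      simp only [flipped, h2]
      norm_num
      omega
    · refine ⟨by simp, ?_⟩
      simp only [flipped, h2]
      norm_num
  · unfold stepCode at hd ⊢
    split_ifs at hd ⊢ <;>
    first
    | (simp only [St.dead] at hd; exact absurd hd one_ne_zero)
    | skip
    · refine ⟨hph, ?_⟩
      simp only [flipped, h3]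
      norm_num
    · refine ⟨hph, ?_⟩
      simp only [flipped, h3]
      norm_num
    · refine ⟨by simp, ?_⟩
      have := card_filter_range_le σ.m (fun o => σ.rp o < 3)
      simp only [flipped, h3]
      norm_num
      exact this
  · have hph4 : σ.ph = 4 := by omega
    have h2' : 2 ≤ σ.ph := by omega
    unfold stepSearch at hd ⊢
    dsimp only at hd ⊢
    set z := first (I.False σ.cur) I.c with hzdef
    set x := I.v z (d / 2) with hx
    set o := σ.mark x - 2 with ho
    split_ifs at hd ⊢ with h1 h3 h4 h5 h6 h7 h8 h9 h10 h11 h12 <;>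
    first
    | (simp only [St.dead] at hd; exact absurd hd one_ne_zero)
    | (exact absurd hd (show ¬ (2 : ℕ) = 0 from two_ne_zero))
    | skip
    · have := ham_fix_le I.n α σ x
      refine ⟨by simp [St.fix, hph4], ?_⟩
      simp only [flipped, St.fix, hph4] at this ⊢
      omega
    -- Releasing an active member gives back its temporary flip, which makes up for one permanent
    -- flip; only an extra flip draws on `k`.
    all_goals
      have hx2 : 2 ≤ σ.mark x := by omega
      obtain ⟨o1, ⟨p, hp, o2⟩, o3⟩ := h.owned h2' x hx2
      have hc := card_act_lt (o := o) o1 (o3 hph4)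
    · have := ham_fix_le I.n α (σ.release o) (σ.tv (3 * o + (σ.rp o + 1 + d % 2) % 3))
      refine ⟨by simp [St.fix, St.release, hph4], ?_⟩
      simp only [flipped, St.fix, St.release, hph4, if_true] at this hc ⊢
      omega
    · have := ham_fix_le I.n α (σ.release o) x
      refine ⟨by simp [St.fix, St.release, hph4], ?_⟩
      simp only [flipped, St.fix, St.release, hph4, if_true] at this hc ⊢
      omega
    · have e1 := ham_fix_le I.n α (σ.release o) x
      have e2 := ham_fix_le I.n α ((σ.release o).fix x) (σ.tv (3 * o + σ.rp o))
      refine ⟨by simp [St.fix, St.release, hph4], ?_⟩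
      simp only [flipped, St.fix, St.release, hph4, if_true] at e1 e2 hc ⊢
      omega

/-- Accepting states carry a satisfying assignment. -/
theorem accept_spec {σ : St} (hst : σ.st = 0) (h : Inv I σ) {d : ℕ}
    (hd : (step I d σ).st = 2) : (∀ z < I.c, ¬ I.False σ.cur z) ∧ (∀ x, σ.cur x ≤ 1) ∧
    σ.cur I.n = 1 ∧ ∀ α, ham I.n α σ.cur ≤ ham I.n α σ.val + flipped σ := by
  have h4 := h.ph
  have hcur : ∀ x, σ.cur x ≤ 1 := by
    intro x; unfold St.cur; split_ifs
    exacts [Nat.sub_le _ _, h.val_le x]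
  have hno : ∀ (I : Data) (d : ℕ), σ.dead.st ≠ 2 ∧ σ.st ≠ 2 := fun _ _ => by simp [St.dead, hst]
  have hcn : σ.cur I.n = 1 := by
    unfold St.cur; rw [h.mark_n, if_neg (by omega), h.val_n]
  unfold step at hd
  split_ifs at hd with h0 h1 h2 h3
  · unfold stepInit at hd
    split_ifs at hd <;> simp [St.dead, hst] at hd
  · unfold stepPair at hd
    dsimp only at hd
    split_ifs at hd <;> simp [St.dead, St.fix, hst] at hd
  · unfold stepFamily at hd
    dsimp only at hd
    split_ifs at hd <;> simp [St.dead, hst] at hd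
  · unfold stepCode at hd
    split_ifs at hd <;> simp [St.dead, hst] at hd
  · have hph4 : σ.ph = 4 := by omega
    unfold stepSearch at hd
    dsimp only at hd
    split_ifs at hd with c1 <;> first | (simp [St.dead, St.fix, St.release, hst] at hd; done) | skip
    refine ⟨fun z hz => of_first c1 hz, hcur, hcn, fun α => ?_⟩
    -- The assignments `cur` and `val` differ only at the flipped variables of active members, one
    -- for each.
    have : {x ∈ range I.n | α x ≠ σ.cur x} ⊆ {x ∈ range I.n | α x ≠ σ.val x} ∪
        ({o ∈ range σ.m | σ.rp o < 3}).image (fun o => σ.tv (3 * o + σ.rp o)) := by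
      intro x hx
      rw [mem_filter] at hx
      rw [mem_union]
      by_cases hc : 2 ≤ σ.mark x ∧ σ.tv (3 * (σ.mark x - 2) + σ.rp (σ.mark x - 2)) = x
      · right
        obtain ⟨o1, _, o3⟩ := h.owned (by omega) x hc.1
        exact mem_image.2 ⟨_, mem_filter.2 ⟨mem_range.2 o1, o3 hph4⟩, hc.2⟩
      · left
        rw [St.cur, if_neg hc] at hx
        exact mem_filter.2 hx
    have h1 := card_le_card this
    have h2 := card_union_le {x ∈ range I.n | α x ≠ σ.val x}
      (({o ∈ range σ.m | σ.rp o < 3}).image (fun o => σ.tv (3 * o + σ.rp o)))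
    have h3 := card_image_le (s := {o ∈ range σ.m | σ.rp o < 3})
      (f := fun o => σ.tv (3 * o + σ.rp o))
    simp only [ham, flipped, hph4, if_true]
    omega

/-! #### Completeness -/

/-- The variables of the member `o` that the assignment `β` asks to flip. -/
def hits (σ : St) (β : ℕ → ℕ) (o : ℕ) : ℕ :=
  #{p ∈ range 3 | σ.val (σ.tv (3 * o + p)) ≠ β (σ.tv (3 * o + p))}

/-- The code flipped a variable that already agrees with `β`: the member may need a switch. -/
def miss (σ : St) (β : ℕ → ℕ) (o : ℕ) : ℕ :=
  if σ.val (σ.tv (3 * o + σ.rp o)) = β (σ.tv (3 * o + σ.rp o)) then 1 else 0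

/-- The code flipped a right variable, but `β` changes a second one too: the member may need an
extra flip. -/
def multi (σ : St) (β : ℕ → ℕ) (o : ℕ) : ℕ :=
  if σ.val (σ.tv (3 * o + σ.rp o)) ≠ β (σ.tv (3 * o + σ.rp o)) ∧ 2 ≤ hits σ β o then 1 else 0

/-- The free variables that `β` asks to flip. -/
def free (n : ℕ) (σ : St) (β : ℕ → ℕ) : ℕ := #{x ∈ range n | σ.mark x = 0 ∧ σ.val x ≠ β x}

open Classical in
/-- The number of positions from `r` on, in a block of length `t`, with the property `P`. -/
noncomputable def later (t r : ℕ) (P : ℕ → Prop) : ℕ := #{q ∈ range t | r ≤ q ∧ P q}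

/-- The number of remaining positions `q` of the block of `i`, if it is under way, for which the
`q`-th entry has the property `R`. -/
noncomputable def pending (t i : ℕ) (R : ℕ → ℕ → Prop) : ℕ :=
  if i % t = 0 then 0 else later t (i % t) fun q => R (i - i % t + q) q

theorem later_of_le (t : ℕ) (P : ℕ → Prop) : later t t P = 0 := by
  simp only [later, card_eq_zero, filter_eq_empty_iff, mem_range]
  intro q hq h; omega

open Classical in
theorem later_eq {t r : ℕ} (P : ℕ → Prop) (hr : r < t) :
    later t r P = (if P r then 1 else 0) + later t (r + 1) P := by
  unfold later
  have h1 : ∀ r, #{q ∈ range t | r ≤ q ∧ P q} = ∑ q ∈ Ico r t, if P q then 1 else 0 := by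
    intro r
    rw [← sum_filter, ← card_eq_sum_ones]
    congr 1
    ext q
    simp only [mem_filter, mem_range, mem_Ico]
    tauto
  rw [h1, h1, sum_eq_sum_Ico_succ_bot hr]

-- Writing an entry moves its error from the pending part of the block to the part already written.
open Classical in
theorem pending_succ {t : ℕ} (ht : 0 < t) (i : ℕ) (R : ℕ → ℕ → Prop) :
    (if R i (i % t) then 1 else 0) + pending t (i + 1) R =
      later t (i % t) fun q => R (i - i % t + q) q := by
  have hle := Nat.mod_le i t
  rw [later_eq _ (Nat.mod_lt i ht), Nat.sub_add_cancel hle, pending, succ_mod ht]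
  by_cases h1 : i % t + 1 = t
  · rw [h1, later_of_le]
    simp
  · rw [if_neg h1, if_neg (Nat.succ_ne_zero _), show i + 1 - (i % t + 1) = i - i % t by omega]

open Classical in
theorem pending_succ_start {t : ℕ} (ht : 0 < t) {i : ℕ} (hi : i % t = 0) (R : ℕ → ℕ → Prop) :
    (if R i 0 then 1 else 0) + pending t (i + 1) R = #{q ∈ range t | R (i + q) q} := by
  have := pending_succ ht i R
  rw [hi, Nat.sub_zero] at this
  rw [this]
  simp [later]

open Classical in
theorem pending_succ_cont {t : ℕ} (ht : 0 < t) {i : ℕ} (hi : i % t ≠ 0) (R : ℕ → ℕ → Prop) :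
    (if R i (i % t) then 1 else 0) + pending t (i + 1) R = pending t i R := by
  rw [pending_succ ht, pending, if_neg hi]

theorem pending_zero (t : ℕ) (R : ℕ → ℕ → Prop) : pending t 0 R = 0 := by simp [pending]

/-- `β` asks to flip the variable `p` of the member `o`; members that do not exist count as if only
their first variable had to be flipped. -/
def Asks (σ : St) (β : ℕ → ℕ) (o p : ℕ) : Prop :=
  if o < σ.m then σ.val (σ.tv (3 * o + p)) ≠ β (σ.tv (3 * o + p)) else p = 0

open Classical in
/-- The conditions under which the assignment `β` is found below the state. -/
structure Good (I : Data) (β : ℕ → ℕ) (σ : St) : Prop where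
  fixed : ∀ x, σ.mark x = 1 → σ.val x = β x
  -- The radius of a code word is added to `k` when the word is chosen, so the errors in the
  -- unwritten rest of the block must already be counted.
  init : σ.ph = 0 → σ.i ≤ I.n ∧ #{x ∈ range σ.i | σ.val x ≠ β x} +
    pending I.tA σ.i (fun x q => I.bit (σ.g * I.tA + q) ≠ β x) ≤ σ.k
  pair : σ.ph = 1 → free I.n σ β ≤ σ.k
  -- One flip per member has been paid for already. By `hit` the truncated subtraction loses
  -- nothing.
  family : σ.ph = 2 ∨ σ.ph = 3 → free I.n σ β + ∑ o ∈ range σ.m, (hits σ β o - 1) ≤ σ.k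
  hit : 2 ≤ σ.ph → ∀ o < σ.m, (σ.ph = 4 → σ.rp o < 3) → 1 ≤ hits σ β o
  codeS : σ.ph = 3 → ∑ o ∈ range σ.i, miss σ β o + 
    pending I.tC σ.i (fun o q => ¬ Asks σ β o (I.pos (σ.g * I.tC + q))) ≤ σ.s
  codeJ : σ.ph = 3 → ∑ o ∈ range σ.i, multi σ β o + 
    pending I.tC σ.i (fun o q => Asks σ β o (I.pos (σ.g * I.tC + q)) ∧
      2 ≤ #{p ∈ range 3 | Asks σ β o p}) ≤ σ.j
  search : σ.ph = 4 →
    free I.n σ β + ∑ o ∈ range σ.m with σ.rp o < 3, (hits σ β o - 1) ≤ σ.k ∧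
    ∑ o ∈ range σ.m with σ.rp o < 3, miss σ β o ≤ σ.s ∧
    ∑ o ∈ range σ.m with σ.rp o < 3, multi σ β o ≤ σ.j

/-- Passing from one set of marks to another by marking the injective family `t` changes the number
of unmarked elements with a property. -/
theorem card_marked {n : ℕ} {f g : ℕ → ℕ} {t : ℕ → ℕ} (P : ℕ → Prop) [DecidablePred P]
    (ht : ∀ p < 3, t p < n) (inj : ∀ p < 3, ∀ p' < 3, t p = t p' → p = p')
    (hf : ∀ p < 3, f (t p) = 0) (hg : ∀ p < 3, g (t p) ≠ 0)
    (heq : ∀ x, (∀ p < 3, x ≠ t p) → g x = f x) :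
    #{x ∈ range n | f x = 0 ∧ P x} = #{x ∈ range n | g x = 0 ∧ P x} + #{p ∈ range 3 | P (t p)} := by
  have h1 : #{p ∈ range 3 | P (t p)} = #(({p ∈ range 3 | P (t p)}).image t) := by
    rw [card_image_of_injOn]
    intro p hp p' hp' he
    simp only [coe_filter, mem_range, Set.mem_ofPred_eq] at hp hp'
    exact inj p hp.1 p' hp'.1 he
  rw [h1, ← card_union_of_disjoint]
  · congr 1
    ext x
    simp only [mem_union, mem_filter, mem_range, mem_image]
    constructor
    · rintro ⟨hx, hfx, hP⟩
      by_cases h : ∃ p < 3, x = t p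
      · obtain ⟨p, hp, rfl⟩ := h
        exact .inr ⟨p, ⟨hp, hP⟩, rfl⟩
      · push Not at h
        exact .inl ⟨hx, by rw [heq x h, hfx], hP⟩
    · rintro (⟨hx, hgx, hP⟩ | ⟨p, ⟨hp, hP⟩, rfl⟩)
      · refine ⟨hx, ?_, hP⟩
        rw [← heq x, hgx]
        rintro p hp rfl
        exact hg p hp hgx
      · exact ⟨ht p hp, hf p hp, hP⟩
  · rw [disjoint_left]
    intro x hx hx'
    obtain ⟨p, hp, rfl⟩ := mem_image.1 hx'
    exact hg p (mem_range.1 (mem_filter.1 hp).1) (mem_filter.1 hx).2.1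

theorem free_fix {n : ℕ} {σ : St} {β : ℕ → ℕ} {x : ℕ} (hx : x < n) (h0 : σ.mark x = 0)
    (hne : σ.val x ≠ β x) : free n (σ.fix x) β + 1 = free n σ β := by
  unfold free
  have : {y ∈ range n | (σ.fix x).mark y = 0 ∧ (σ.fix x).val y ≠ β y} =
      ({y ∈ range n | σ.mark y = 0 ∧ σ.val y ≠ β y}).erase x := by
    ext y
    simp only [mem_filter, mem_erase, St.fix_mark, St.fix_val]
    by_cases h : y = x <;> simp [h]
  rw [this, card_erase_add_one]
  simp [hx, h0, hne]

theorem flip_eq {a b : ℕ} (ha : a ≤ 1) (hb : b ≤ 1) (h : a ≠ b) : 1 - a = b := by omega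

theorem good_fixed_fix {σ : St} {β : ℕ → ℕ} (hβ : ∀ x, β x ≤ 1) (hv : ∀ x, σ.val x ≤ 1)
    (h : ∀ x, σ.mark x = 1 → σ.val x = β x) {x : ℕ} (hne : σ.val x ≠ β x) :
    ∀ y, (σ.fix x).mark y = 1 → (σ.fix x).val y = β y := by
  intro y hy
  rw [St.fix_mark] at hy
  rw [St.fix_val]
  split_ifs at hy ⊢ with hyx
  · rw [hyx]; exact flip_eq (hv x) (hβ x) hne
  · exact h y hy

/-- A clause that is false under `f` and satisfied by `β` has a variable on which they differ. -/
theorem exists_ne {f β : ℕ → ℕ} {z : ℕ} (hF : I.False f z) (hβ : ¬ I.False β z) :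
    ∃ q < 3, f (I.v z q) ≠ β (I.v z q) := by
  rw [Data.false_iff] at hF hβ
  push Not at hβ
  obtain ⟨q, hq, h⟩ := hβ
  refine ⟨q, hq, ?_⟩
  have h1 := hF q hq
  unfold LitFalse at h h1
  push Not at h
  unfold Data.v
  rwa [h]

open Classical in
theorem good_stepInit {B : ℝ} (hI : I.Valid B) {β : ℕ → ℕ} (hβ : ∀ x, β x ≤ 1) {σ : St}
    (h : Inv I σ) (hst : σ.st = 0) (hph : σ.ph = 0) (hG : Good I β σ) {N : ℕ} (hN : I.sizeA ≤ N)
    (hN0 : 0 < N) : ∃ d < N, (stepInit I d σ).st = 0 ∧ Good I β (stepInit I d σ) := by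
  have hcap := hI.n_le
  obtain ⟨hin, hk⟩ := hG.init hph
  have hfix : σ.i < I.n → ∀ b x, σ.mark x = 1 → Function.update σ.val σ.i b x = β x := by
    intro hi b x hx
    rw [Function.update_apply, if_neg, hG.fixed x hx]
    rintro rfl
    have := h.start hph σ.i (by omega)
    omega
  have hcount : ∀ b, #{x ∈ range (σ.i + 1) | Function.update σ.val σ.i b x ≠ β x} =
      #{x ∈ range σ.i | σ.val x ≠ β x} + if b ≠ β σ.i then 1 else 0 := by
    intro b
    rw [range_add_one, filter_insert]
    have : {x ∈ range σ.i | Function.update σ.val σ.i b x ≠ β x} = {x ∈ range σ.i | σ.val x ≠ β x} := by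
      apply filter_congr
      intro x hx
      rw [mem_range] at hx
      rw [Function.update_apply, if_neg (by omega)]
    rw [Function.update_self, this]
    split_ifs
    · rw [card_insert_of_notMem (by simp)]
    · rfl
  by_cases hi : σ.i < I.n
  · have hmin : min (σ.i + 1) I.cap = σ.i + 1 := by omega
    by_cases hmod : σ.i % I.tA = 0
    · obtain ⟨d, hd, hcov⟩ := hI.coverA (fun q => β (σ.i + q)) fun q => hβ _
      refine ⟨d, by omega, ?_⟩
      simp only [stepInit, hi, hmod, hd, if_true]
      refine ⟨hst, ⟨hfix hi _, fun _ => ?_, by simp [hph], by simp [hph], by simp [hph], by simp [hph],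
        by simp [hph], by simp [hph]⟩⟩
      simp only [hmin]
      refine ⟨hi, ?_⟩
      have e := pending_succ_start hI.tA_pos hmod fun x q => I.bit (d * I.tA + q) ≠ β x
      rw [hcount, add_assoc]
      -- Cutting `k` off at `cap` does no harm, because at most `n + tA` errors have to be covered.
      have h1 : #{x ∈ range σ.i | σ.val x ≠ β x} ≤ σ.i := card_filter_range_le _ _
      have h2 : #{q ∈ range I.tA | I.bit (d * I.tA + q) ≠ β (σ.i + q)} ≤ I.tA :=
        card_filter_range_le _ _
      have h3 : (if I.bit (d * I.tA + 0) ≠ β σ.i then 1 else 0) +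
          pending I.tA (σ.i + 1) (fun x q => I.bit (d * I.tA + q) ≠ β x) =
          #{q ∈ range I.tA | I.bit (d * I.tA + q) ≠ β (σ.i + q)} := by
        convert e
      omega
    · refine ⟨0, hN0, ?_⟩
      simp only [stepInit, hi, hmod, if_true, if_false]
      refine ⟨hst, ⟨hfix hi _, fun _ => ?_, by simp [hph], by simp [hph], by simp [hph], by simp [hph],
        by simp [hph], by simp [hph]⟩⟩
      simp only [hmin]
      refine ⟨hi, ?_⟩
      have e := pending_succ_cont hI.tA_pos hmod fun x q => I.bit (σ.g * I.tA + q) ≠ β x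
      have e' : (if I.bit (σ.g * I.tA + σ.i % I.tA) ≠ β σ.i then 1 else 0) +
          pending I.tA (σ.i + 1) (fun x q => I.bit (σ.g * I.tA + q) ≠ β x) =
          pending I.tA σ.i (fun x q => I.bit (σ.g * I.tA + q) ≠ β x) := by
        convert e
      rw [hcount]
      omega
  · refine ⟨0, hN0, ?_⟩
    simp only [stepInit, hi, if_true, if_false]
    refine ⟨hst, ⟨hG.fixed, by simp, fun _ => ?_, by simp, by simp, by simp, by simp, by simp⟩⟩
    have hin' : σ.i = I.n := by omega
    rw [hin'] at hk
    refine le_trans ?_ (le_trans (Nat.le_add_right _ _) hk)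
    apply card_le_card
    intro x hx
    simp only [mem_filter] at hx ⊢
    exact ⟨hx.1, hx.2.2⟩

/-- The solution changes a free variable in each of the two clauses. If one of these variables
occurs in both clauses, it is guessed alone, with `a = b`; otherwise both are private and are
flipped together. -/
theorem good_stepPair {B : ℝ} (hI : I.Valid B) {β : ℕ → ℕ} (hβ : ∀ x, β x ≤ 1)
    (hsat : ∀ z < I.c, ¬ I.False β z) {σ : St} (h : Inv I σ) (hst : σ.st = 0) (hph : σ.ph = 1)
    (hG : Good I β σ) {N : ℕ} (hN : 9 ≤ N) :
    ∃ d < N, (stepPair I d σ).st = 0 ∧ Good I β (stepPair I d σ) := by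
  obtain ⟨hm0, hmark⟩ := h.early (by omega)
  have hk := hG.pair hph
  set w := first (fun w => I.Pair σ.val σ.mark (w / I.c) (w % I.c)) (min (I.c * I.c) I.cap) with hwdef
  by_cases hw : w < min (I.c * I.c) I.cap
  swap
  · refine ⟨0, by omega, ?_⟩
    simp only [stepPair, ← hwdef, hw, if_false, if_true]
    refine ⟨hst, ⟨hG.fixed, by simp, by simp, fun _ => ?_, fun _ o ho => ?_, by simp, by simp, by simp⟩⟩
    · rw [hm0]; exact hk
    · rw [hm0] at ho; omega
  obtain ⟨hyc, hzc⟩ := pair_lt hI hw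
  obtain ⟨hFy, hFz, -⟩ : I.Pair σ.val σ.mark (w / I.c) (w % I.c) := first_spec hw
  set y := w / I.c with hy
  set z := w % I.c with hz
  have hdiff : ∀ y < I.c, I.False σ.val y → ∃ q < 3, σ.val (I.v y q) ≠ β (I.v y q) ∧
      σ.mark (I.v y q) = 0 ∧ I.v y q < I.n := by
    intro y hy hF
    obtain ⟨q, hq, hne⟩ := exists_ne hF (hsat y hy)
    have h1 : σ.mark (I.v y q) ≠ 1 := fun h => hne (hG.fixed _ h)
    have := hmark (I.v y q)
    exact ⟨q, hq, hne, by omega, v_lt hI h hy hq h1⟩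
  have hone : ∀ p < 3, ∀ q < 3, I.v y p = I.v z q → σ.val (I.v y p) ≠ β (I.v y p) →
      σ.mark (I.v y p) = 0 → I.v y p < I.n →
      ∃ d < N, (stepPair I d σ).st = 0 ∧ Good I β (stepPair I d σ) := by
    intro p hp q hq he hne h0 hlt
    have hf := free_fix hlt h0 hne
    refine ⟨3 * p + q, by omega, ?_⟩
    have h9 : 3 * p + q < 9 := by omega
    have hk1 : 1 ≤ σ.k := by omega
    simp only [stepPair, ← hwdef, hw, if_true, ← hy, ← hz, show (3 * p + q) / 3 = p by omega,
      show (3 * p + q) % 3 = q by omega, h9, h0, ← he, hk1, and_self]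
    refine ⟨hst, ⟨good_fixed_fix hβ h.val_le hG.fixed hne, by simp [St.fix, hph], fun _ => ?_,
      by simp [St.fix, hph], by simp [St.fix, hph], by simp [St.fix, hph], by simp [St.fix, hph],
      by simp [St.fix, hph]⟩⟩
    change free I.n (σ.fix (I.v y p)) β ≤ σ.k - 1
    omega
  obtain ⟨p, hp, hne, h0, hlt⟩ := hdiff y hyc hFy
  obtain ⟨q, hq, hne', h0', hlt'⟩ := hdiff z hzc hFz
  by_cases c1 : I.Mem z (I.v y p)
  · obtain ⟨q', hq', he⟩ := Data.mem_iff.1 c1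
    exact hone p hp q' hq' he.symm hne h0 hlt
  by_cases c2 : I.Mem y (I.v z q)
  · obtain ⟨p', hp', he⟩ := Data.mem_iff.1 c2
    exact hone p' hp' q hq he (by rwa [he]) (by rwa [he]) (by rwa [he])
  have hxx : I.v y p ≠ I.v z q := fun he => c1 (he ▸ Data.v_mem hq)
  have hf := free_fix hlt h0 hne
  have h0'' : (σ.fix (I.v y p)).mark (I.v z q) = 0 := by rw [St.fix_mark, if_neg hxx.symm, h0']
  have hne'' : (σ.fix (I.v y p)).val (I.v z q) ≠ β (I.v z q) := by
    rwa [St.fix_val, if_neg hxx.symm]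
  have hf' := free_fix hlt' h0'' hne''
  refine ⟨3 * p + q, by omega, ?_⟩
  have h9 : 3 * p + q < 9 := by omega
  have hk2 : 2 ≤ σ.k := by omega
  simp only [stepPair, ← hwdef, hw, if_true, ← hy, ← hz, show (3 * p + q) / 3 = p by omega,
    show (3 * p + q) % 3 = q by omega, h9, h0, h0', hxx, c1, c2, hk2, if_false, and_self,
    not_false_eq_true]
  refine ⟨hst, ⟨good_fixed_fix hβ (St.fix_val_le h.val_le _)
    (good_fixed_fix hβ h.val_le hG.fixed hne) hne'', by simp [St.fix, hph], fun _ => ?_,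
    by simp [St.fix, hph], by simp [St.fix, hph], by simp [St.fix, hph], by simp [St.fix, hph],
    by simp [St.fix, hph]⟩⟩
  change free I.n ((σ.fix (I.v y p)).fix (I.v z q)) β ≤ σ.k - 2
  omega

/-- The clause is false under `val`, so the new member has `h ≥ 1` hits. These leave `free`, and `h
- 1` enters the sum over the members: the budget needed drops by one, just as `k` does. -/
theorem good_stepFamily {B : ℝ} (hI : I.Valid B) {β : ℕ → ℕ}
    (hsat : ∀ z < I.c, ¬ I.False β z) {σ : St} (h : Inv I σ) (hst : σ.st = 0) (hph : σ.ph = 2)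
    (hG : Good I β σ) {N : ℕ} (hN : 0 < N) :
    ∃ d < N, (stepFamily I d σ).st = 0 ∧ Good I β (stepFamily I d σ) := by
  have hcap := hI.n_le
  have hmle := h.m_le
  have hk := hG.family (.inl hph)
  refine ⟨0, hN, ?_⟩
  set z := first (I.Fresh σ.val σ.mark) I.c with hzdef
  by_cases h1 : z < I.c
  swap
  · simp only [stepFamily, ← hzdef, h1, if_false, if_true]
    refine ⟨hst, ⟨hG.fixed, by simp, by simp, fun _ => hk, fun _ o ho _ => ?_, ?_, ?_, by simp⟩⟩
    · exact hG.hit (by omega) o ho (by simp [hph])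
    · simp [pending_zero]
    · simp [pending_zero]
  obtain ⟨hF, hfr⟩ : I.Fresh σ.val σ.mark z := first_spec h1
  have hfr : ∀ q < 3, σ.mark (I.v z q) = 0 := by
    intro q hq
    interval_cases q
    exacts [hfr.1, hfr.2.1, hfr.2.2]
  have hlt : ∀ q < 3, I.v z q < I.n := fun q hq => v_lt hI h h1 hq (by rw [hfr q hq]; norm_num)
  have hinj : ∀ p < 3, ∀ p' < 3, I.v z p = I.v z p' → p = p' := fun p hp p' hp' he =>
    v_inj hI h.val_le h1 hF hp hp' (by have := hlt p hp; omega) he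
  set mk := Function.update (Function.update (Function.update σ.mark (I.v z 0) (σ.m + 2))
    (I.v z 1) (σ.m + 2)) (I.v z 2) (σ.m + 2) with hmk
  set tv := Function.update (Function.update (Function.update σ.tv (3 * σ.m) (I.v z 0))
    (3 * σ.m + 1) (I.v z 1)) (3 * σ.m + 2) (I.v z 2) with htv
  have hmk_in : ∀ q < 3, mk (I.v z q) = σ.m + 2 := by
    intro q hq
    simp only [hmk, Function.update_apply]
    interval_cases q <;> simp
  have hmk_out : ∀ y, (∀ q < 3, y ≠ I.v z q) → mk y = σ.mark y := by
    intro y hy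
    simp only [hmk, Function.update_apply, hy 0 (by norm_num), hy 1 (by norm_num),
      hy 2 (by norm_num), if_false]
  have htv_new : ∀ p < 3, tv (3 * σ.m + p) = I.v z p := by
    intro p hp
    simp only [htv, Function.update_apply]
    interval_cases p <;> simp
  have htv_old : ∀ o < σ.m, ∀ p < 3, tv (3 * o + p) = σ.tv (3 * o + p) := by
    intro o ho p hp
    simp only [htv, Function.update_apply]
    rw [if_neg (by omega), if_neg (by omega), if_neg (by omega)]
  have hfree := card_marked (f := σ.mark) (g := mk) (t := I.v z) (fun x => σ.val x ≠ β x) hlt hinj hfr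
    (fun p hp => by rw [hmk_in p hp]; omega) hmk_out
  obtain ⟨q, hq, hne⟩ := exists_ne hF (hsat z h1)
  have hpos : 1 ≤ #{p ∈ range 3 | σ.val (I.v z p) ≠ β (I.v z p)} :=
    card_pos.2 ⟨q, by simp [hq, hne]⟩
  have hk1 : 1 ≤ σ.k := by
    have : free I.n σ β ≤ σ.k := le_trans (Nat.le_add_right _ _) hk
    unfold free at this
    omega
  simp only [stepFamily, ← hzdef, h1, hk1, if_true, and_self,
    show min (σ.m + 1) I.cap = σ.m + 1 by omega, show min (σ.m + 2) I.cap = σ.m + 2 by omega]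
  simp only [← hmk, ← htv]
  have hhit_new : #{p ∈ range 3 | σ.val (tv (3 * σ.m + p)) ≠ β (tv (3 * σ.m + p))} =
      #{p ∈ range 3 | σ.val (I.v z p) ≠ β (I.v z p)} := by
    congr 1
    apply filter_congr
    intro p hp
    rw [htv_new p (mem_range.1 hp)]
  have hhit_old : ∀ o < σ.m, #{p ∈ range 3 | σ.val (tv (3 * o + p)) ≠ β (tv (3 * o + p))} =
      hits σ β o := by
    intro o ho
    unfold hits
    congr 1
    apply filter_congr
    intro p hp
    rw [htv_old o ho p (mem_range.1 hp)]
  refine ⟨hst, ⟨fun x hx => ?_, by simp [hph], by simp [hph], fun _ => ?_, fun _ o ho _ => ?_,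
    by simp [hph], by simp [hph], by simp [hph]⟩⟩
  · change mk x = 1 at hx
    by_cases hxq : ∃ q < 3, x = I.v z q
    · obtain ⟨q, hq, rfl⟩ := hxq
      rw [hmk_in q hq] at hx; omega
    · push Not at hxq
      rw [hmk_out x hxq] at hx
      exact hG.fixed x hx
  · simp only [free, hits] at hk ⊢
    rw [sum_range_succ, hhit_new]
    rw [sum_congr rfl fun o ho => by rw [hhit_old o (mem_range.1 ho)]]
    simp only [hits]
    omega
  · simp only [hits]
    rcases Nat.lt_succ_iff_lt_or_eq.1 ho with ho | rfl
    · rw [hhit_old o ho]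
      exact hG.hit (by omega) o ho (by simp [hph])
    · rw [hhit_new]; exact hpos

theorem hits_pos_iff {σ : St} {β : ℕ → ℕ} {o : ℕ} : 1 ≤ hits σ β o ↔
    ∃ p < 3, σ.val (σ.tv (3 * o + p)) ≠ β (σ.tv (3 * o + p)) := by
  rw [hits, Nat.succ_le_iff, card_pos]
  constructor
  · rintro ⟨p, hp⟩
    rw [mem_filter, mem_range] at hp
    exact ⟨p, hp⟩
  · rintro ⟨p, hp⟩
    exact ⟨p, by rw [mem_filter, mem_range]; exact hp⟩

theorem miss_le_one (σ : St) (β : ℕ → ℕ) (o : ℕ) : miss σ β o ≤ 1 := by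
  unfold miss; split_ifs <;> norm_num

theorem multi_le_one (σ : St) (β : ℕ → ℕ) (o : ℕ) : multi σ β o ≤ 1 := by
  unfold multi; split_ifs <;> norm_num

-- The code is applied to the sets of variables that `β` asks to flip, nonempty by `hit`; imaginary
-- members fill up the last block. Its two error counts are those of `miss` and `multi`, and each
-- total is at most `n + tC`, so cutting off at `cap` does no harm.
open Classical in
theorem good_stepCode {B : ℝ} (hI : I.Valid B) {β : ℕ → ℕ} {σ : St} (h : Inv I σ) (hst : σ.st = 0)
    (hph : σ.ph = 3) (hG : Good I β σ) {N : ℕ} (hN : I.sizeC ≤ N) (hN0 : 0 < N) :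
    ∃ d < N, (stepCode I d σ).st = 0 ∧ Good I β (stepCode I d σ) := by
  have hcap := hI.n_le
  have hmle := h.m_le
  have hk := hG.family (.inr hph)
  have hS := hG.codeS hph
  have hJ := hG.codeJ hph
  have hhit : ∀ o < σ.m, 1 ≤ hits σ β o := fun o ho => hG.hit (by omega) o ho (by simp [hph])
  by_cases hi : σ.i < σ.m
  · have hmin : min (σ.i + 1) I.cap = σ.i + 1 := by omega
    -- the sums after the entry `r` has been written
    have hsumS : ∀ r, ∑ o ∈ range (σ.i + 1),
        (if σ.val (σ.tv (3 * o + Function.update σ.rp σ.i r o)) =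
          β (σ.tv (3 * o + Function.update σ.rp σ.i r o)) then 1 else 0) =
        ∑ o ∈ range σ.i, miss σ β o + if ¬ Asks σ β σ.i r then 1 else 0 := by
      intro r
      rw [sum_range_succ]
      congr 1
      · apply sum_congr rfl
        intro o ho
        rw [mem_range] at ho
        rw [Function.update_of_ne (by omega), miss]
      · simp only [Function.update_self, Asks, hi, if_true, ne_eq, not_not]
    have hsumJ : ∀ r, ∑ o ∈ range (σ.i + 1),
        (if σ.val (σ.tv (3 * o + Function.update σ.rp σ.i r o)) ≠
          β (σ.tv (3 * o + Function.update σ.rp σ.i r o)) ∧ 2 ≤ hits σ β o then 1 else 0) =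
        ∑ o ∈ range σ.i, multi σ β o +
          if Asks σ β σ.i r ∧ 2 ≤ #{p ∈ range 3 | Asks σ β σ.i p} then 1 else 0 := by
      intro r
      rw [sum_range_succ]
      congr 1
      · apply sum_congr rfl
        intro o ho
        rw [mem_range] at ho
        rw [Function.update_of_ne (by omega), multi]
      · have e : hits σ β σ.i = #{p ∈ range 3 | Asks σ β σ.i p} := by
          unfold hits
          congr 1
          ext p
          simp only [mem_filter, Asks, hi, if_true]
        rw [e]
        simp only [Function.update_self, Asks, hi, if_true]
    by_cases hmod : σ.i % I.tC = 0
    · obtain ⟨d, hd, hcS, hcJ⟩ := hI.coverC (fun q p => Asks σ β (σ.i + q) p) (by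
        intro q
        by_cases hq : σ.i + q < σ.m
        · obtain ⟨p, hp, hne⟩ := hits_pos_iff.1 (hhit _ hq)
          exact ⟨p, hp, by rw [Asks, if_pos hq]; exact hne⟩
        · exact ⟨0, by norm_num, by rw [Asks, if_neg hq]⟩)
      refine ⟨d, by omega, ?_⟩
      simp only [stepCode, hi, hmod, hd, if_true]
      refine ⟨hst, ⟨hG.fixed, by simp [hph], by simp [hph], fun _ => hk,
        fun _ o ho _ => hhit o ho, fun _ => ?_, fun _ => ?_, by simp [hph]⟩⟩
      · have e : (if ¬ Asks σ β σ.i (I.pos (d * I.tC + 0)) then 1 else 0) +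
            pending I.tC (σ.i + 1) (fun o q => ¬ Asks σ β o (I.pos (d * I.tC + q))) =
            #{q ∈ range I.tC | ¬ Asks σ β (σ.i + q) (I.pos (d * I.tC + q))} := by
          convert pending_succ_start hI.tC_pos hmod fun o q => ¬ Asks σ β o (I.pos (d * I.tC + q))
        have hcS' : #{q ∈ range I.tC | ¬ Asks σ β (σ.i + q) (I.pos (d * I.tC + q))} ≤ I.sw d := by
          convert hcS
        have e2 := hsumS (I.pos (d * I.tC + 0))
        have h1 : ∑ o ∈ range σ.i, miss σ β o ≤ σ.i := by
          simpa using sum_le_card_nsmul (range σ.i) _ 1 fun o _ => miss_le_one σ β o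
        have h2 : #{q ∈ range I.tC | ¬ Asks σ β (σ.i + q) (I.pos (d * I.tC + q))} ≤ I.tC :=
          card_filter_range_le _ _
        have e3 : ∑ o ∈ range (σ.i + 1),
            (if σ.val (σ.tv (3 * o + Function.update σ.rp σ.i (I.pos (d * I.tC + 0)) o)) =
            β (σ.tv (3 * o + Function.update σ.rp σ.i (I.pos (d * I.tC + 0)) o)) then 1 else 0) +
            pending I.tC (σ.i + 1) (fun o q => ¬ Asks σ β o (I.pos (d * I.tC + q))) ≤
            min (σ.s + I.sw d) I.cap := by
          omega
        simp only [hmin]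
        exact e3
      · have e : (if Asks σ β σ.i (I.pos (d * I.tC + 0)) ∧ 2 ≤ #{p ∈ range 3 | Asks σ β σ.i p}
              then 1 else 0) +
            pending I.tC (σ.i + 1) (fun o q => Asks σ β o (I.pos (d * I.tC + q)) ∧
              2 ≤ #{p ∈ range 3 | Asks σ β o p}) =
            #{q ∈ range I.tC | Asks σ β (σ.i + q) (I.pos (d * I.tC + q)) ∧
              2 ≤ #{p ∈ range 3 | Asks σ β (σ.i + q) p}} := by
          convert pending_succ_start hI.tC_pos hmod fun o q => Asks σ β o (I.pos (d * I.tC + q)) ∧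
            2 ≤ #{p ∈ range 3 | Asks σ β o p}
        have hcJ' : #{q ∈ range I.tC | Asks σ β (σ.i + q) (I.pos (d * I.tC + q)) ∧
            2 ≤ #{p ∈ range 3 | Asks σ β (σ.i + q) p}} ≤ I.ex d := by
          convert hcJ
        have e2 := hsumJ (I.pos (d * I.tC + 0))
        have h1 : ∑ o ∈ range σ.i, multi σ β o ≤ σ.i := by
          simpa using sum_le_card_nsmul (range σ.i) _ 1 fun o _ => multi_le_one σ β o
        have h2 : #{q ∈ range I.tC | Asks σ β (σ.i + q) (I.pos (d * I.tC + q)) ∧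
            2 ≤ #{p ∈ range 3 | Asks σ β (σ.i + q) p}} ≤ I.tC :=
          card_filter_range_le _ _
        have e3 : ∑ o ∈ range (σ.i + 1),
            (if σ.val (σ.tv (3 * o + Function.update σ.rp σ.i (I.pos (d * I.tC + 0)) o)) ≠
            β (σ.tv (3 * o + Function.update σ.rp σ.i (I.pos (d * I.tC + 0)) o)) ∧
            2 ≤ hits σ β o then 1 else 0) +
            pending I.tC (σ.i + 1) (fun o q => Asks σ β o (I.pos (d * I.tC + q)) ∧
              2 ≤ #{p ∈ range 3 | Asks σ β o p}) ≤
            min (σ.j + I.ex d) I.cap := by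
          omega
        simp only [hmin]
        exact e3
    · refine ⟨0, hN0, ?_⟩
      simp only [stepCode, hi, hmod, if_true, if_false]
      refine ⟨hst, ⟨hG.fixed, by simp [hph], by simp [hph], fun _ => hk,
        fun _ o ho _ => hhit o ho, fun _ => ?_, fun _ => ?_, by simp [hph]⟩⟩
      · have e : (if ¬ Asks σ β σ.i (I.pos (σ.g * I.tC + σ.i % I.tC)) then 1 else 0) +
            pending I.tC (σ.i + 1) (fun o q => ¬ Asks σ β o (I.pos (σ.g * I.tC + q))) =
            pending I.tC σ.i (fun o q => ¬ Asks σ β o (I.pos (σ.g * I.tC + q))) := by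
          convert pending_succ_cont hI.tC_pos hmod fun o q => ¬ Asks σ β o (I.pos (σ.g * I.tC + q))
        have e2 := hsumS (I.pos (σ.g * I.tC + σ.i % I.tC))
        have e3 : ∑ o ∈ range (σ.i + 1),
            (if σ.val (σ.tv (3 * o + Function.update σ.rp σ.i (I.pos (σ.g * I.tC + σ.i % I.tC)) o)) =
            β (σ.tv (3 * o + Function.update σ.rp σ.i (I.pos (σ.g * I.tC + σ.i % I.tC)) o))
              then 1 else 0) +
            pending I.tC (σ.i + 1) (fun o q => ¬ Asks σ β o (I.pos (σ.g * I.tC + q))) ≤ σ.s := by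
          omega
        simp only [hmin]
        exact e3
      · have e : (if Asks σ β σ.i (I.pos (σ.g * I.tC + σ.i % I.tC)) ∧
              2 ≤ #{p ∈ range 3 | Asks σ β σ.i p} then 1 else 0) +
            pending I.tC (σ.i + 1) (fun o q => Asks σ β o (I.pos (σ.g * I.tC + q)) ∧
              2 ≤ #{p ∈ range 3 | Asks σ β o p}) =
            pending I.tC σ.i (fun o q => Asks σ β o (I.pos (σ.g * I.tC + q)) ∧
              2 ≤ #{p ∈ range 3 | Asks σ β o p}) := by
          convert pending_succ_cont hI.tC_pos hmod fun o q =>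
            Asks σ β o (I.pos (σ.g * I.tC + q)) ∧ 2 ≤ #{p ∈ range 3 | Asks σ β o p}
        have e2 := hsumJ (I.pos (σ.g * I.tC + σ.i % I.tC))
        have e3 : ∑ o ∈ range (σ.i + 1),
            (if σ.val (σ.tv (3 * o + Function.update σ.rp σ.i (I.pos (σ.g * I.tC + σ.i % I.tC)) o)) ≠
            β (σ.tv (3 * o + Function.update σ.rp σ.i (I.pos (σ.g * I.tC + σ.i % I.tC)) o)) ∧
            2 ≤ hits σ β o then 1 else 0) +
            pending I.tC (σ.i + 1) (fun o q => Asks σ β o (I.pos (σ.g * I.tC + q)) ∧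
              2 ≤ #{p ∈ range 3 | Asks σ β o p}) ≤ σ.j := by
          omega
        simp only [hmin]
        exact e3
  · refine ⟨0, hN0, ?_⟩
    simp only [stepCode, hi, if_true, if_false]
    have him : σ.i = σ.m := by have := (h.code hph).1; omega
    refine ⟨hst, ⟨hG.fixed, by simp, by simp, by simp, fun _ o ho _ => hhit o ho, by simp, by simp,
      fun _ => ⟨?_, ?_, ?_⟩⟩⟩
    · refine le_trans (Nat.add_le_add_left ?_ _) hk
      exact sum_le_sum_of_subset (filter_subset _ _)
    · rw [him] at hS
      exact (sum_le_sum_of_subset (filter_subset _ _)).trans ((Nat.le_add_right _ _).trans hS)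
    · rw [him] at hJ
      exact (sum_le_sum_of_subset (filter_subset _ _)).trans ((Nat.le_add_right _ _).trans hJ)

/-- A state in which the variables of the member `o` have the values they have in `σ`. -/
def Same (σ ρ : St) (o : ℕ) : Prop :=
  ρ.rp o = σ.rp o ∧ ∀ p < 3, ρ.tv (3 * o + p) = σ.tv (3 * o + p) ∧
    ρ.val (σ.tv (3 * o + p)) = σ.val (σ.tv (3 * o + p))

theorem Same.hits {σ ρ : St} {o : ℕ} (h : Same σ ρ o) (β : ℕ → ℕ) : hits ρ β o = hits σ β o := by
  unfold Search.hits
  congr 1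
  apply filter_congr
  intro p hp
  obtain ⟨h1, h2⟩ := h.2 p (mem_range.1 hp)
  rw [h1, h2]

theorem Same.miss {σ ρ : St} {o : ℕ} (h : Same σ ρ o) (hr : σ.rp o < 3) (β : ℕ → ℕ) :
    miss ρ β o = miss σ β o := by
  obtain ⟨h1, h2⟩ := h.2 _ hr
  unfold Search.miss
  rw [h.1, h1, h2]

theorem Same.multi {σ ρ : St} {o : ℕ} (h : Same σ ρ o) (hr : σ.rp o < 3) (β : ℕ → ℕ) :
    multi ρ β o = multi σ β o := by
  obtain ⟨h1, h2⟩ := h.2 _ hr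
  unfold Search.multi
  rw [h.1, h1, h2, h.hits]

theorem sum_active {σ ρ : St} {o : ℕ} (ho : o < σ.m) (hr : σ.rp o < 3) (hm : ρ.m = σ.m)
    (hrp : ρ.rp = Function.update σ.rp o 3) {f g : ℕ → ℕ}
    (hfg : ∀ o' < σ.m, o' ≠ o → σ.rp o' < 3 → g o' = f o') :
    ∑ o ∈ range ρ.m with ρ.rp o < 3, g o + f o = ∑ o ∈ range σ.m with σ.rp o < 3, f o := by
  have e : {o' ∈ range ρ.m | ρ.rp o' < 3} = ({o' ∈ range σ.m | σ.rp o' < 3}).erase o := by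
    ext y
    simp only [mem_filter, mem_erase, hm, hrp, Function.update_apply]
    by_cases hy : y = o <;> simp [hy]
  rw [e, ← sum_erase_add _ _ (show o ∈ {o' ∈ range σ.m | σ.rp o' < 3} by simp [ho, hr])]
  congr 1
  apply sum_congr rfl
  intro y hy
  simp only [mem_erase, mem_filter, mem_range] at hy
  exact hfg y hy.2.1 hy.1 hy.2.2

theorem free_release {σ : St} (h : Inv I σ) (hph : σ.ph = 4) {o : ℕ} (ho : o < σ.m)
    (hr : σ.rp o < 3) (β : ℕ → ℕ) : free I.n (σ.release o) β = free I.n σ β + hits σ β o := by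
  have h2 : 2 ≤ σ.ph := by omega
  have htri := h.tri h2 o ho fun _ => hr
  refine card_marked (fun x => σ.val x ≠ β x) (t := fun p => σ.tv (3 * o + p))
    (fun p hp => (htri p hp).1) (h.inj h2 o ho fun _ => hr) ?_
    (fun p hp => by rw [(htri p hp).2]; omega) ?_
  · intro p hp
    rw [St.release_mark, if_pos ⟨p, hp, rfl⟩]
  · intro x hx
    rw [St.release_mark, if_neg]
    rintro ⟨p, hp, he⟩
    exact hx p hp he

/-- Some variable `x` of the false clause has a current value different from that in `β`, so it is
not frozen. If it is free, it is flipped. If it is the flipped variable of its member, the member is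
a miss, and another of its variables is a hit to switch to. Otherwise `x` is a hit: either the
flipped variable `w` is wrong, and `x` replaces it, or both are hits, and the member counts in
`multi`. Releasing the member turns its hits into free ones, and the permanent flips compensate for
this. -/
theorem good_stepSearch {B : ℝ} (hI : I.Valid B) {β : ℕ → ℕ} (hβ : ∀ x, β x ≤ 1)
    (hsat : ∀ z < I.c, ¬ I.False β z) {σ : St} (h : Inv I σ) (hst : σ.st = 0) (hph : σ.ph = 4)
    (hG : Good I β σ) {N : ℕ} (hN : 9 ≤ N) :
    ∃ d < N, (stepSearch I d σ).st = 2 ∨ (stepSearch I d σ).st = 0 ∧ Good I β (stepSearch I d σ) := by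
  have h2 : 2 ≤ σ.ph := by omega
  obtain ⟨hk, hs, hj⟩ := hG.search hph
  set z := first (I.False σ.cur) I.c with hz
  by_cases hzc : z < I.c
  swap
  · exact ⟨0, by omega, .inl (by simp [stepSearch, ← hz, hzc])⟩
  obtain ⟨q, hq, hne⟩ := exists_ne (first_spec hzc) (hsat z hzc)
  rw [← hz] at hne
  set x := I.v z q with hx
  have hd : ∀ e < 2, 2 * q + e < N ∧ 2 * q + e < 6 ∧ (2 * q + e) / 2 = q ∧ (2 * q + e) % 2 = e := by
    intro e he; omega
  by_cases hm0 : σ.mark x = 0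
  · have hc : σ.cur x = σ.val x := by rw [St.cur, if_neg (by omega)]
    rw [hc] at hne
    have hxn : x < I.n := v_lt hI h hzc hq (by rw [← hx, hm0]; norm_num)
    have hf := free_fix hxn hm0 hne
    obtain ⟨d1, d2, d3, d4⟩ := hd 0 (by norm_num)
    refine ⟨2 * q + 0, d1, .inr ?_⟩
    have hk1 : 1 ≤ σ.k := by omega
    simp only [stepSearch, ← hz, hzc, d2, d3, d4, ← hx, hm0, hk1, if_true, and_self]
    have hsame : ∀ o < σ.m, σ.rp o < 3 →
        Same σ { σ.fix x with k := σ.k - 1 } o := fun o ho hr => ⟨rfl, fun p hp => ⟨rfl, by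
      change (σ.fix x).val _ = _
      rw [St.fix_val, if_neg]
      intro he
      have := (h.tri h2 o ho (fun _ => hr) p hp).2
      rw [he] at this
      omega⟩⟩
    refine ⟨hst, ⟨good_fixed_fix hβ h.val_le hG.fixed hne, by simp [St.fix, hph],
      by simp [St.fix, hph], by simp [St.fix, hph], fun _ o ho hr => ?_, by simp [St.fix, hph],
      by simp [St.fix, hph], fun _ => ⟨?_, ?_, ?_⟩⟩⟩
    · rw [(hsame o ho (hr hph)).hits]
      exact hG.hit h2 o ho hr
    · have e : ∑ o ∈ range σ.m with σ.rp o < 3, (hits { σ.fix x with k := σ.k - 1 } β o - 1) =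
          ∑ o ∈ range σ.m with σ.rp o < 3, (hits σ β o - 1) := sum_congr rfl fun o ho => by
        rw [(hsame o (mem_range.1 (mem_filter.1 ho).1) (mem_filter.1 ho).2).hits]
      change free I.n (σ.fix x) β + ∑ o ∈ range σ.m with σ.rp o < 3,
        (hits { σ.fix x with k := σ.k - 1 } β o - 1) ≤ σ.k - 1
      omega
    · exact (sum_congr rfl fun o ho => (hsame o (mem_range.1 (mem_filter.1 ho).1)
        (mem_filter.1 ho).2).miss (mem_filter.1 ho).2 β).trans_le hs
    · exact (sum_congr rfl fun o ho => (hsame o (mem_range.1 (mem_filter.1 ho).1)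
        (mem_filter.1 ho).2).multi (mem_filter.1 ho).2 β).trans_le hj
  have hm1 : σ.mark x ≠ 1 := by
    intro h1
    apply hne
    rw [St.cur, if_neg (by omega), hG.fixed x h1]
  set o := σ.mark x - 2 with ho
  obtain ⟨om, ⟨p, hp, hpx⟩, hr⟩ := h.owned h2 x (by omega)
  rw [← ho] at om hpx hr
  replace hr := hr hph
  set w := σ.tv (3 * o + σ.rp o) with hw
  have hhit := hG.hit h2 o om fun _ => hr
  have hfree := free_release h hph om hr β
  have htri := h.tri h2 o om fun _ => hr
  have hinj := h.inj h2 o om fun _ => hr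
  have hval : ∀ p < 3, (σ.release o).mark (σ.tv (3 * o + p)) = 0 := by
    intro p hp; rw [St.release_mark, if_pos ⟨p, hp, rfl⟩]
  have hfixed : ∀ y, (σ.release o).mark y = 1 → (σ.release o).val y = β y := by
    intro y hy
    rw [St.release_mark] at hy
    split_ifs at hy
    exact hG.fixed y hy
  -- states that arise by changing values of variables of the member `o` only
  have key : ∀ ρ : St, ρ.ph = σ.ph → ρ.m = σ.m → ρ.tv = σ.tv → ρ.rp = Function.update σ.rp o 3 →
      (∀ y, (∀ p < 3, y ≠ σ.tv (3 * o + p)) → ρ.val y = σ.val y) →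
      (∀ x, ρ.mark x = 1 → ρ.val x = β x) →
      free I.n ρ β + (σ.k - ρ.k) + 1 ≤ free I.n σ β + hits σ β o → ρ.k ≤ σ.k →
      σ.s ≤ ρ.s + miss σ β o → σ.j ≤ ρ.j + multi σ β o →
      Good I β ρ := by
    intro ρ e1 e2 e3 e4 e5 e6 e7 e8 e9 e10
    have hsame : ∀ o' < σ.m, o' ≠ o → σ.rp o' < 3 → Same σ ρ o' := by
      intro o' h1 h2' h3
      refine ⟨by rw [e4, Function.update_of_ne h2'], fun p hp => ⟨by rw [e3], e5 _ ?_⟩⟩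
      intro p' hp' he
      have t1 := (h.tri h2 o' h1 (fun _ => h3) p hp).2
      have t2 := (htri p' hp').2
      rw [he, t2] at t1
      omega
    have s1 := sum_active om hr e2 e4 (f := fun o => hits σ β o - 1) (g := fun o => hits ρ β o - 1)
      fun o' a b c => by simp only [(hsame o' a b c).hits]
    have s2 := sum_active om hr e2 e4 (f := miss σ β) (g := miss ρ β)
      fun o' a b c => (hsame o' a b c).miss c β
    have s3 := sum_active om hr e2 e4 (f := multi σ β) (g := multi ρ β)
      fun o' a b c => (hsame o' a b c).multi c β
    refine ⟨e6, by omega, by omega, by omega, fun _ o' ho' hr' => ?_, by omega, by omega,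
      fun _ => ⟨?_, ?_, ?_⟩⟩
    · have h3 := hr' (by omega)
      rw [e4] at h3
      have hne : o' ≠ o := by
        rintro rfl
        rw [Function.update_self] at h3; omega
      rw [Function.update_of_ne hne] at h3
      rw [(hsame o' (by omega) hne h3).hits]
      exact hG.hit h2 o' (by omega) fun _ => h3
    · omega
    · omega
    · omega
  by_cases hwx : w = x
  · have hc : σ.cur x = 1 - σ.val x := by
      rw [St.cur, if_pos ⟨by omega, hwx⟩]
    rw [hc] at hne
    have hvx : σ.val x = β x := by
      have := hβ x
      have := h.val_le x
      omega
    have hmiss : miss σ β o = 1 := by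
      rw [miss, if_pos]
      rw [← hw, hwx, hvx]
    have hs1 : 1 ≤ σ.s := by
      refine le_trans ?_ hs
      rw [← hmiss]
      exact single_le_sum (f := miss σ β) (fun _ _ => Nat.zero_le _) (by simp [om, hr])
    obtain ⟨p', hp', hne'⟩ := hits_pos_iff.1 hhit
    have hpr : p' ≠ σ.rp o := by
      rintro rfl
      rw [← hw, hwx] at hne'
      exact hne' hvx
    obtain ⟨e, he, hpe⟩ : ∃ e < 2, (σ.rp o + 1 + e) % 3 = p' := by
      by_cases h : (σ.rp o + 1) % 3 = p'
      · exact ⟨0, by norm_num, h⟩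
      · exact ⟨1, by norm_num, by omega⟩
    obtain ⟨d1, d2, d3, d4⟩ := hd e he
    refine ⟨2 * q + e, d1, .inr ?_⟩
    simp only [stepSearch, ← hz, hzc, d2, d3, d4, ← hx, hm0, hm1, if_true, if_false, ← ho, ← hw, hwx,
      hs1, hpe]
    have hf := free_fix (σ := σ.release o) (htri p' hp').1 (hval p' hp') hne'
    refine ⟨hst, key _ rfl rfl rfl rfl ?_ ?_ ?_ le_rfl ?_ (Nat.le_add_right _ _)⟩
    · intro y hy
      change ((σ.release o).fix _).val y = _
      rw [St.fix_val, if_neg (hy p' hp')]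
      rfl
    · exact good_fixed_fix (σ := σ.release o) hβ h.val_le hfixed hne'
    · change free I.n ((σ.release o).fix _) β + (σ.k - σ.k) + 1 ≤ _
      omega
    · change σ.s ≤ σ.s - 1 + _
      omega
  have hc : σ.cur x = σ.val x := by
    rw [St.cur, if_neg (fun hh => hwx hh.2)]
  rw [hc] at hne
  have hxp : ∀ y, (∀ p < 3, y ≠ σ.tv (3 * o + p)) → y ≠ x := fun y hy => hpx ▸ hy p hp
  have hxn : x < I.n := hpx ▸ (htri p hp).1
  have hx0 : (σ.release o).mark x = 0 := hpx ▸ hval p hp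
  have hf := free_fix (σ := σ.release o) hxn hx0 hne
  by_cases hmw : σ.val w = β w
  · have hmiss : miss σ β o = 1 := by
      rw [miss, if_pos (by rw [← hw]; exact hmw)]
    have hs1 : 1 ≤ σ.s := by
      refine le_trans ?_ hs
      rw [← hmiss]
      exact single_le_sum (f := miss σ β) (fun _ _ => Nat.zero_le _) (by simp [om, hr])
    obtain ⟨d1, d2, d3, d4⟩ := hd 0 (by norm_num)
    refine ⟨2 * q + 0, d1, .inr ?_⟩
    simp only [stepSearch, ← hz, hzc, d2, d3, d4, ← hx, hm0, hm1, if_true, if_false, ← ho, ← hw, hwx,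
      hs1]
    refine ⟨hst, key _ rfl rfl rfl rfl ?_ ?_ ?_ le_rfl ?_ (Nat.le_add_right _ _)⟩
    · intro y hy
      change ((σ.release o).fix _).val y = _
      rw [St.fix_val, if_neg (hxp y hy)]
      rfl
    · exact good_fixed_fix (σ := σ.release o) hβ h.val_le hfixed hne
    · change free I.n ((σ.release o).fix _) β + (σ.k - σ.k) + 1 ≤ _
      omega
    · change σ.s ≤ σ.s - 1 + _
      omega
  · have hpr : p ≠ σ.rp o := by
      rintro rfl
      exact hwx (hw.trans hpx)
    have h2h : 2 ≤ hits σ β o := by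
      unfold hits
      rw [← card_pair hpr]
      apply card_le_card
      intro y hy
      rw [mem_insert, mem_singleton] at hy
      rw [mem_filter, mem_range]
      rcases hy with rfl | rfl
      · exact ⟨hp, by rw [hpx]; exact hne⟩
      · exact ⟨hr, hmw⟩
    have hmulti : multi σ β o = 1 := by
      rw [multi, if_pos ⟨hmw, h2h⟩]
    have hj1 : 1 ≤ σ.j := by
      refine le_trans ?_ hj
      rw [← hmulti]
      exact single_le_sum (f := multi σ β) (fun _ _ => Nat.zero_le _) (by simp [om, hr])
    have hk1 : 1 ≤ σ.k := by
      have : hits σ β o - 1 ≤ ∑ o ∈ range σ.m with σ.rp o < 3, (hits σ β o - 1) :=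
        single_le_sum (f := fun o => hits σ β o - 1) (fun _ _ => Nat.zero_le _) (by simp [om, hr])
      omega
    obtain ⟨d1, d2, d3, d4⟩ := hd 1 (by norm_num)
    refine ⟨2 * q + 1, d1, .inr ?_⟩
    simp only [stepSearch, ← hz, hzc, d2, d3, d4, ← hx, hm0, hm1, if_true, if_false, ← ho, ← hw, hwx,
      hj1, hk1, one_ne_zero, and_self]
    have hw0 : ((σ.release o).fix x).mark w = 0 := by
      rw [St.fix_mark, if_neg hwx]; exact hval _ hr
    have hwne : ((σ.release o).fix x).val w ≠ β w := by
      rw [St.fix_val, if_neg hwx]; exact hmw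
    have hf' := free_fix (x := w) (htri _ hr).1 hw0 hwne
    refine ⟨hst, key _ rfl rfl rfl rfl ?_ ?_ ?_ (Nat.sub_le _ _) (Nat.le_add_right _ _) ?_⟩
    · intro y hy
      change (((σ.release o).fix _).fix w).val y = _
      rw [St.fix_val, if_neg (hy _ hr), St.fix_val, if_neg (hxp y hy)]
      rfl
    · exact good_fixed_fix hβ (St.fix_val_le (σ := σ.release o) h.val_le _) (good_fixed_fix (σ := σ.release o) hβ h.val_le hfixed hne) hwne
    · change free I.n (((σ.release o).fix _).fix w) β + (σ.k - (σ.k - 1)) + 1 ≤ _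
      omega
    · change σ.j ≤ σ.j - 1 + _
      omega

/-- A satisfying assignment that the state leads to is reached by some choice. -/
theorem good_step {B : ℝ} (hI : I.Valid B) {β : ℕ → ℕ} (hβ : ∀ x, β x ≤ 1)
    (hsat : ∀ z < I.c, ¬ I.False β z) {σ : St} (h : Inv I σ) (hst : σ.st = 0) (hG : Good I β σ)
    {N : ℕ} (hN : 9 ≤ N) (hA : I.sizeA ≤ N) (hC : I.sizeC ≤ N) :
    ∃ d < N, (step I d σ).st = 2 ∨ (step I d σ).st = 0 ∧ Good I β (step I d σ) := by
  have hph := h.ph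
  unfold step
  split_ifs with h0 h1 h2 h3
  · obtain ⟨d, hd, hh⟩ := good_stepInit hI hβ h hst h0 hG hA (by omega)
    exact ⟨d, hd, .inr hh⟩
  · obtain ⟨d, hd, hh⟩ := good_stepPair hI hβ hsat h hst h1 hG hN
    exact ⟨d, hd, .inr hh⟩
  · obtain ⟨d, hd, hh⟩ := good_stepFamily (N := N) hI hsat h hst h2 hG (by omega)
    exact ⟨d, hd, .inr hh⟩
  · obtain ⟨d, hd, hh⟩ := good_stepCode hI h hst h3 hG hC (by omega)
    exact ⟨d, hd, .inr hh⟩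
  · have h4 : σ.ph = 4 := by omega
    exact good_stepSearch hI hβ hsat h hst h4 hG hN

end Search


/-! ### Covering codes -/

open Finset Filter Topology

/-- The greedy algorithm for weighted set cover, compared with a fractional cover `μ` of cost at most
`M`. -/
theorem exists_cover {ι U : Type*} [Fintype ι] [DecidableEq ι] [DecidableEq U] (covers : ι → U → Prop)
    [∀ i u, Decidable (covers i u)] (cost μ : ι → ℝ) (hcost : ∀ i, 0 < cost i) (hμ : ∀ i, 0 < μ i)
    {M : ℝ} (hM : ∑ i, μ i * cost i ≤ M) (V : Finset U)
    (hV : ∀ u ∈ V, 1 ≤ ∑ i with covers i u, μ i) :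
    ∃ T : Finset ι, (∀ u ∈ V, ∃ i ∈ T, covers i u) ∧ ∑ i ∈ T, cost i ≤ M * harmonic #V := by
  have hM0 : 0 ≤ M := le_trans (sum_nonneg fun i _ => (mul_pos (hμ i) (hcost i)).le) hM
  induction h : #V using Nat.strong_induction_on generalizing V with
  | _ n ih =>
  rcases V.eq_empty_or_nonempty with rfl | hne
  · subst h
    exact ⟨∅, by simp, by simp⟩
  have hn : 0 < n := h ▸ hne.card_pos
  have hn' : (0 : ℝ) < n := by exact_mod_cast hn
  -- a cheap item
  obtain ⟨i, hi⟩ : ∃ i, cost i * n ≤ M * #{u ∈ V | covers i u} := by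
    -- Otherwise every item costs more than `M / n` per newly covered element. Averaged with the
    -- weights `μ`, which cover each of the `n` elements at least once, this makes the fractional
    -- cover cost more than `M`.
    by_contra! hcon
    obtain ⟨u, hu⟩ := hne
    have hι : (univ : Finset ι).Nonempty := by
      by_contra hempty
      rw [not_nonempty_iff_eq_empty] at hempty
      have := hV u hu
      rw [hempty] at this
      norm_num at this
    have h1 : M * ∑ i, μ i * #{u ∈ V | covers i u} < (∑ i, μ i * cost i) * n := by
      rw [mul_sum, sum_mul]
      apply sum_lt_sum_of_nonempty hι
      intro i _
      have := mul_lt_mul_of_pos_left (hcon i) (hμ i)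
      linarith
    have h2 : (n : ℝ) ≤ ∑ i, μ i * #{u ∈ V | covers i u} := by
      calc (n : ℝ) = ∑ u ∈ V, (1 : ℝ) := by simp [h]
        _ ≤ ∑ u ∈ V, ∑ i with covers i u, μ i := sum_le_sum hV
        _ = ∑ u ∈ V, ∑ i, if covers i u then μ i else 0 := by simp_rw [sum_filter]
        _ = ∑ i, ∑ u ∈ V, if covers i u then μ i else 0 := sum_comm
        _ = _ := by
          refine sum_congr rfl fun i _ => ?_
          rw [← sum_filter, sum_const, nsmul_eq_mul, mul_comm]
    have h3 := mul_le_mul_of_nonneg_left h2 hM0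
    have h4 := mul_le_mul_of_nonneg_right hM hn'.le
    linarith
  set c := #{u ∈ V | covers i u} with hc
  have hc0 : 0 < c := by
    rcases Nat.eq_zero_or_pos c with h0 | h0
    · rw [h0] at hi
      have := mul_pos (hcost i) hn'
      simp only [Nat.cast_zero, mul_zero] at hi
      linarith
    · exact h0
  have hcard : c + #{u ∈ V | ¬ covers i u} = n := by
    rw [hc, card_filter_add_card_filter_not, h]
  obtain ⟨T, hT, hTc⟩ := ih _ (by omega) {u ∈ V | ¬ covers i u}
    (fun u hu => hV u (mem_filter.1 hu).1) rfl
  set m := #{u ∈ V | ¬ covers i u}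
  refine ⟨insert i T, fun u hu => ?_, ?_⟩
  · by_cases hcu : covers i u
    · exact ⟨i, mem_insert_self _ _, hcu⟩
    · obtain ⟨j, hj, hju⟩ := hT u (mem_filter.2 ⟨hu, hcu⟩)
      exact ⟨j, mem_insert_of_mem hj, hju⟩
  -- The `c` elements covered now are charged `1 / n` each, at most the terms of the harmonic sum
  -- from `1 / (m + 1)` to `1 / n`.
  · have hharm : ((harmonic m : ℚ) : ℝ) + c / n ≤ (harmonic n : ℚ) := by
      have key : ∀ c, c + m ≤ n → ((harmonic m : ℚ) : ℝ) + c / n ≤ (harmonic (m + c) : ℚ) := by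
        intro c
        induction c with
        | zero => intro _; simp
        | succ c ihc =>
          intro hle
          have h1 := ihc (by omega)
          rw [← add_assoc, harmonic_succ]
          push_cast
          have h2 : (1 : ℝ) / n ≤ ((m : ℝ) + c + 1)⁻¹ := by
            rw [← one_div]
            apply one_div_le_one_div_of_le (by positivity)
            have : m + c + 1 ≤ n := by omega
            exact_mod_cast this
          rw [add_div]
          linarith
      have := key c (by omega)
      rwa [show m + c = n by omega] at this
    have hstep : cost i ≤ M * (c / n) := by
      rw [← mul_div_assoc, le_div_iff₀ hn']
      exact hi
    calc ∑ j ∈ insert i T, cost j ≤ cost i + ∑ j ∈ T, cost j := by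
          by_cases hiT : i ∈ T
          · rw [insert_eq_of_mem hiT]; linarith [hcost i]
          · rw [sum_insert hiT]
      _ ≤ M * (c / n) + M * harmonic m := add_le_add hstep hTc
      _ = M * (harmonic m + c / n) := by ring
      _ ≤ M * harmonic n := mul_le_mul_of_nonneg_left hharm hM0

/-- A covering code for words over `U` with letters in `Fin k`: the entry `d` has the word
`word (d * t + q)` and the capacities `r₁ d` and `r₂ d`. -/
theorem exists_code {U : Type} [Fintype U] [Nonempty U] (k : ℕ) (e f : ℕ → U → ℕ)
    (he : ∀ w u, e w u ≤ 1) (hf : ∀ w u, f w u ≤ 1) {A B c γ : ℝ} (hA : 1 ≤ A) (hB : 1 ≤ B) (hc : 0 < c)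
    (hcu : ∀ u, c ≤ ∑ w ∈ range k, (A ^ e w u * B ^ f w u)⁻¹) (hγ : k / c < γ) (hk : 0 < k) :
    ∃ (t size : ℕ) (r₁ r₂ word : ℕ → ℕ), 0 < t ∧ (∀ x, word x < k) ∧
      (∀ x, size * t ≤ x → word x = 0) ∧
      (∀ u : ℕ → U, ∃ d < size, ∑ q ∈ range t, e (word (d * t + q)) (u q) ≤ r₁ d ∧
        ∑ q ∈ range t, f (word (d * t + q)) (u q) ≤ r₂ d) ∧
      ∑ d ∈ range size, A ^ r₁ d * B ^ r₂ d ≤ γ ^ t := by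
  classical
  have hk' : (0 : ℝ) < k := by exact_mod_cast hk
  have hγ0 : 0 < γ := lt_trans (by positivity) hγ
  set K : ℝ := 4 * (1 + Fintype.card U) with hK
  have hK0 : 0 < K := by positivity
  -- All losses are polynomial in `t`: a factor `(t + 1) ^ 2` for the capacities and one linear in
  -- `t` for the harmonic number. A long block absorbs them in the gap between `k / c` and `γ`.
  obtain ⟨t, ht, htK⟩ : ∃ t : ℕ, 0 < t ∧ K * (t ^ 3 * (k / c / γ) ^ t) < 1 := by
    have h1 := (tendsto_pow_const_mul_const_pow_of_abs_lt_one (r := k / c / γ) 3 (by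
      rw [abs_of_pos (by positivity), div_lt_one hγ0]; exact hγ)).const_mul K
    rw [mul_zero] at h1
    obtain ⟨t, h2, h3⟩ := ((h1.eventually (gt_mem_nhds one_pos)).and (eventually_gt_atTop 0)).exists
    exact ⟨t, h3, h2⟩
  have ht' : (1 : ℝ) ≤ t := by exact_mod_cast ht
  let ι := (Fin t → Fin k) × Fin (t + 1) × Fin (t + 1)
  let cost : ι → ℝ := fun i => A ^ (i.2.1 : ℕ) * B ^ (i.2.2 : ℕ)
  -- An item is a word with two capacities, weighted inversely to its cost. For a given `u`, the
  -- items that give each word precisely its own error counts already have weight at least 1,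
  -- because the sum over words factors into `t` sums, each at least `c`.
  let μ : ι → ℝ := fun i => (c ^ t * cost i)⁻¹
  let covers : ι → (Fin t → U) → Prop := fun i u =>
    ∑ q, e (i.1 q) (u q) ≤ i.2.1 ∧ ∑ q, f (i.1 q) (u q) ≤ i.2.2
  have hcost : ∀ i, 0 < cost i := fun i => by positivity
  have hM : ∑ i, μ i * cost i ≤ (t + 1) ^ 2 * (k / c) ^ t := by
    have : ∀ i, μ i * cost i = (c ^ t)⁻¹ := by
      intro i
      have := (hcost i).ne'
      simp only [μ]
      field_simp
    rw [sum_congr rfl fun i _ => this i, sum_const, card_univ]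
    simp only [ι, Fintype.card_prod, Fintype.card_fun, Fintype.card_fin, nsmul_eq_mul]
    push_cast
    rw [div_pow]
    apply le_of_eq
    field_simp
  have hcov : ∀ u ∈ (univ : Finset (Fin t → U)), 1 ≤ ∑ i with covers i u, μ i := by
    intro u _
    have hlt : ∀ (g : ℕ → U → ℕ), (∀ w u, g w u ≤ 1) → ∀ w : Fin t → Fin k,
        ∑ q, g (w q) (u q) < t + 1 := by
      intro g hg w
      have := sum_le_card_nsmul univ (fun q => g (w q) (u q)) 1 fun q _ => hg _ _
      simp at this
      omega
    let φ : (Fin t → Fin k) → ι := fun w => (w, ⟨_, hlt e he w⟩, ⟨_, hlt f hf w⟩)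
    have hφ : Function.Injective φ := fun w w' h => congrArg Prod.fst h
    calc (1 : ℝ) = (c ^ t)⁻¹ * c ^ t := by field_simp
      _ = (c ^ t)⁻¹ * ∏ q : Fin t, c := by simp
      _ ≤ (c ^ t)⁻¹ * ∏ q : Fin t, ∑ w : Fin k, (A ^ e w (u q) * B ^ f w (u q))⁻¹ := by
          apply mul_le_mul_of_nonneg_left _ (by positivity)
          apply prod_le_prod (fun _ _ => hc.le)
          intro q _
          have := hcu (u q)
          rwa [← Fin.sum_univ_eq_sum_range (fun w => (A ^ e w (u q) * B ^ f w (u q))⁻¹)] at this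
      _ = ∑ w : Fin t → Fin k, μ (φ w) := by
          rw [prod_univ_sum, mul_sum, Fintype.piFinset_univ]
          refine sum_congr rfl fun w _ => ?_
          simp only [μ, cost, φ]
          rw [mul_inv, prod_inv_distrib, prod_mul_distrib, prod_pow_eq_pow_sum, prod_pow_eq_pow_sum]
      _ = ∑ i ∈ univ.image φ, μ i := by rw [sum_image fun _ _ _ _ h => hφ h]
      _ ≤ ∑ i with covers i u, μ i := by
          apply sum_le_sum_of_subset_of_nonneg
          · intro i hi
            obtain ⟨w, _, rfl⟩ := mem_image.1 hi
            exact mem_filter.2 ⟨mem_univ _, le_rfl, le_rfl⟩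
          · intro i _ _
            have := hcost i
            positivity
  obtain ⟨T, hT, hTc⟩ := exists_cover covers cost μ hcost
    (fun i => by have := hcost i; positivity) hM univ hcov
  let item : ℕ → ι := fun d => if h : d < #T then T.equivFin.symm ⟨d, h⟩ else
    (fun _ => ⟨0, hk⟩, 0, 0)
  refine ⟨t, #T, fun d => (item d).2.1, fun d => (item d).2.2,
    fun x => (item (x / t)).1 ⟨x % t, Nat.mod_lt _ ht⟩, ht, fun x => Fin.is_lt _, ?_, ?_, ?_⟩
  · intro x hx
    have : ¬ x / t < #T := by
      rw [not_lt, Nat.le_div_iff_mul_le ht]; exact hx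
    simp only [item, dif_neg this]
  · intro u
    obtain ⟨i, hi, h1, h2⟩ := hT (fun q => u q) (mem_univ _)
    refine ⟨T.equivFin ⟨i, hi⟩, Fin.is_lt _, ?_⟩
    have hitem : item (T.equivFin ⟨i, hi⟩) = i := by
      simp only [item, dif_pos (Fin.is_lt _), Fin.eta, Equiv.symm_apply_apply]
    have hword : ∀ q : Fin t, ((item (((T.equivFin ⟨i, hi⟩ : Fin #T) * t + q) / t)).1
        ⟨((T.equivFin ⟨i, hi⟩ : Fin #T) * t + q) % t, Nat.mod_lt _ ht⟩ : ℕ) = i.1 q := by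
      intro q
      have e1 : ((T.equivFin ⟨i, hi⟩ : Fin #T) * t + q : ℕ) / t = (T.equivFin ⟨i, hi⟩ : Fin #T) := by
        rw [add_comm, Nat.add_mul_div_right _ _ ht, Nat.div_eq_of_lt q.2, zero_add]
      have e2 : ((T.equivFin ⟨i, hi⟩ : Fin #T) * t + q : ℕ) % t = q := by
        rw [add_comm, Nat.add_mul_mod_self_right, Nat.mod_eq_of_lt q.2]
      simp only [e1, e2, hitem]
    rw [sum_range, sum_range]
    simp only [hword, hitem]
    exact ⟨h1, h2⟩
  · calc ∑ d ∈ range #T, A ^ ((item d).2.1 : ℕ) * B ^ ((item d).2.2 : ℕ)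
        = ∑ d : Fin #T, cost (item d) := by rw [sum_range]
      _ = ∑ i : T, cost i := by
          apply Fintype.sum_equiv T.equivFin.symm
          intro d
          simp only [item, dif_pos d.2, Fin.eta]
      _ = ∑ i ∈ T, cost i := by rw [sum_coe_sort]
      _ ≤ _ := hTc
      _ ≤ (t + 1) ^ 2 * (k / c) ^ t * (1 + t * Fintype.card U) := by
          apply mul_le_mul_of_nonneg_left _ (by positivity)
          refine (harmonic_le_one_add_log _).trans ?_
          rw [card_univ, Fintype.card_fun, Fintype.card_fin, Nat.cast_pow, Real.log_pow]
          gcongr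
          exact Real.log_le_self (by positivity)
      _ ≤ K * t ^ 3 * (k / c) ^ t := by
          have h1 : ((t : ℝ) + 1) ^ 2 ≤ 4 * t ^ 2 := by nlinarith
          have h2 : 1 + (t : ℝ) * Fintype.card U ≤ (1 + Fintype.card U) * t := by nlinarith
          have h3 : ((t : ℝ) + 1) ^ 2 * (1 + t * Fintype.card U) ≤
              4 * t ^ 2 * ((1 + Fintype.card U) * t) := by gcongr
          have h4 : (0 : ℝ) ≤ (k / c) ^ t := by positivity
          nlinarith [mul_le_mul_of_nonneg_right h3 h4]
      _ ≤ γ ^ t := by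
          rw [div_pow (k / c) γ, ← mul_div_assoc, ← mul_div_assoc, div_lt_one (by positivity)] at htK
          linarith

/-- The covering code for assignments. -/
theorem exists_boolean_code : ∃ (t size : ℕ) (rad bit : ℕ → ℕ), 0 < t ∧ (∀ x, bit x ≤ 1) ∧
    (∀ x, size * t ≤ x → bit x = 0) ∧
    (∀ β : ℕ → ℕ, (∀ q, β q ≤ 1) → ∃ d < size, #{q ∈ range t | bit (d * t + q) ≠ β q} ≤ rad d) ∧
    ∑ d ∈ range size, ballBase ^ rad d ≤ (1.439 : ℝ) ^ t := by
  have h1 := lt_ballBase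
  have h2 := ballBase_lt
  obtain ⟨t, size, r₁, r₂, word, ht, hw, hz, hcov, hcost⟩ := exists_code (U := Fin 2) 2
    (fun w u => if w ≠ u then 1 else 0) (fun _ _ => 0) (by intro w u; split_ifs <;> simp) (by simp)
    -- The correct letter contributes 1 and the wrong one `1 / ballBase`. The quotient `2 / (1 + 1 /
    -- ballBase)` is just below 1.4385: this is the source of 1.439.
    (A := ballBase) (B := 1) (c := 1 + ballBase⁻¹) (γ := 1.439) (by linarith) le_rfl
    (by have := ballBase_pos; positivity) (by
      intro u
      rw [sum_range_succ, sum_range_one]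
      fin_cases u
      · simp
      · simp [add_comm]) (by
      have := ballBase_pos
      rw [div_lt_iff₀ (by positivity)]
      have h3 : (0.39038 : ℝ) < ballBase⁻¹ := by
        rw [lt_inv_comm₀ (by norm_num) this]
        refine h2.trans ?_
        norm_num
      push_cast
      linarith) (by norm_num)
  refine ⟨t, size, r₁, word, ht, fun x => Nat.le_of_lt_succ (hw x), hz, fun β hβ => ?_, ?_⟩
  · obtain ⟨d, hd, h, _⟩ := hcov fun q => ⟨β q, Nat.lt_succ_of_le (hβ q)⟩
    refine ⟨d, hd, ?_⟩
    rw [card_filter]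
    exact h
  · simpa using hcost

open Classical in
/-- The covering code for families of disjoint clauses. -/
theorem exists_clause_code : ∃ (t size : ℕ) (sw ex pos : ℕ → ℕ), 0 < t ∧ (∀ x, pos x < 3) ∧
    (∀ x, size * t ≤ x → pos x = 0) ∧
    (∀ Q : ℕ → ℕ → Prop, (∀ q, ∃ p < 3, Q q p) → ∃ d < size,
      #{q ∈ range t | ¬ Q q (pos (d * t + q))} ≤ sw d ∧
      #{q ∈ range t | Q q (pos (d * t + q)) ∧ 2 ≤ #{p ∈ range 3 | Q q p}} ≤ ex d) ∧
    ∑ d ∈ range size, (10 : ℝ) ^ sw d * (4 / ballBase) ^ ex d ≤ ballBase ^ t := by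
  have h1 := lt_ballBase
  have h2 := ballBase_lt
  have hb := ballBase_pos
  let U := {S : Finset ℕ // S ∈ (range 3).powerset ∧ S.Nonempty}
  have : Fintype U := Fintype.subtype ((range 3).powerset.filter Finset.Nonempty) (by simp)
  have : Nonempty U := ⟨⟨{0}, by simp⟩⟩
  obtain ⟨t, size, r₁, r₂, word, ht, hw, hz, hcov, hcost⟩ := exists_code (U := U) 3
    (fun w u => if w ∉ u.1 then 1 else 0) (fun w u => if w ∈ u.1 ∧ 2 ≤ #u.1 then 1 else 0)
    (by intro w u; split_ifs <;> simp) (by intro w u; split_ifs <;> simp)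
    -- A singleton contributes `1 + 2 / 10 = 1.2`; two elements give at least `2 * 0.64 + 0.1`,
    -- three at least `3 * 0.64`. So the cost per letter is `3 / 1.2 = 2.5 < ballBase`.
    (A := 10) (B := 4 / ballBase) (c := 1.2) (γ := ballBase) (by norm_num) Search.one_le_four_div
    (by norm_num) (by
      rintro ⟨S, hS, hne⟩
      rw [sum_range_succ, sum_range_succ, sum_range_one]
      have h3 : (0.64 : ℝ) ≤ (4 / ballBase)⁻¹ := by
        rw [inv_div, le_div_iff₀ (by norm_num)]; linarith
      have hS' : S ∈ ({∅, {0}, {1}, {2}, {0, 1}, {0, 2}, {1, 2}, {0, 1, 2}} : Finset (Finset ℕ)) := by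
        revert hS
        have : (range 3).powerset =
            ({∅, {0}, {1}, {2}, {0, 1}, {0, 2}, {1, 2}, {0, 1, 2}} : Finset (Finset ℕ)) := by decide
        rw [this]; exact id
      simp only [mem_insert, mem_singleton] at hS'
      rcases hS' with rfl | rfl | rfl | rfl | rfl | rfl | rfl | rfl
      · simp at hne
      all_goals
        norm_num
        try linarith) (by norm_num; linarith) (by norm_num)
  refine ⟨t, size, r₁, r₂, word, ht, hw, hz, fun Q hQ => ?_, hcost⟩
  obtain ⟨d, hd, h, h'⟩ := hcov fun q => ⟨{p ∈ range 3 | Q q p}, by simp, by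
    obtain ⟨p, hp, hp'⟩ := hQ q
    exact ⟨p, by simp [hp, hp']⟩⟩
  refine ⟨d, hd, ?_, ?_⟩
  · rw [card_filter]
    refine le_trans (le_of_eq (sum_congr rfl fun q _ => ?_)) h
    have := hw (d * t + q)
    simp [this]
  · rw [card_filter]
    refine le_trans (le_of_eq (sum_congr rfl fun q _ => ?_)) h'
    have := hw (d * t + q)
    simp [this]


/-! ### Depth-first search -/

namespace DFS

open Finset

/-- The state of a depth-first search: the path `ch 0, …, ch (len - 1)` of choices leading to the
current node, whether the node is to be entered (`dir = 0`) or left, whether the search is still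
running, and its answer. -/
structure State where
  len : ℕ
  ch : ℕ → ℕ
  dir : ℕ
  run : ℕ
  ans : ℕ

variable {X : Type*} (N cap : ℕ) (root : X) (child : ℕ → X → X) (st : X → ℕ)

def node (ch : ℕ → ℕ) : ℕ → X
  | 0 => root
  | l + 1 => child (ch l) (node ch l)

theorem node_congr {ch ch' : ℕ → ℕ} : ∀ {l : ℕ}, (∀ i < l, ch i = ch' i) →
    node root child ch l = node root child ch' l
  | 0, _ => rfl
  | l + 1, h => by
    rw [node, node, node_congr (l := l) fun i hi => h i (by omega), h l (by omega)]

/-- One step of the search; the nodes with `st = 0` are inner nodes, and those with `st = 2` accept. -/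
def iter (D : State) : State :=
  if D.dir = 0 then
    if st (node root child D.ch D.len) = 0 then
      -- The minimum has no effect in the search, whose depth stays below `cap`; it mirrors the
      -- machine, which stores capped values only.
      { D with ch := Function.update D.ch D.len 0, len := min (D.len + 1) cap }
    else if st (node root child D.ch D.len) = 2 then { D with ans := 1, run := 0 }
    else { D with dir := 1 }
  else if D.len = 0 then { D with run := 0 }
  else if D.ch (D.len - 1) + 1 < N then
    { D with ch := Function.update D.ch (D.len - 1) (min (D.ch (D.len - 1) + 1) cap), dir := 0 }
  else { D with len := D.len - 1 }

/-- `m` steps lead from one state to another. -/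
inductive Runs {α : Type*} (f : α → α) (run : α → ℕ) : ℕ → α → α → Prop
  | refl (D : α) : Runs f run 0 D D
  | step {m : ℕ} {D D' : α} : run D ≠ 0 → Runs f run m (f D) D' → Runs f run (m + 1) D D'

theorem Runs.trans {α : Type*} {f : α → α} {run : α → ℕ} {m m' : ℕ} {D D' D'' : α}
    (h : Runs f run m D D') (h' : Runs f run m' D' D'') : Runs f run (m + m') D D'' := by
  induction h with
  | refl => rwa [zero_add]
  | step h1 _ ih => rw [add_right_comm]; exact .step h1 (ih h')

/-- There is an accepting node in the tree below. -/
inductive Accepts : X → Prop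
  | leaf {σ : X} : st σ = 2 → Accepts σ
  | inner {σ : X} {d : ℕ} : st σ = 0 → d < N → Accepts (child d σ) → Accepts σ

variable {N cap root child st}

/-- The search below a node: it finds an accepting node, or returns. The number of steps is bounded
by `cnt`. -/
theorem visit {P : X → Prop} {fuel : X → ℕ} {cnt : X → ℝ} (hN : 0 < N) (hcap : N ≤ cap)
    (hP : ∀ σ d, P σ → st σ = 0 → st (child d σ) = 0 → P (child d σ) ∧ fuel (child d σ) < fuel σ)
    (hcnt : ∀ σ, P σ → st σ = 0 → 1 + ∑ d ∈ range N, (cnt (child d σ) + 1) ≤ cnt σ)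
    (hone : ∀ σ, st σ ≠ 0 → 1 ≤ cnt σ) : ∀ (f : ℕ) (D : State),
    (st (node root child D.ch D.len) = 0 → P (node root child D.ch D.len) ∧
      fuel (node root child D.ch D.len) < f) →
    D.len + f ≤ cap → D.run = 1 → D.dir = 0 → D.ans = 0 →
    ∃ m D', Runs (iter N cap root child st) State.run m D D' ∧
      (m : ℝ) ≤ cnt (node root child D.ch D.len) ∧
      ((D'.run = 0 ∧ D'.ans = 1 ∧ Accepts N child st (node root child D.ch D.len)) ∨
      (D'.run = 1 ∧ D'.dir = 1 ∧ D'.ans = 0 ∧ D'.len = D.len ∧ (∀ i < D.len, D'.ch i = D.ch i) ∧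
        ¬ Accepts N child st (node root child D.ch D.len))) := by
  intro f
  induction f using Nat.strong_induction_on with
  | _ f ih =>
  intro D hD hlen hrun hdir hans
  set σ := node root child D.ch D.len with hσ
  by_cases h0 : st σ = 0
  swap
  · by_cases h2 : st σ = 2
    · refine ⟨1, { D with ans := 1, run := 0 }, .step (by omega) ?_, by simpa using hone σ h0,
        .inl ⟨rfl, rfl, .leaf h2⟩⟩
      rw [iter, if_pos hdir, ← hσ, if_neg h0, if_pos h2]
      exact .refl _
    · refine ⟨1, { D with dir := 1 }, .step (by omega) ?_, by simpa using hone σ h0,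
        .inr ⟨hrun, rfl, hans, rfl, fun _ _ => rfl, ?_⟩⟩
      · rw [iter, if_pos hdir, ← hσ, if_neg h0, if_neg h2]
        exact .refl _
      · intro h
        cases h with
        | leaf h => exact h2 h
        | inner h => exact h0 h
  obtain ⟨hPσ, hfuel⟩ := hD h0
  -- the children from `d` on
  have key : ∀ e d, d + e = N → 0 < e → ∀ E : State, E.len = D.len + 1 → E.run = 1 → E.dir = 0 →
      E.ans = 0 → (∀ i < D.len, E.ch i = D.ch i) → E.ch D.len = d →
      (∀ d' < d, ¬ Accepts N child st (child d' σ)) →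
      ∃ m D', Runs (iter N cap root child st) State.run m E D' ∧
        (m : ℝ) ≤ ∑ d' ∈ Ico d N, (cnt (child d' σ) + 1) ∧
        ((D'.run = 0 ∧ D'.ans = 1 ∧ Accepts N child st σ) ∨
        (D'.run = 1 ∧ D'.dir = 1 ∧ D'.ans = 0 ∧ D'.len = D.len ∧ (∀ i < D.len, D'.ch i = D.ch i) ∧
          ¬ Accepts N child st σ)) := by
    intro e
    induction e with
    | zero => intro d _ h; omega
    | succ e ihe =>
      intro d hde _ E e1 e2 e3 e4 e5 e6 e7
      have hnode : node root child E.ch E.len = child d σ := by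
        rw [e1, node, e6, node_congr root child e5]
      have h1 := ih (f - 1) (by omega) E (by
        rw [hnode]
        intro h
        obtain ⟨h1, h2⟩ := hP σ d hPσ h0 h
        exact ⟨h1, by omega⟩) (by omega) e2 e3 e4
      rw [hnode] at h1
      obtain ⟨m, E', hr, hm, h⟩ := h1
      have hsum : ∑ d' ∈ Ico d N, (cnt (child d' σ) + 1) =
          (cnt (child d σ) + 1) + ∑ d' ∈ Ico (d + 1) N, (cnt (child d' σ) + 1) :=
        sum_eq_sum_Ico_succ_bot (by omega) _
      -- At inner nodes nonnegativity is not among the hypotheses; it follows from `hcnt` by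
      -- induction on the fuel.
      have hone' : ∀ d, 0 ≤ cnt (child d σ) := by
        intro d
        by_cases hd : st (child d σ) = 0
        · have hpos : ∀ (k : ℕ) (τ : X), P τ → st τ = 0 → fuel τ ≤ k → 0 ≤ cnt τ := by
            intro k
            induction k with
            | zero | succ k ihk =>
              intro τ hτ hs hk
              refine le_trans ?_ (hcnt τ hτ hs)
              refine add_nonneg zero_le_one (sum_nonneg fun d' _ => ?_)
              by_cases hd' : st (child d' τ) = 0
              · obtain ⟨p1, p2⟩ := hP τ d' hτ hs hd'
                first
                | omega
                | exact add_nonneg (ihk _ p1 hd' (by omega)) zero_le_one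
              · linarith [hone _ hd']
          exact hpos _ _ (hP σ d hPσ h0 hd).1 hd le_rfl
        · linarith [hone _ hd]
      have hrest : 0 ≤ ∑ d' ∈ Ico (d + 1) N, (cnt (child d' σ) + 1) :=
        sum_nonneg fun d' _ => by linarith [hone' d']
      rcases h with ⟨h1, h2, h3⟩ | ⟨h1, h2, h3, h4, h5, h6⟩
      · exact ⟨m, E', hr, by linarith, .inl ⟨h1, h2, .inner h0 (by omega) h3⟩⟩
      · have hch : E'.ch D.len = d := by rw [h5 _ (by omega), e6]
        have hbelow : ∀ d' < d + 1, ¬ Accepts N child st (child d' σ) := by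
          intro d' hd'
          rcases Nat.lt_succ_iff_lt_or_eq.1 hd' with h | rfl
          exacts [e7 d' h, h6]
        have hlen1 : E'.len - 1 = D.len := by omega
        by_cases hlast : d + 1 < N
        · obtain ⟨m', D', hr', hm', h'⟩ := ihe (d + 1) (by omega) (by omega)
            { E' with ch := Function.update E'.ch D.len (d + 1), dir := 0 } (by simp; omega) h1 rfl h3
            (fun i hi => by
              simp only [Function.update_of_ne (by omega : i ≠ D.len)]
              rw [h5 i (by omega), e5 i hi]) (by simp) hbelow
          refine ⟨m + (m' + 1), D', hr.trans (.step (by omega) ?_), by push_cast; linarith, h'⟩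
          rw [iter, if_neg (by omega), if_neg (by omega), hlen1, hch, if_pos hlast,
            min_eq_left (by omega)]
          exact hr'
        · refine ⟨m + 1, { E' with len := D.len }, hr.trans (.step (by omega) ?_),
            by push_cast; linarith, .inr ⟨h1, h2, h3, rfl, fun i hi => ?_, ?_⟩⟩
          · rw [iter, if_neg (by omega), if_neg (by omega), hlen1, hch, if_neg hlast]
            exact .refl _
          · rw [← e5 i hi]; exact h5 i (by omega)
          · intro h
            cases h with
            | leaf h => omega
            | inner _ hd' h => exact hbelow _ (by omega) h
  obtain ⟨m, D', hr, hm, h⟩ := key N 0 (by omega) hN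
    { D with ch := Function.update D.ch D.len 0, len := D.len + 1 } rfl hrun hdir hans
    (fun i hi => by simp only [Function.update_of_ne (by omega : i ≠ D.len)]) (by simp) (by simp)
  refine ⟨m + 1, D', .step (by omega) ?_, ?_, h⟩
  · rw [iter, if_pos hdir, ← hσ, if_pos h0, min_eq_left (by omega)]
    exact hr
  · have := hcnt σ hPσ h0
    rw [range_eq_Ico] at this
    push_cast
    linarith

/-- The whole search. -/
theorem search {P : X → Prop} {fuel : X → ℕ} {cnt : X → ℝ} (hN : 0 < N) (hcap : N ≤ cap)
    (hP : ∀ σ d, P σ → st σ = 0 → st (child d σ) = 0 → P (child d σ) ∧ fuel (child d σ) < fuel σ)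
    (hcnt : ∀ σ, P σ → st σ = 0 → 1 + ∑ d ∈ range N, (cnt (child d σ) + 1) ≤ cnt σ)
    (hone : ∀ σ, st σ ≠ 0 → 1 ≤ cnt σ) (hroot : st root = 0 → P root) (hfuel : fuel root < cap)
    {D : State} (hlen : D.len = 0) (hrun : D.run = 1) (hdir : D.dir = 0) (hans : D.ans = 0) :
    ∃ m D', Runs (iter N cap root child st) State.run m D D' ∧ (m : ℝ) ≤ cnt root + 1 ∧
      D'.run = 0 ∧ (Accepts N child st root → D'.ans = 1) ∧
      (¬ Accepts N child st root → D'.ans = 0) := by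
  have hn : node root child D.ch D.len = root := by rw [hlen]; rfl
  obtain ⟨m, D', hr, hm, h⟩ := visit hN hcap hP hcnt hone (fuel root + 1) D
    (by rw [hn]; exact fun h => ⟨hroot h, by omega⟩) (by omega) hrun hdir hans
  rw [hn] at hm h
  rcases h with ⟨h1, h2, h3⟩ | ⟨h1, h2, h3, h4, h5, h6⟩
  · exact ⟨m, D', hr, by linarith, h1, fun _ => h2, fun h => absurd h3 h⟩
  · refine ⟨m + 1, { D' with run := 0 }, hr.trans (.step (by omega) ?_), by push_cast; linarith, rfl,
      fun h => absurd h h6, fun _ => h3⟩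
    rw [iter, if_neg (by omega), if_pos (by omega)]
    exact .refl _

end DFS


/-! ### The search as a program -/

namespace HL

/-- The value of the expression is not zero. -/
def Ex.Holds (e : Ex) (y : ℕ → ℕ) (S : Store) : Prop := e.eval y S ≠ 0

instance (e : Ex) (y : ℕ → ℕ) (S : Store) : Decidable (e.Holds y S) :=
  inferInstanceAs (Decidable (_ ≠ _))

def Ex.and (a b : Ex) : Ex := .ite a (.ite b (.const 1) (.const 0)) (.const 0)

def Ex.or (a b : Ex) : Ex := .ite a (.const 1) (.ite b (.const 1) (.const 0))

def Ex.not (a : Ex) : Ex := .ite a (.const 0) (.const 1)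

def Ex.mod (a b : Ex) : Ex := .sub a (.mul b (.div a b))

/-- The cell `0` of an array. -/
def Ex.reg (k : ℕ) : Ex := .get k (.const 0)

section
variable {y : ℕ → ℕ} {S : Store} {a b : Ex}

@[simp] theorem Ex.holds_eq : (Ex.eq a b).Holds y S ↔ a.eval y S = b.eval y S := by
  simp [Holds]

@[simp] theorem Ex.holds_lt : (Ex.lt a b).Holds y S ↔ a.eval y S < b.eval y S := by
  simp [Holds]

@[simp] theorem Ex.holds_and : (Ex.and a b).Holds y S ↔ a.Holds y S ∧ b.Holds y S := by
  simp [Holds, Ex.and]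

@[simp] theorem Ex.holds_or : (Ex.or a b).Holds y S ↔ a.Holds y S ∨ b.Holds y S := by
  by_cases h : a.eval y S = 0 <;> simp [Holds, Ex.or, h]

@[simp] theorem Ex.holds_not : (Ex.not a).Holds y S ↔ ¬ a.Holds y S := by
  simp [Holds, Ex.not]

@[simp] theorem Ex.eval_mod : (Ex.mod a b).eval y S = a.eval y S % b.eval y S :=
  (Nat.mod_eq_sub_mul_div).symm

@[simp] theorem Ex.eval_reg (k : ℕ) : (Ex.reg k).eval y S = S k 0 := rfl

end

/-- Assign to the cell `0` of an array. -/
def Pr.put (k : ℕ) (e : Ex) : Pr := .set k (.const 0) e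

@[simp] theorem Pr.den_put (y : ℕ → ℕ) (k : ℕ) (e : Ex) (S : Store) :
    (Pr.put k e).den y S = S.set k 0 (e.eval y S) := rfl

theorem Pr.den_ite (y : ℕ → ℕ) (e : Ex) (p q : Pr) (S : Store) :
    (Pr.ite e p q).den y S = if e.Holds y S then p.den y S else q.den y S := rfl

/-- A sequence of programs. -/
def Pr.seqs : List Pr → Pr
  | [] => .skip
  | p :: l => .seq p (seqs l)

@[simp] theorem Pr.den_seqs_nil (y : ℕ → ℕ) (S : Store) : (Pr.seqs []).den y S = S := rfl

@[simp] theorem Pr.den_seqs_cons (y : ℕ → ℕ) (p : Pr) (l : List Pr) (S : Store) :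
    (Pr.seqs (p :: l)).den y S = (Pr.seqs l).den y (p.den y S) := rfl

/-- The program for `Search.first`: the result is stored in the array `22`. -/
def Pr.first (cond bound : Ex) : Pr :=
  .seqs [.put 22 bound, .loop 23 bound (.ite cond (.put 22 (.reg 23)) .skip)]

/-- The condition may depend on the counter but not otherwise on the two scratch arrays, so all
rounds test the same predicate. As the loop counts downwards, the last hit recorded is the least
one. -/
theorem loopDown_scan {y : ℕ → ℕ} {cond : Ex} {P : ℕ → Prop} {S : Store}
    (h : ∀ T z, (∀ l, l ≠ 22 → l ≠ 23 → T l = S l) → T 23 0 = z → (cond.Holds y T ↔ P z)) :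
    ∀ (N : ℕ) (T : Store), (∀ l, l ≠ 22 → l ≠ 23 → T l = S l) →
      loopDown ((Pr.ite cond (.put 22 (.reg 23)) .skip).den y) 23 N T 22 0 =
        Search.scan P N (T 22 0)
  | 0, T, _ => by simp [loopDown, Search.scan, Store.set_apply]
  | N + 1, T, hT => by
    rw [loopDown, Search.scan]
    have hc : cond.Holds y (T.set 23 0 N) ↔ P N := by
      apply h
      · intro l h1 h2
        rw [T.set_ne _ _ h2, hT l h1 h2]
      · simp [Store.set_apply]
    rw [Pr.den_ite, loopDown_scan h N]
    · congr 1
      by_cases hP : P N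
      · rw [if_pos hP, if_pos (hc.2 hP)]
        simp [Store.set_apply]
      · rw [if_neg hP, if_neg fun hh => hP (hc.1 hh)]
        simp [Store.set_apply]
    · intro l h1 h2
      split_ifs
      · rw [Pr.den_put, Store.set_ne _ _ _ h1, T.set_ne _ _ h2, hT l h1 h2]
      · rw [Pr.den, T.set_ne _ _ h2, hT l h1 h2]

theorem Pr.first_den {y : ℕ → ℕ} {cond bound : Ex} {P : ℕ → Prop} {S : Store}
    (hb : ∀ T : Store, (∀ l, l ≠ 22 → l ≠ 23 → T l = S l) → bound.eval y T = bound.eval y S)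
    (h : ∀ T z, (∀ l, l ≠ 22 → l ≠ 23 → T l = S l) → T 23 0 = z → (cond.Holds y T ↔ P z)) :
    (∀ l, l ≠ 22 → l ≠ 23 → (Pr.first cond bound).den y S l = S l) ∧
      (Pr.first cond bound).den y S 22 0 = Search.first P (bound.eval y S) := by
  have hS : ∀ l, l ≠ 22 → l ≠ 23 → (S.set 22 0 (bound.eval y S)) l = S l :=
    fun l h1 _ => S.set_ne _ _ h1
  constructor
  · intro l h1 h2
    rw [Pr.den_keeps]
    simp [Pr.first, Pr.seqs, Pr.put, h1, h2]
  · simp only [Pr.first, Pr.den_seqs_cons, Pr.den_seqs_nil, Pr.den_put]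
    rw [Pr.den, loopDown_scan h _ _ hS, hb _ hS, Store.set_apply, if_pos ⟨rfl, rfl⟩, Search.first]

end HL

/-! ### Programs for the steps of the search -/

namespace Search

open HL

/-- The data of the search are in the arrays `0` to `8`. -/
def dat (tA sizeA tC sizeC : ℕ) (S : Store) : Data where
  cap := S 0 0
  n := S 1 0
  c := S 2 0
  lit := S 3
  rad := S 4
  bit := S 5
  sw := S 6
  ex := S 7
  pos := S 8
  tA := tA
  sizeA := sizeA
  tC := tC
  sizeC := sizeC

/-- The state of the search is in the arrays `9` to `20`. -/
def abs (S : Store) : St where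
  ph := S 9 0
  st := S 10 0
  k := S 11 0
  s := S 12 0
  j := S 13 0
  g := S 14 0
  i := S 15 0
  m := S 16 0
  val := S 17
  mark := S 18
  tv := S 19
  rp := S 20

theorem abs_congr {S T : Store} (h : ∀ l, 9 ≤ l → l ≤ 20 → S l = T l) : abs S = abs T := by
  simp [abs, h]

theorem dat_congr {S T : Store} (tA sizeA tC sizeC : ℕ) (h : ∀ l, l ≤ 8 → S l = T l) :
    dat tA sizeA tC sizeC S = dat tA sizeA tC sizeC T := by
  simp [dat, h]

theorem abs_ite {c c' : Prop} {_ : Decidable c} {_ : Decidable c'} {A B : Store} {A' B' : St}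
    (h : c ↔ c') (hA : c' → abs A = A') (hB : ¬ c' → abs B = B') :
    abs (if c then A else B) = if c' then A' else B' := by
  by_cases hc : c'
  · rw [if_pos (h.2 hc), if_pos hc, hA hc]
  · rw [if_neg fun hh => hc (h.1 hh), if_neg hc, hB hc]

/-- The variable of the literal `q` of the clause `z`. -/
def varE (z q : Ex) : Ex := .div (.get 3 (.add (.mul (.const 3) z) q)) (.const 2)

def litE (z : Ex) (q : ℕ) : Ex := .get 3 (.add (.mul (.const 3) z) (.const q))

def memE (z x : Ex) : Ex :=
  .or (.eq (varE z (.const 0)) x) (.or (.eq (varE z (.const 1)) x) (.eq (varE z (.const 2)) x))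

def litFalseE (f : Ex → Ex) (l : Ex) : Ex := .not (.eq (f (.div l (.const 2))) (.mod l (.const 2)))

def falseE (f : Ex → Ex) (z : Ex) : Ex :=
  .and (litFalseE f (litE z 0)) (.and (litFalseE f (litE z 1)) (litFalseE f (litE z 2)))

def markE (q : ℕ) (z : Ex) : Ex := .get 18 (varE z (.const q))

def sharedE (y z : Ex) (q : ℕ) : Ex := .and (.eq (markE q y) (.const 0)) (memE z (varE y (.const q)))

def privateE (y z : Ex) (q : ℕ) : Ex :=
  .and (.eq (markE q y) (.const 0)) (.not (memE z (varE y (.const q))))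

def pairE (y z : Ex) : Ex :=
  .and (falseE (.get 17) y) (.and (falseE (.get 17) z) (.or
    (.and (.eq y z) (.or (.not (.eq (markE 0 y) (.const 0))) (.or (.not (.eq (markE 1 y) (.const 0)))
      (.not (.eq (markE 2 y) (.const 0))))))
    (.and (.or (sharedE y z 0) (.or (sharedE y z 1) (sharedE y z 2)))
      (.or (privateE y z 0) (.or (privateE y z 1) (privateE y z 2))))))

def freshE (z : Ex) : Ex :=
  .and (falseE (.get 17) z) (.and (.eq (markE 0 z) (.const 0)) (.and (.eq (markE 1 z) (.const 0))
    (.eq (markE 2 z) (.const 0))))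

def curE (x : Ex) : Ex :=
  .ite (.and (.not (.lt (.get 18 x) (.const 2))) (.eq (.get 19 (.add (.mul (.const 3)
    (.sub (.get 18 x) (.const 2))) (.get 20 (.sub (.get 18 x) (.const 2))))) x))
    (.sub (.const 1) (.get 17 x)) (.get 17 x)

section
variable {tA sizeA tC sizeC : ℕ} {y : ℕ → ℕ} {S : Store}

local notation "I" => dat tA sizeA tC sizeC S

theorem eval_varE (z q : Ex) : (varE z q).eval y S = Data.v I (z.eval y S) (q.eval y S) := rfl

theorem holds_memE (z x : Ex) : (memE z x).Holds y S ↔ Data.Mem I (z.eval y S) (x.eval y S) := by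
  simp only [memE, Ex.holds_or, Ex.holds_eq]
  rfl

theorem holds_litFalseE {f : Ex → Ex} {g : ℕ → ℕ} (h : ∀ x, (f x).eval y S = g (x.eval y S)) (l : Ex) :
    (litFalseE f l).Holds y S ↔ LitFalse g (l.eval y S) := by
  simp only [litFalseE, Ex.holds_not, Ex.holds_eq, h, Ex.eval_mod]
  rfl

theorem holds_falseE {f : Ex → Ex} {g : ℕ → ℕ} (h : ∀ x, (f x).eval y S = g (x.eval y S)) (z : Ex) :
    (falseE f z).Holds y S ↔ Data.False I g (z.eval y S) := by
  simp only [falseE, Ex.holds_and, holds_litFalseE h]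
  rfl

theorem holds_sharedE (y' z : Ex) (q : ℕ) :
    (sharedE y' z q).Holds y S ↔ Data.Shared I (S 18) (y'.eval y S) (z.eval y S) q := by
  simp only [sharedE, Ex.holds_and, Ex.holds_eq]
  rw [holds_memE (tA := tA) (sizeA := sizeA) (tC := tC) (sizeC := sizeC)]
  rfl

theorem holds_privateE (y' z : Ex) (q : ℕ) :
    (privateE y' z q).Holds y S ↔ Data.Private I (S 18) (y'.eval y S) (z.eval y S) q := by
  simp only [privateE, Ex.holds_and, Ex.holds_eq, Ex.holds_not]
  rw [holds_memE (tA := tA) (sizeA := sizeA) (tC := tC) (sizeC := sizeC)]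
  rfl

theorem holds_pairE (y' z : Ex) :
    (pairE y' z).Holds y S ↔ Data.Pair I (S 17) (S 18) (y'.eval y S) (z.eval y S) := by
  simp only [pairE, Ex.holds_and, Ex.holds_eq, Ex.holds_not, Ex.holds_or]
  simp only [holds_sharedE (tA := tA) (sizeA := sizeA) (tC := tC) (sizeC := sizeC),
    holds_privateE (tA := tA) (sizeA := sizeA) (tC := tC) (sizeC := sizeC),
    holds_falseE (tA := tA) (sizeA := sizeA) (tC := tC) (sizeC := sizeC) (g := S 17)
      (fun x => show (Ex.get 17 x).eval y S = _ from rfl)]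
  rfl

theorem holds_freshE (z : Ex) :
    (freshE z).Holds y S ↔ Data.Fresh I (S 17) (S 18) (z.eval y S) := by
  simp only [freshE, Ex.holds_and, Ex.holds_eq]
  simp only [holds_falseE (tA := tA) (sizeA := sizeA) (tC := tC) (sizeC := sizeC) (g := S 17)
      (fun x => show (Ex.get 17 x).eval y S = _ from rfl)]
  rfl

theorem eval_curE (x : Ex) : (curE x).eval y S = (abs S).cur (x.eval y S) := by
  have : (curE x).eval y S = if (Ex.and (.not (.lt (.get 18 x) (.const 2))) (.eq (.get 19 (.add
      (.mul (.const 3) (.sub (.get 18 x) (.const 2))) (.get 20 (.sub (.get 18 x) (.const 2))))) x)).Holds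
      y S then 1 - S 17 (x.eval y S) else S 17 (x.eval y S) := rfl
  rw [this, St.cur]
  simp only [Ex.holds_and, Ex.holds_not, Ex.holds_lt, Ex.holds_eq, not_lt]
  rfl

end

/-- Flip the variable in the array `t` for good. -/
def fixP (t : ℕ) : Pr :=
  .seqs [.set 17 (.reg t) (.sub (.const 1) (.get 17 (.reg t))), .set 18 (.reg t) (.const 1)]

theorem fixP_abs (y : ℕ → ℕ) {t : ℕ} (ht : 20 < t) (S : Store) :
    abs ((fixP t).den y S) = (abs S).fix (S t 0) := by
  simp only [fixP, Pr.den_seqs_cons, Pr.den_seqs_nil, Pr.den, Ex.eval_reg, Ex.eval]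
  rw [Store.set_ne S _ _ (by omega : t ≠ 17)]
  simp [abs, St.fix, Store.set_eq, Store.set_ne]

theorem fixP_den (y : ℕ → ℕ) (t : ℕ) (S : Store) {l : ℕ} (h1 : l ≠ 17) (h2 : l ≠ 18) :
    (fixP t).den y S l = S l := by
  rw [Pr.den_keeps]
  simp [fixP, Pr.seqs, h1, h2]

/-- Remove the member in the array `31` from the family. -/
def releaseP : Pr :=
  .seqs [.set 18 (.get 19 (.mul (.const 3) (.reg 31))) (.const 0),
    .set 18 (.get 19 (.add (.mul (.const 3) (.reg 31)) (.const 1))) (.const 0),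
    .set 18 (.get 19 (.add (.mul (.const 3) (.reg 31)) (.const 2))) (.const 0),
    .set 20 (.reg 31) (.const 3)]

theorem releaseP_abs (y : ℕ → ℕ) (S : Store) :
    abs (releaseP.den y S) = (abs S).release (S 31 0) := by
  simp [releaseP, abs, St.release, Store.set_eq, Store.set_ne]

theorem releaseP_den (y : ℕ → ℕ) (S : Store) {l : ℕ} (h1 : l ≠ 18) (h2 : l ≠ 20) :
    releaseP.den y S l = S l := by
  rw [Pr.den_keeps]
  simp [releaseP, Pr.seqs, h1, h2]

def deadP : Pr := .put 10 (.const 1)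

theorem deadP_abs (y : ℕ → ℕ) (S : Store) : abs (deadP.den y S) = (abs S).dead := by
  simp [deadP, abs, St.dead, Store.set_ne, Store.set_apply]

def stepInitP (tA sizeA : ℕ) : Pr :=
  .ite (.lt (.reg 15) (.reg 1))
    (.ite (.eq (.mod (.reg 15) (.const tA)) (.const 0))
      (.ite (.lt (.reg 21) (.const sizeA))
        (.seqs [.put 11 (.cap (.add (.reg 11) (.get 4 (.reg 21)))), .put 14 (.reg 21),
          .set 17 (.reg 15) (.get 5 (.add (.mul (.reg 21) (.const tA)) (.mod (.reg 15) (.const tA)))),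
          .put 15 (.cap (.add (.reg 15) (.const 1)))])
        deadP)
      (.ite (.eq (.reg 21) (.const 0))
        (.seqs [.set 17 (.reg 15)
            (.get 5 (.add (.mul (.reg 14) (.const tA)) (.mod (.reg 15) (.const tA)))),
          .put 15 (.cap (.add (.reg 15) (.const 1)))])
        deadP))
    (.ite (.eq (.reg 21) (.const 0)) (.seqs [.put 9 (.const 1), .put 15 (.const 0)]) deadP)

theorem stepInitP_abs (tA sizeA tC sizeC : ℕ) (y : ℕ → ℕ) (S : Store) :
    abs ((stepInitP tA sizeA).den y S) = stepInit (dat tA sizeA tC sizeC S) (S 21 0) (abs S) := by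
  unfold stepInitP stepInit
  simp only [Pr.den_ite]
  refine abs_ite (by simp [abs, dat]) (fun h1 => abs_ite (by simp [abs, dat]) (fun h2 => abs_ite
    (by simp [dat]) (fun h3 => ?_) fun h3 => deadP_abs _ _) fun h2 => abs_ite (by simp) (fun h3 => ?_)
    fun h3 => deadP_abs _ _) fun h1 => abs_ite (by simp) (fun h2 => ?_) fun h2 => deadP_abs _ _
  all_goals simp [abs, dat, Store.set_eq, Store.set_ne, Store.set_apply]

def stepPairP : Pr :=
  .seqs [.first (pairE (.div (.reg 23) (.reg 2)) (.mod (.reg 23) (.reg 2)))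
      (.cap (.mul (.reg 2) (.reg 2))),
    .ite (.lt (.reg 22) (.cap (.mul (.reg 2) (.reg 2))))
      (.seqs [.put 30 (varE (.div (.reg 22) (.reg 2)) (.div (.reg 21) (.const 3))),
        .put 31 (varE (.mod (.reg 22) (.reg 2)) (.mod (.reg 21) (.const 3))),
        .ite (.and (.lt (.reg 21) (.const 9)) (.and (.eq (.get 18 (.reg 30)) (.const 0))
            (.eq (.get 18 (.reg 31)) (.const 0))))
          (.ite (.eq (.reg 30) (.reg 31))
            (.ite (.lt (.const 0) (.reg 11))
              (.seqs [fixP 30, .put 11 (.sub (.reg 11) (.const 1))]) deadP)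
            (.ite (.and (.not (memE (.mod (.reg 22) (.reg 2)) (.reg 30))) (.and
                (.not (memE (.div (.reg 22) (.reg 2)) (.reg 31))) (.lt (.const 1) (.reg 11))))
              (.seqs [fixP 30, fixP 31, .put 11 (.sub (.reg 11) (.const 2))]) deadP))
          deadP])
      (.ite (.eq (.reg 21) (.const 0)) (.put 9 (.const 2)) deadP)]

theorem abs_put_k (S : Store) (v : ℕ) : abs (S.set 11 0 v) = { abs S with k := v } := by
  simp [abs, Store.set_ne, Store.set_apply]

theorem stepPairP_abs (tA sizeA tC sizeC : ℕ) (y : ℕ → ℕ) (S : Store) :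
    abs (stepPairP.den y S) = stepPair (dat tA sizeA tC sizeC S) (S 21 0) (abs S) := by
  obtain ⟨hT, hw⟩ := Pr.first_den (y := y) (S := S)
    (cond := pairE (.div (.reg 23) (.reg 2)) (.mod (.reg 23) (.reg 2)))
    (bound := .cap (.mul (.reg 2) (.reg 2)))
    (P := fun w => Data.Pair (dat tA sizeA tC sizeC S) (S 17) (S 18) (w / S 2 0) (w % S 2 0))
    (fun T hT => by simp [hT]) (fun T z hT hz => by
      rw [holds_pairE (tA := tA) (sizeA := sizeA) (tC := tC) (sizeC := sizeC),
        dat_congr (T := S) _ _ _ _ fun l hl => hT l (by omega) (by omega)]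
      simp [hT, hz])
  unfold stepPairP stepPair
  simp only [Pr.den_seqs_cons, Pr.den_seqs_nil]
  set T := (Pr.first (pairE (.div (.reg 23) (.reg 2)) (.mod (.reg 23) (.reg 2)))
    (.cap (.mul (.reg 2) (.reg 2)))).den y S with hTdef
  have hdat : dat tA sizeA tC sizeC S = dat tA sizeA tC sizeC T :=
    dat_congr _ _ _ _ fun l hl => (hT l (by omega) (by omega)).symm
  have habs : abs S = abs T := abs_congr fun l h1 h2 => (hT l (by omega) (by omega)).symm
  have hw' : first (fun w => (dat tA sizeA tC sizeC S).Pair (abs S).val (abs S).mark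
      (w / (dat tA sizeA tC sizeC S).c) (w % (dat tA sizeA tC sizeC S).c))
      (min ((dat tA sizeA tC sizeC S).c * (dat tA sizeA tC sizeC S).c) (dat tA sizeA tC sizeC S).cap) =
      T 22 0 := hw.symm
  rw [hw', hdat, habs, ← hT 21 (by norm_num) (by norm_num)]
  simp only [Pr.den_ite]
  refine abs_ite (by simp [dat]) (fun h1 => ?_) fun h1 => abs_ite (by simp) (fun h2 => ?_)
    fun h2 => deadP_abs _ _
  swap
  · simp [abs, Store.set_ne, Store.set_apply]
  simp only [Pr.den_seqs_cons, Pr.den_seqs_nil, Pr.den_put]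
  set a := (dat tA sizeA tC sizeC T).v (T 22 0 / (dat tA sizeA tC sizeC T).c) (T 21 0 / 3) with ha
  set b := (dat tA sizeA tC sizeC T).v (T 22 0 % (dat tA sizeA tC sizeC T).c) (T 21 0 % 3) with hb
  have ea : (varE (.div (.reg 22) (.reg 2)) (.div (.reg 21) (.const 3))).eval y T = a := rfl
  have eb : (varE (.mod (.reg 22) (.reg 2)) (.mod (.reg 21) (.const 3))).eval y (T.set 30 0 a) = b := by
    rw [eval_varE (tA := tA) (sizeA := sizeA) (tC := tC) (sizeC := sizeC),
      dat_congr (T := T) _ _ _ _ fun l hl => T.set_ne _ _ (by omega)]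
    simp [Store.set_apply, hb, dat]
  rw [ea, eb]
  set U := (T.set 30 0 a).set 31 0 b with hU
  have hUT : ∀ l < 30, U l = T l := by
    intro l hl
    rw [hU, Store.set_ne _ _ _ (by omega), Store.set_ne _ _ _ (by omega)]
  have hU30 : U 30 0 = a := by simp [hU, Store.set_apply]
  have hU31 : U 31 0 = b := by simp [hU, Store.set_apply]
  have hdat' : dat tA sizeA tC sizeC T = dat tA sizeA tC sizeC U :=
    dat_congr _ _ _ _ fun l hl => (hUT l (by omega)).symm
  have habs' : abs T = abs U := abs_congr fun l h1 h2 => (hUT l (by omega)).symm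
  rw [hdat', habs', ← hUT 21 (by norm_num), ← hUT 22 (by norm_num)]
  clear_value a b U
  simp only [Pr.den_ite]
  refine abs_ite (by simp [abs, hU30, hU31]) (fun h2 => abs_ite (by simp [hU30, hU31])
    (fun h3 => abs_ite (by simp [abs, Nat.succ_le_iff]) (fun h4 => ?_) fun h4 => deadP_abs _ _)
    fun h3 => abs_ite ?_ (fun h4 => ?_) fun h4 => deadP_abs _ _) fun h2 => deadP_abs _ _
  · simp only [Pr.den_seqs_cons, Pr.den_seqs_nil, Pr.den_put, abs_put_k]
    rw [fixP_abs _ (by norm_num), hU30]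
    simp [abs, fixP_den]
  · simp only [Ex.holds_and, Ex.holds_not, Ex.holds_lt,
      holds_memE (tA := tA) (sizeA := sizeA) (tC := tC) (sizeC := sizeC)]
    simp only [Ex.eval_mod, Ex.eval_reg, hU30, hU31, Ex.eval]
    rfl
  · simp only [Pr.den_seqs_cons, Pr.den_seqs_nil, Pr.den_put, abs_put_k]
    rw [fixP_abs _ (by norm_num), fixP_abs _ (by norm_num), fixP_den _ _ _ (by norm_num) (by norm_num),
      hU30, hU31]
    simp [abs, fixP_den]

def stepFamilyP : Pr :=
  .seqs [.first (freshE (.reg 23)) (.reg 2),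
    .ite (.lt (.reg 22) (.reg 2))
      (.ite (.and (.eq (.reg 21) (.const 0)) (.lt (.const 0) (.reg 11)))
        (.seqs [.put 11 (.sub (.reg 11) (.const 1)), .put 30 (varE (.reg 22) (.const 0)),
          .put 31 (varE (.reg 22) (.const 1)), .put 32 (varE (.reg 22) (.const 2)),
          .put 33 (.cap (.add (.reg 16) (.const 2))),
          .set 19 (.mul (.const 3) (.reg 16)) (.reg 30),
          .set 19 (.add (.mul (.const 3) (.reg 16)) (.const 1)) (.reg 31),
          .set 19 (.add (.mul (.const 3) (.reg 16)) (.const 2)) (.reg 32),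
          .set 18 (.reg 30) (.reg 33), .set 18 (.reg 31) (.reg 33), .set 18 (.reg 32) (.reg 33),
          .put 16 (.cap (.add (.reg 16) (.const 1)))])
        deadP)
      (.ite (.eq (.reg 21) (.const 0)) (.seqs [.put 9 (.const 3), .put 15 (.const 0)]) deadP)]

theorem stepFamilyP_abs (tA sizeA tC sizeC : ℕ) (y : ℕ → ℕ) (S : Store) :
    abs (stepFamilyP.den y S) = stepFamily (dat tA sizeA tC sizeC S) (S 21 0) (abs S) := by
  obtain ⟨hT, hw⟩ := Pr.first_den (y := y) (S := S) (cond := freshE (.reg 23)) (bound := .reg 2)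
    (P := Data.Fresh (dat tA sizeA tC sizeC S) (S 17) (S 18))
    (fun T hT => by simp [hT]) (fun T z hT hz => by
      rw [holds_freshE (tA := tA) (sizeA := sizeA) (tC := tC) (sizeC := sizeC),
        dat_congr (T := S) _ _ _ _ fun l hl => hT l (by omega) (by omega)]
      simp [hT, hz])
  unfold stepFamilyP stepFamily
  simp only [Pr.den_seqs_cons, Pr.den_seqs_nil]
  set T := (Pr.first (freshE (.reg 23)) (.reg 2)).den y S with hTdef
  have hdat : dat tA sizeA tC sizeC S = dat tA sizeA tC sizeC T :=
    dat_congr _ _ _ _ fun l hl => (hT l (by omega) (by omega)).symm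
  have habs : abs S = abs T := abs_congr fun l h1 h2 => (hT l (by omega) (by omega)).symm
  have hw' : first ((dat tA sizeA tC sizeC S).Fresh (abs S).val (abs S).mark)
      (dat tA sizeA tC sizeC S).c = T 22 0 := hw.symm
  rw [hw', hdat, habs, ← hT 21 (by norm_num) (by norm_num)]
  clear_value T
  simp only [Pr.den_ite]
  refine abs_ite (by simp [dat]) (fun h1 => abs_ite (by simp [abs, Nat.succ_le_iff]) (fun h2 => ?_)
    fun h2 => deadP_abs _ _) fun h1 => abs_ite (by simp) (fun h2 => ?_) fun h2 => deadP_abs _ _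
  · simp [abs, dat, Data.v, varE, Store.set_eq, Store.set_ne, Store.set_apply]
  · simp [abs, Store.set_ne, Store.set_apply]

def stepCodeP (tC sizeC : ℕ) : Pr :=
  .ite (.lt (.reg 15) (.reg 16))
    (.ite (.eq (.mod (.reg 15) (.const tC)) (.const 0))
      (.ite (.lt (.reg 21) (.const sizeC))
        (.seqs [.put 12 (.cap (.add (.reg 12) (.get 6 (.reg 21)))),
          .put 13 (.cap (.add (.reg 13) (.get 7 (.reg 21)))), .put 14 (.reg 21),
          .set 20 (.reg 15) (.get 8 (.add (.mul (.reg 21) (.const tC)) (.mod (.reg 15) (.const tC)))),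
          .put 15 (.cap (.add (.reg 15) (.const 1)))])
        deadP)
      (.ite (.eq (.reg 21) (.const 0))
        (.seqs [.set 20 (.reg 15)
            (.get 8 (.add (.mul (.reg 14) (.const tC)) (.mod (.reg 15) (.const tC)))),
          .put 15 (.cap (.add (.reg 15) (.const 1)))])
        deadP))
    (.ite (.eq (.reg 21) (.const 0)) (.put 9 (.const 4)) deadP)

theorem stepCodeP_abs (tA sizeA tC sizeC : ℕ) (y : ℕ → ℕ) (S : Store) :
    abs ((stepCodeP tC sizeC).den y S) = stepCode (dat tA sizeA tC sizeC S) (S 21 0) (abs S) := by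
  unfold stepCodeP stepCode
  simp only [Pr.den_ite]
  refine abs_ite (by simp [abs]) (fun h1 => abs_ite (by simp [abs, dat]) (fun h2 => abs_ite
    (by simp [dat]) (fun h3 => ?_) fun h3 => deadP_abs _ _) fun h2 => abs_ite (by simp) (fun h3 => ?_)
    fun h3 => deadP_abs _ _) fun h1 => abs_ite (by simp) (fun h2 => ?_) fun h2 => deadP_abs _ _
  all_goals simp [abs, dat, Store.set_eq, Store.set_ne, Store.set_apply]

def stepSearchP : Pr :=
  .seqs [.first (falseE curE (.reg 23)) (.reg 2),
    .ite (.lt (.reg 22) (.reg 2))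
      (.ite (.lt (.reg 21) (.const 6))
        (.seqs [.put 30 (varE (.reg 22) (.div (.reg 21) (.const 2))),
          .ite (.eq (.get 18 (.reg 30)) (.const 0))
            (.ite (.and (.eq (.mod (.reg 21) (.const 2)) (.const 0)) (.lt (.const 0) (.reg 11)))
              (.seqs [fixP 30, .put 11 (.sub (.reg 11) (.const 1))]) deadP)
            (.ite (.eq (.get 18 (.reg 30)) (.const 1)) deadP
              (.seqs [.put 31 (.sub (.get 18 (.reg 30)) (.const 2)),
                .put 32 (.get 19 (.add (.mul (.const 3) (.reg 31)) (.get 20 (.reg 31)))),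
                .ite (.eq (.reg 32) (.reg 30))
                  (.ite (.lt (.const 0) (.reg 12))
                    (.seqs [.put 33 (.get 19 (.add (.mul (.const 3) (.reg 31)) (.mod (.add (.add
                        (.get 20 (.reg 31)) (.const 1)) (.mod (.reg 21) (.const 2))) (.const 3)))),
                      releaseP, fixP 33, .put 12 (.sub (.reg 12) (.const 1))])
                    deadP)
                  (.ite (.eq (.mod (.reg 21) (.const 2)) (.const 0))
                    (.ite (.lt (.const 0) (.reg 12))
                      (.seqs [releaseP, fixP 30, .put 12 (.sub (.reg 12) (.const 1))]) deadP)
                    (.ite (.and (.lt (.const 0) (.reg 11)) (.lt (.const 0) (.reg 13)))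
                      (.seqs [releaseP, fixP 30, fixP 32, .put 11 (.sub (.reg 11) (.const 1)),
                        .put 13 (.sub (.reg 13) (.const 1))])
                      deadP))]))])
        deadP)
      (.ite (.eq (.reg 21) (.const 0)) (.put 10 (.const 2)) deadP)]

theorem abs_put_s (S : Store) (v : ℕ) : abs (S.set 12 0 v) = { abs S with s := v } := by
  simp [abs, Store.set_ne, Store.set_apply]

theorem abs_put_j (S : Store) (v : ℕ) : abs (S.set 13 0 v) = { abs S with j := v } := by
  simp [abs, Store.set_ne, Store.set_apply]

theorem abs_put_temp (S : Store) {l : ℕ} (hl : 20 < l) (v : ℕ) : abs (S.set l 0 v) = abs S :=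
  abs_congr fun k _ h2 => S.set_ne _ _ (by omega)

theorem stepSearchP_abs (tA sizeA tC sizeC : ℕ) (y : ℕ → ℕ) (S : Store) :
    abs (stepSearchP.den y S) = stepSearch (dat tA sizeA tC sizeC S) (S 21 0) (abs S) := by
  obtain ⟨hT, hw⟩ := Pr.first_den (y := y) (S := S) (cond := falseE curE (.reg 23)) (bound := .reg 2)
    (P := Data.False (dat tA sizeA tC sizeC S) (abs S).cur)
    (fun T hT => by simp [hT]) (fun T z hT hz => by
      rw [holds_falseE (tA := tA) (sizeA := sizeA) (tC := tC) (sizeC := sizeC) eval_curE,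
        dat_congr (T := S) _ _ _ _ fun l hl => hT l (by omega) (by omega),
        abs_congr (T := S) fun l h1 h2 => hT l (by omega) (by omega)]
      simp [hz])
  unfold stepSearchP stepSearch
  simp only [Pr.den_seqs_cons, Pr.den_seqs_nil]
  set T := (Pr.first (falseE curE (.reg 23)) (.reg 2)).den y S with hTdef
  have hdat : dat tA sizeA tC sizeC S = dat tA sizeA tC sizeC T :=
    dat_congr _ _ _ _ fun l hl => (hT l (by omega) (by omega)).symm
  have habs : abs S = abs T := abs_congr fun l h1 h2 => (hT l (by omega) (by omega)).symm
  have hw' : first ((dat tA sizeA tC sizeC S).False (abs S).cur) (dat tA sizeA tC sizeC S).c = T 22 0 :=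
    hw.symm
  rw [hw', hdat, habs, ← hT 21 (by norm_num) (by norm_num)]
  clear_value T
  simp only [Pr.den_ite]
  refine abs_ite (by simp [dat]) (fun h1 => abs_ite (by simp) (fun h2 => ?_)
    fun h2 => deadP_abs _ _) fun h1 => abs_ite (by simp) (fun h2 => ?_) fun h2 => deadP_abs _ _
  swap
  · simp [abs, Store.set_ne, Store.set_apply]
  simp only [Pr.den_seqs_cons, Pr.den_seqs_nil, Pr.den_put]
  set x := (dat tA sizeA tC sizeC T).v (T 22 0) (T 21 0 / 2) with hx
  have ex : (varE (.reg 22) (.div (.reg 21) (.const 2))).eval y T = x := rfl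
  rw [ex]
  set U := T.set 30 0 x with hU
  have habs' : abs T = abs U := (abs_put_temp _ (by norm_num) _).symm
  have hU30 : U 30 0 = x := by simp [hU, Store.set_apply]
  have hU21 : U 21 0 = T 21 0 := by simp [hU, Store.set_apply]
  rw [habs', ← hU21]
  clear_value x U
  simp only [Pr.den_ite]
  refine abs_ite (by simp [abs, hU30]) (fun h3 => abs_ite (by simp [abs, Nat.succ_le_iff])
    (fun h4 => ?_) fun h4 => deadP_abs _ _) fun h3 => abs_ite (by simp [abs, hU30])
    (fun h4 => deadP_abs _ _) fun h4 => ?_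
  · simp only [Pr.den_seqs_cons, Pr.den_seqs_nil, Pr.den_put, abs_put_k]
    rw [fixP_abs _ (by norm_num), hU30]
    simp [abs, fixP_den]
  simp only [Pr.den_seqs_cons, Pr.den_seqs_nil, Pr.den_put]
  set o := (abs U).mark x - 2 with ho
  have eo : (Ex.sub (.get 18 (.reg 30)) (.const 2)).eval y U = o := by
    simp [ho, abs, hU30]
  rw [eo]
  set w := (abs U).tv (3 * o + (abs U).rp o) with hw
  have ew : (Ex.get 19 (.add (.mul (.const 3) (.reg 31)) (.get 20 (.reg 31)))).eval y (U.set 31 0 o) =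
      w := by
    simp [hw, abs, Store.set_apply]
  rw [ew]
  set W := (U.set 31 0 o).set 32 0 w with hW
  have habs'' : abs U = abs W := by
    rw [hW, abs_put_temp _ (by norm_num), abs_put_temp _ (by norm_num)]
  have hW30 : W 30 0 = x := by simp [hW, Store.set_apply, hU30]
  have hW31 : W 31 0 = o := by simp [hW, Store.set_apply]
  have hW32 : W 32 0 = w := by simp [hW, Store.set_apply]
  have hW21 : W 21 0 = U 21 0 := by simp [hW, Store.set_apply]
  rw [habs'', ← hW21]
  clear_value w W o
  simp only [Pr.den_ite]
  refine abs_ite (by simp [hW30, hW32]) (fun h5 => abs_ite (by simp [abs, Nat.succ_le_iff])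
    (fun h6 => ?_) fun h6 => deadP_abs _ _) fun h5 => abs_ite (by simp) (fun h6 => abs_ite
    (by simp [abs, Nat.succ_le_iff]) (fun h7 => ?_) fun h7 => deadP_abs _ _) fun h6 => abs_ite
    (by simp [abs, Nat.succ_le_iff]) (fun h7 => ?_) fun h7 => deadP_abs _ _
  · simp only [Pr.den_seqs_cons, Pr.den_seqs_nil, Pr.den_put, abs_put_s]
    rw [fixP_abs _ (by norm_num), releaseP_abs, releaseP_den _ _ (by norm_num) (by norm_num),
      abs_put_temp _ (by norm_num)]
    simp [abs, fixP_den, releaseP_den, Store.set_apply, hW31]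
  · simp only [Pr.den_seqs_cons, Pr.den_seqs_nil, Pr.den_put, abs_put_s]
    rw [fixP_abs _ (by norm_num), releaseP_abs, releaseP_den _ _ (by norm_num) (by norm_num), hW30, hW31]
    simp [abs, fixP_den, releaseP_den]
  · simp only [Pr.den_seqs_cons, Pr.den_seqs_nil, Pr.den_put, abs_put_k, abs_put_j]
    rw [fixP_abs _ (by norm_num), fixP_abs _ (by norm_num), fixP_den _ _ _ (by norm_num) (by norm_num),
      releaseP_abs, releaseP_den _ _ (by norm_num) (by norm_num),
      releaseP_den _ _ (by norm_num) (by norm_num), hW30, hW31, hW32]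
    simp [abs, fixP_den, releaseP_den, Store.set_apply]

/-- The program for a step of the search. -/
def stepP (tA sizeA tC sizeC : ℕ) : Pr :=
  .ite (.eq (.reg 9) (.const 0)) (stepInitP tA sizeA)
    (.ite (.eq (.reg 9) (.const 1)) stepPairP
      (.ite (.eq (.reg 9) (.const 2)) stepFamilyP
        (.ite (.eq (.reg 9) (.const 3)) (stepCodeP tC sizeC) stepSearchP)))

theorem stepP_abs (tA sizeA tC sizeC : ℕ) (y : ℕ → ℕ) (S : Store) :
    abs ((stepP tA sizeA tC sizeC).den y S) = step (dat tA sizeA tC sizeC S) (S 21 0) (abs S) := by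
  unfold stepP step
  simp only [Pr.den_ite]
  exact abs_ite (by simp [abs]) (fun _ => stepInitP_abs _ _ _ _ _ _) fun _ =>
    abs_ite (by simp [abs]) (fun _ => stepPairP_abs _ _ _ _ _ _) fun _ =>
    abs_ite (by simp [abs]) (fun _ => stepFamilyP_abs _ _ _ _ _ _) fun _ =>
    abs_ite (by simp [abs]) (fun _ => stepCodeP_abs _ _ _ _ _ _) fun _ => stepSearchP_abs _ _ _ _ _ _

/-- Left alone are the data, the current choice, the registers of the depth-first search, and the
arrays from which a state is rebuilt. -/
theorem stepP_keeps (tA sizeA tC sizeC : ℕ) {l : ℕ} (hl : l ≤ 8 ∨ l = 21 ∨ l = 24 ∨ 33 < l ∨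
    (25 ≤ l ∧ l ≤ 29)) : (stepP tA sizeA tC sizeC).Keeps l := by
  simp only [stepP, stepInitP, stepPairP, stepFamilyP, stepCodeP, stepSearchP, Pr.Keeps, Pr.seqs,
    Pr.put, Pr.first, deadP, fixP, releaseP, and_true]
  omega

theorem stepP_ok (tA sizeA tC sizeC : ℕ) {V : ℕ} (hV : 4 ≤ V) : (stepP tA sizeA tC sizeC).Ok 48 V := by
  simp [stepP, stepInitP, stepPairP, stepFamilyP, stepCodeP, stepSearchP, Pr.seqs,
    Pr.put, Pr.first, deadP, fixP, releaseP, Ex.reg, Ex.and, Ex.or, Ex.not, Ex.mod, varE, pairE, falseE,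
    memE, sharedE, privateE, litFalseE, markE, litE, freshE, curE]
  omega

end Search


/-! ### Bounds for values and indices, and copying of arrays -/

namespace HL

theorem loopDown_le {f : Store → Store} {V k : ℕ}
    (hf : ∀ S : Store, (∀ k i, S k i ≤ V) → ∀ k i, f S k i ≤ V) :
    ∀ N (S : Store), N ≤ V → (∀ k i, S k i ≤ V) → ∀ l i, loopDown f k N S l i ≤ V
  | 0, _, _, hS => Store.set_le hS (Nat.zero_le _) _ _
  | N + 1, _, hN, hS => loopDown_le hf N _ (by omega) (hf _ (Store.set_le hS (by omega) _ _))

/-- Well-formed programs do not exceed the bound. -/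
theorem Pr.den_le {K V : ℕ} {y : ℕ → ℕ} (hV : 1 ≤ V) (hy : ∀ i, y i ≤ V) : ∀ p : Pr, p.Ok K V →
    ∀ S : Store, (∀ k i, S k i ≤ V) → ∀ k i, p.den y S k i ≤ V
  | .skip, _, _, hS => hS
  | .set k i e, h, S, hS => Store.set_le hS (e.eval_le hV hy hS h.2.2.2) _ _
  | .seq p q, h, S, hS => den_le hV hy q h.2 _ (den_le hV hy p h.1 S hS)
  | .ite e p q, h, S, hS => by
    simp only [Pr.den]; split
    exacts [den_le hV hy p h.2.1 S hS, den_le hV hy q h.2.2 S hS]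
  | .loop k e p, h, S, hS =>
    loopDown_le (den_le hV hy p h.2.2.2.2) _ _ (e.eval_le hV hy hS h.2.2.1) hS

/-- The program writes to indices below `G` only. -/
@[simp] def Pr.Within (y : ℕ → ℕ) (V G : ℕ) : Pr → Prop
  | .skip => True
  | .set _ i _ => ∀ S : Store, (∀ k i, S k i ≤ V) → S 0 0 = V → i.eval y S < G
  | .seq p q => p.Within y V G ∧ q.Within y V G
  | .ite _ p q => p.Within y V G ∧ q.Within y V G
  | .loop _ _ p => p.Within y V G

theorem loopDown_within {f : Store → Store} {V G k : ℕ} (hG : 0 < G) (hk : k ≠ 0)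
    (hf : ∀ S : Store, (∀ k i, S k i ≤ V) → S 0 0 = V → (∀ k i, f S k i ≤ V) ∧ f S 0 0 = V ∧
      ∀ k i, G ≤ i → f S k i = S k i) :
    ∀ N (S : Store), N ≤ V → (∀ k i, S k i ≤ V) → S 0 0 = V →
      ∀ l i, G ≤ i → loopDown f k N S l i = S l i
  | 0, S, _, _, _ => fun l i hi => by
    rw [loopDown, Store.set_apply, if_neg]
    omega
  | N + 1, S, hN, hS, h0 => fun l i hi => by
    obtain ⟨h1, h2, h3⟩ := hf (S.set k 0 N) (Store.set_le hS (by omega) _ _)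
      (by rw [Store.set_ne _ _ _ hk.symm, h0])
    rw [loopDown, loopDown_within hG hk hf N _ (by omega) h1 h2 l i hi, h3 l i hi, Store.set_apply,
      if_neg]
    omega

theorem Pr.den_within {K V G : ℕ} {y : ℕ → ℕ} (hV : 1 ≤ V) (hG : 0 < G) (hy : ∀ i, y i ≤ V) :
    ∀ p : Pr, p.Ok K V → p.Keeps 0 → p.Within y V G → ∀ S : Store, (∀ k i, S k i ≤ V) → S 0 0 = V →
      ∀ k i, G ≤ i → p.den y S k i = S k i
  | .skip, _, _, _, _, _, _ => fun _ _ _ => rfl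
  | .set k j e, _, _, hw, S, hS, h0 => fun l i hi => by
    have := hw S hS h0
    rw [Pr.den, Store.set_apply, if_neg]
    omega
  | .seq p q, h, hk, hw, S, hS, h0 => fun l i hi => by
    rw [Pr.den, den_within hV hG hy q h.2 hk.2 hw.2 _ (den_le hV hy p h.1 S hS)
      (by rw [den_keeps p hk.1, h0]) l i hi, den_within hV hG hy p h.1 hk.1 hw.1 S hS h0 l i hi]
  | .ite e p q, h, hk, hw, S, hS, h0 => by
    simp only [Pr.den]; split
    exacts [den_within hV hG hy p h.2.1 hk.1 hw.1 S hS h0,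
      den_within hV hG hy q h.2.2 hk.2 hw.2 S hS h0]
  | .loop k e p, h, hk, hw, S, hS, h0 =>
    loopDown_within hG hk.1.symm (fun T hT hT0 => ⟨den_le hV hy p h.2.2.2.2 T hT,
      by rw [den_keeps p hk.2, hT0], den_within hV hG hy p h.2.2.2.2 hk.2 hw T hT hT0⟩) _ _
      (e.eval_le hV hy hS h.2.2.1) hS h0

/-- Inside the loop the counter is below `cap` and the remainder changes nothing. It is there
because `Pr.Within` asks for small indices in every bounded store, where the counter could equal
`cap`. -/
def Pr.copyIdx (q : ℕ) : Ex := .add (.mul (.const q) (.reg 0)) (.mod (.reg 35) (.reg 0))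

/-- Copy the cells with indices below `4 * cap` of the array `src` to `dst`. -/
def Pr.copy (dst src : ℕ) : Pr :=
  .loop 35 (.reg 0) (.seqs [.set dst (Pr.copyIdx 0) (.get src (Pr.copyIdx 0)),
    .set dst (Pr.copyIdx 1) (.get src (Pr.copyIdx 1)), .set dst (Pr.copyIdx 2) (.get src (Pr.copyIdx 2)),
    .set dst (Pr.copyIdx 3) (.get src (Pr.copyIdx 3))])

/-- Round `i` copies the four cells below `4 * cap` that are congruent to `i` modulo `cap`. The
invariant is that all residues from the counter on are done; the cells beyond agree by hypothesis,
so the arrays become equal as functions. -/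
theorem Pr.copy_den (y : ℕ → ℕ) {dst src : ℕ} (h1 : dst ≠ src) (h2 : dst ≠ 35) (h3 : src ≠ 35)
    (h0 : dst ≠ 0) {S : Store} (hd : ∀ i, 4 * S 0 0 ≤ i → S dst i = S src i) :
    (∀ l, l ≠ dst → l ≠ 35 → (Pr.copy dst src).den y S l = S l) ∧
      (Pr.copy dst src).den y S dst = S src := by
  have hkeep : ∀ l, l ≠ dst → l ≠ 35 → (Pr.copy dst src).den y S l = S l := by
    intro l hl hl'
    rw [Pr.den_keeps]
    simp [Pr.copy, Pr.seqs, hl, hl']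
  refine ⟨hkeep, ?_⟩
  set V := S 0 0 with hV
  have := loopDown_induction (f := (Pr.seqs [.set dst (Pr.copyIdx 0) (.get src (Pr.copyIdx 0)),
    .set dst (Pr.copyIdx 1) (.get src (Pr.copyIdx 1)), .set dst (Pr.copyIdx 2) (.get src (Pr.copyIdx 2)),
    .set dst (Pr.copyIdx 3) (.get src (Pr.copyIdx 3))]).den y) (k := 35)
    (fun i T => T 0 0 = V ∧ (∀ x, T src x = S src x) ∧
      ∀ x, (4 * V ≤ x ∨ i ≤ x % V) → T dst x = S src x) ?_ ?_ V S
      ⟨hV.symm, fun _ => rfl, fun x hx => ?_⟩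
  · funext x
    have e : (Pr.copy dst src).den y S dst x = _ := this.2.2 x (.inr (Nat.zero_le _))
    exact e
  · rintro i T ⟨t0, ts, td⟩
    simp only [Pr.den_seqs_cons, Pr.den_seqs_nil, Pr.den, Pr.copyIdx, Ex.eval, Ex.eval_reg, Ex.eval_mod,
      Store.set_apply, h1.symm, h2, h2.symm, h3, h0.symm, t0, ts, if_true, if_false, false_and, true_and,
      and_true, and_self, (by norm_num : (0 : ℕ) ≠ 35)]
    refine ⟨fun _ => trivial, ?_⟩
    intro x hx
    split_ifs with c1 c2 c3 c4 <;> try simp [*]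
    apply td
    rcases hx with hx | hx
    · exact .inl hx
    · by_cases hx4 : 4 * V ≤ x
      · exact .inl hx4
      right
      rcases hx.eq_or_lt with he | he
      · exfalso
        have hdiv := Nat.div_add_mod x V
        have : x / V < 4 := by
          rw [Nat.div_lt_iff_lt_mul]
          · omega
          · rcases Nat.eq_zero_or_pos V with hz | hz
            · rw [hz] at hx4; omega
            · exact hz
        have hV0 : 0 < V := by omega
        have hi : i % V = i := Nat.mod_eq_of_lt (by rw [he]; exact Nat.mod_lt _ hV0)
        rw [hi] at c1 c2 c3 c4
        rw [← he] at hdiv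
        set q := x / V
        interval_cases q <;> omega
      · exact he
  · rintro T ⟨t0, ts, td⟩
    refine ⟨?_, ?_, ?_⟩
    · rw [Store.set_ne _ _ _ (by norm_num), t0]
    · intro x; rw [Store.set_ne _ _ _ h3, ts]
    · intro x hx; rw [Store.set_ne _ _ _ h2, td x hx]
  · rcases hx with hx | hx
    · exact hd x hx
    · rcases Nat.eq_zero_or_pos V with hz | hz
      · exact hd x (by omega)
      · have := Nat.mod_lt x hz
        omega

end HL

/-! ### Rebuilding a node from its path, and the depth-first search as a program -/

namespace Search

open HL

/-- Initialize the state of the search: the initial values are in the array `34`, the initial budget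
and phase in the arrays `36` and `37`, and the array `38` is zero. -/
def resetP : Pr :=
  .seqs [.copy 17 34, .copy 18 38, .copy 19 38, .copy 20 38, .set 18 (.reg 1) (.const 1),
    .put 9 (.reg 37), .put 10 (.const 0), .put 11 (.reg 36), .put 12 (.const 0), .put 13 (.const 0),
    .put 14 (.const 0), .put 15 (.const 0), .put 16 (.const 0)]

/-- The initial state of the search. -/
def root (S : Store) : St where
  ph := S 37 0
  st := 0
  k := S 36 0
  s := 0
  j := 0
  g := 0
  i := 0
  m := 0
  val := S 34
  mark := Function.update 0 (S 1 0) 1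
  tv := 0
  rp := 0

theorem resetP_keeps {l : ℕ} (hl : l ≤ 8 ∨ (20 < l ∧ l ≠ 35)) : resetP.Keeps l := by
  simp only [resetP, Pr.copy, Pr.Keeps, Pr.seqs, Pr.put, and_true]
  omega

theorem resetP_abs (y : ℕ → ℕ) {S : Store} (hz : ∀ k i, 4 * S 0 0 ≤ i → S k i = 0) (h38 : S 38 = 0) :
    abs (resetP.den y S) = root S := by
  simp only [resetP, Pr.den_seqs_cons, Pr.den_seqs_nil]
  obtain ⟨a1, a2⟩ := Pr.copy_den y (dst := 17) (src := 34) (by norm_num) (by norm_num) (by norm_num)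
    (by norm_num) (S := S) fun i hi => by rw [hz _ i hi, hz _ i hi]
  set T1 := (Pr.copy 17 34).den y S
  have c1 : T1 38 = 0 := by rw [a1 _ (by norm_num) (by norm_num), h38]
  have c2 : T1 0 0 = S 0 0 := by rw [a1 _ (by norm_num) (by norm_num)]
  obtain ⟨b1, b2⟩ := Pr.copy_den y (dst := 18) (src := 38) (by norm_num) (by norm_num) (by norm_num)
    (by norm_num) (S := T1) fun i hi => by
      rw [c1, a1 18 (by norm_num) (by norm_num), hz _ i (by omega)]; rfl
  set T2 := (Pr.copy 18 38).den y T1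
  have d1 : T2 38 = 0 := by rw [b1 _ (by norm_num) (by norm_num), c1]
  have d2 : T2 0 0 = S 0 0 := by rw [b1 _ (by norm_num) (by norm_num), c2]
  obtain ⟨e1, e2⟩ := Pr.copy_den y (dst := 19) (src := 38) (by norm_num) (by norm_num) (by norm_num)
    (by norm_num) (S := T2) fun i hi => by
      rw [d1, b1 19 (by norm_num) (by norm_num), a1 19 (by norm_num) (by norm_num), hz _ i (by omega)]; rfl
  set T3 := (Pr.copy 19 38).den y T2
  have f1 : T3 38 = 0 := by rw [e1 _ (by norm_num) (by norm_num), d1]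
  have f2 : T3 0 0 = S 0 0 := by rw [e1 _ (by norm_num) (by norm_num), d2]
  obtain ⟨g1, g2⟩ := Pr.copy_den y (dst := 20) (src := 38) (by norm_num) (by norm_num) (by norm_num)
    (by norm_num) (S := T3) fun i hi => by
      rw [f1, e1 20 (by norm_num) (by norm_num), b1 20 (by norm_num) (by norm_num),
        a1 20 (by norm_num) (by norm_num), hz _ i (by omega)]; rfl
  set T4 := (Pr.copy 20 38).den y T3
  have hkeep : ∀ l, (l < 17 ∨ 20 < l) → l ≠ 35 → T4 l = S l := by
    intro l h1 h2
    rw [g1 l (by omega) h2, e1 l (by omega) h2, b1 l (by omega) h2, a1 l (by omega) h2]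
  have k17 : T4 17 = S 34 := by
    rw [g1 17 (by norm_num) (by norm_num), e1 17 (by norm_num) (by norm_num),
      b1 17 (by norm_num) (by norm_num), a2]
  have k18 : T4 18 = 0 := by
    rw [g1 18 (by norm_num) (by norm_num), e1 18 (by norm_num) (by norm_num), b2, c1]
  have k19 : T4 19 = 0 := by
    rw [g1 19 (by norm_num) (by norm_num), e2, d1]
  have k20 : T4 20 = 0 := by rw [g2, f1]
  clear_value T4
  simp [abs, root, Store.set_eq, Store.set_ne, Store.set_apply, k17, k18, k19, k20,
    hkeep 1, hkeep 36, hkeep 37]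

/-- Compute the node of the search tree that is given by the path. -/
def nodeP (tA sizeA tC sizeC : ℕ) : Pr :=
  -- Starting again from the root spares any undoing of steps and costs only a polynomial factor.
  -- The counter runs downwards, hence the index `len - 1 - counter` of the choice.
  .seqs [resetP, .loop 24 (.reg 26) (.seqs [.put 21 (.get 25 (.sub (.sub (.reg 26) (.const 1)) (.reg 24))),
    stepP tA sizeA tC sizeC])]

theorem nodeP_keeps (tA sizeA tC sizeC : ℕ) {l : ℕ} (hl : l ≤ 8 ∨ 35 < l ∨ l = 34 ∨
    (25 ≤ l ∧ l ≤ 29)) : (nodeP tA sizeA tC sizeC).Keeps l := by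
  have h1 := resetP_keeps (l := l) (by omega)
  have h2 := stepP_keeps tA sizeA tC sizeC (l := l) (by omega)
  simp only [nodeP, Pr.Keeps, Pr.seqs, Pr.put, and_true, h1, h2, true_and]
  omega

theorem nodeP_abs (tA sizeA tC sizeC : ℕ) (y : ℕ → ℕ) {S : Store}
    (hz : ∀ k i, 4 * S 0 0 ≤ i → S k i = 0) (h38 : S 38 = 0) :
    abs ((nodeP tA sizeA tC sizeC).den y S) =
      DFS.node (root S) (step (dat tA sizeA tC sizeC S)) (S 25) (S 26 0) := by
  simp only [nodeP, Pr.den_seqs_cons, Pr.den_seqs_nil]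
  have hreset : ∀ l, (l ≤ 8 ∨ (20 < l ∧ l ≠ 35)) → resetP.den y S l = S l :=
    fun l hl => Pr.den_keeps _ (resetP_keeps hl) S
  have key : ∀ N (T : Store), N ≤ S 26 0 → (∀ l, (l ≤ 8 ∨ l = 25 ∨ l = 26) → T l = S l) →
      abs T = DFS.node (root S) (step (dat tA sizeA tC sizeC S)) (S 25) (S 26 0 - N) →
      abs (loopDown ((Pr.seqs [.put 21 (.get 25 (.sub (.sub (.reg 26) (.const 1)) (.reg 24))),
        stepP tA sizeA tC sizeC]).den y) 24 N T) =
      DFS.node (root S) (step (dat tA sizeA tC sizeC S)) (S 25) (S 26 0) := by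
    intro N
    induction N with
    | zero =>
      intro T _ _ h
      rw [loopDown, abs_put_temp _ (by norm_num), h, Nat.sub_zero]
    | succ N ih =>
      intro T hN hT h
      have h1 : (Ex.get 25 (.sub (.sub (.reg 26) (.const 1)) (.reg 24))).eval y (T.set 24 0 N) =
          S 25 (S 26 0 - (N + 1)) := by
        simp [Store.set_apply, hT 25, hT 26]
        congr 1; omega
      rw [loopDown]
      simp only [Pr.den_seqs_cons, Pr.den_seqs_nil, Pr.den_put, h1]
      apply ih
      · omega
      · intro l hl
        rw [Pr.den_keeps _ (stepP_keeps _ _ _ _ (by omega)), Store.set_ne _ _ _ (by omega),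
          Store.set_ne _ _ _ (by omega), hT l hl]
      · rw [stepP_abs, abs_put_temp _ (by norm_num), abs_put_temp _ (by norm_num), h,
          dat_congr (T := S)]
        · rw [show S 26 0 - N = S 26 0 - (N + 1) + 1 by omega, DFS.node]
          simp [Store.set_apply]
        · intro l hl
          rw [Store.set_ne _ _ _ (by omega), Store.set_ne _ _ _ (by omega), hT l (by omega)]
  have hlen : (Ex.reg 26).eval y (resetP.den y S) = S 26 0 := by
    rw [Ex.eval_reg, hreset 26 (by norm_num)]
  rw [Pr.den, hlen]
  apply key _ _ le_rfl
  · intro l hl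
    exact hreset l (by omega)
  · rw [resetP_abs y hz h38, Nat.sub_self]
    rfl

/-- A step of the depth-first search. -/
def iterP (N tA sizeA tC sizeC : ℕ) : Pr :=
  .ite (.eq (.reg 27) (.const 0))
    (.seqs [nodeP tA sizeA tC sizeC,
      .ite (.eq (.reg 10) (.const 0))
        (.seqs [.set 25 (.reg 26) (.const 0), .put 26 (.cap (.add (.reg 26) (.const 1)))])
        (.ite (.eq (.reg 10) (.const 2)) (.seqs [.put 29 (.const 1), .put 28 (.const 0)])
          (.put 27 (.const 1)))])
    (.ite (.eq (.reg 26) (.const 0)) (.put 28 (.const 0))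
      (.ite (.lt (.add (.get 25 (.sub (.reg 26) (.const 1))) (.const 1)) (.const N))
        (.seqs [.set 25 (.sub (.reg 26) (.const 1))
            (.cap (.add (.get 25 (.sub (.reg 26) (.const 1))) (.const 1))),
          .put 27 (.const 0)])
        (.put 26 (.sub (.reg 26) (.const 1)))))

/-- The state of the depth-first search. -/
def drv (S : Store) : DFS.State where
  len := S 26 0
  ch := S 25
  dir := S 27 0
  run := S 28 0
  ans := S 29 0

theorem iterP_keeps (N tA sizeA tC sizeC : ℕ) {l : ℕ} (hl : l ≤ 8 ∨ 35 < l ∨ l = 34) :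
    (iterP N tA sizeA tC sizeC).Keeps l := by
  have h1 := nodeP_keeps tA sizeA tC sizeC (l := l) (by omega)
  simp only [iterP, Pr.Keeps, Pr.seqs, Pr.put, and_true, h1, true_and]
  omega

theorem drv_ite {c c' : Prop} {_ : Decidable c} {_ : Decidable c'} {A B : Store} {A' B' : DFS.State}
    (h : c ↔ c') (hA : c' → drv A = A') (hB : ¬ c' → drv B = B') :
    drv (if c then A else B) = if c' then A' else B' := by
  by_cases hc : c'
  · rw [if_pos (h.2 hc), if_pos hc, hA hc]
  · rw [if_neg fun hh => hc (h.1 hh), if_neg hc, hB hc]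

theorem iterP_drv (N tA sizeA tC sizeC : ℕ) (y : ℕ → ℕ) {S : Store}
    (hz : ∀ k i, 4 * S 0 0 ≤ i → S k i = 0) (h38 : S 38 = 0) :
    drv ((iterP N tA sizeA tC sizeC).den y S) = DFS.iter N (S 0 0) (root S)
      (step (dat tA sizeA tC sizeC S)) St.st (drv S) := by
  unfold iterP DFS.iter
  simp only [Pr.den_ite]
  refine drv_ite (by simp [drv]) (fun h1 => ?_) fun h1 => drv_ite (by simp [drv]) (fun h2 => ?_)
    fun h2 => drv_ite (by simp [drv]) (fun h3 => ?_) fun h3 => ?_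
  · have hst := nodeP_abs tA sizeA tC sizeC y hz h38
    simp only [Pr.den_seqs_cons, Pr.den_seqs_nil]
    set T := (nodeP tA sizeA tC sizeC).den y S with hT
    have hkeep : ∀ l, (l ≤ 8 ∨ 35 < l ∨ l = 34 ∨ (25 ≤ l ∧ l ≤ 29)) → T l = S l :=
      fun l hl => Pr.den_keeps _ (nodeP_keeps _ _ _ _ hl) S
    have hst' : T 10 0 = (DFS.node (root S) (step (dat tA sizeA tC sizeC S)) (drv S).ch (drv S).len).st :=
      congrArg St.st hst
    rw [← hst']
    clear_value T
    simp only [Pr.den_ite]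
    refine drv_ite (by simp) (fun h2 => ?_) fun h2 => drv_ite (by simp) (fun h3 => ?_) fun h3 => ?_
    all_goals simp [drv, Store.set_eq, Store.set_ne, Store.set_apply, hkeep]
  all_goals simp [drv, Store.set_eq, Store.set_ne, Store.set_apply]

theorem iterP_ok (N tA sizeA tC sizeC : ℕ) {V : ℕ} (hV : 4 ≤ V) :
    (iterP N tA sizeA tC sizeC).Ok 48 V := by
  have h1 := stepP_ok tA sizeA tC sizeC hV
  have h2 := stepP_keeps tA sizeA tC sizeC (l := 24) (by omega)
  simp [iterP, nodeP, resetP, Pr.copy, Pr.copyIdx, Ex.mod, Pr.seqs, Pr.put, Ex.reg, h1, h2]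
  omega

/-- The largest indices are `3 * m + 2` with `m ≤ V`, and those of the copying loops, below `3 * V +
V`. -/
theorem iterP_within (N tA sizeA tC sizeC : ℕ) (y : ℕ → ℕ) {V : ℕ} (hV : 4 ≤ V) :
    (iterP N tA sizeA tC sizeC).Within y V (4 * V) := by
  simp only [iterP, nodeP, resetP, Pr.copy, Pr.copyIdx, Pr.seqs, Pr.put, stepP, stepInitP, stepPairP,
    stepFamilyP, stepCodeP, stepSearchP, Pr.first, deadP, fixP, releaseP, Pr.Within, Ex.eval_reg,
    Ex.eval_mod, Ex.eval, and_true]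
  and_intros
  all_goals
    intro S hS hS0
    first
    | omega
    | exact lt_of_le_of_lt (hS _ _) (by omega)
    | exact lt_of_le_of_lt (Nat.sub_le_of_le_add (le_trans (hS _ _) (Nat.le_add_right _ _))) (by omega)
    | (have := hS 16 0; omega)
    | (rw [hS0]; have := Nat.mod_lt (S 35 0) (show 0 < V by omega); omega)

end Search


namespace Search

open HL

/-- The depth-first search on the machine. -/
theorem search_exec (o N tA sizeA tC sizeC : ℕ) : ∃ C D : ℕ, ∀ (V : ℕ) (x : List ℕ) (y : ℕ → ℕ)
    (M : RAM.Mem) (S : Store), 4 ≤ V → Setting o 48 V x y M S → S 0 0 = V →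
    (∀ k i, 4 * V ≤ i → S k i = 0) → S 38 = 0 → ∀ m D',
    DFS.Runs (DFS.iter N V (root S) (step (dat tA sizeA tC sizeC S)) St.st) DFS.State.run m (drv S) D' →
    D'.run = 0 → ∃ M' t, RAM.Exec x (.loop (.mem (.const 28)) ((iterP N tA sizeA tC sizeC).comp o 48)) M M' t ∧
      M' 29 = D'.ans ∧ RAM.Bounded o V x M' ∧
      t ≤ (m + 1) * (C * (V + 1) ^ D) := by
  obtain ⟨C, D, hCD⟩ := Pr.comp_exec o 48 (by norm_num) (iterP N tA sizeA tC sizeC)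
  obtain ⟨B, hB⟩ := (RAM.Expr.mem (.const 28)).cost_le o trivial
  refine ⟨C + B + 1, D + 2, ?_⟩
  intro V x y M S hV hset h0 hz h38 m D' hruns hD'
  have e1 : (V + 1) ^ D ≤ (V + 1) ^ (D + 2) := Nat.pow_le_pow_right (by omega) (by omega)
  have e2 : (V + 1) ^ 2 ≤ (V + 1) ^ (D + 2) := Nat.pow_le_pow_right (by omega) (by omega)
  have e3 : 1 ≤ (V + 1) ^ (D + 2) := Nat.one_le_pow _ _ (by omega)
  generalize hE : drv S = E at hruns
  have hf : ∃ f, f = DFS.iter N V (root S) (step (dat tA sizeA tC sizeC S)) St.st := ⟨_, rfl⟩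
  obtain ⟨f, hf⟩ := hf
  rw [← hf] at hruns
  induction hruns generalizing M S with
  | refl E =>
    subst hE
    have hv : (RAM.Expr.mem (.const 28)).val x M = 0 := by
      have := hset.represents 28 (by norm_num) 0
      simp only [mul_zero, zero_add] at this
      simp only [RAM.Expr.val, this]
      exact hD'
    refine ⟨M, _, .loop_exit hv, ?_, hset.bounded (by norm_num), ?_⟩
    · have := hset.represents 29 (by norm_num) 0
      simp only [mul_zero, zero_add] at this
      exact this
    · have := (hB V x M (hset.bounded (by norm_num))).2
      nlinarith
  | @step m E E' hrun hruns ih =>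
    subst hE
    have hv : (RAM.Expr.mem (.const 28)).val x M ≠ 0 := by
      have := hset.represents 28 (by norm_num) 0
      simp only [mul_zero, zero_add] at this
      simp only [RAM.Expr.val, this]
      exact hrun
    obtain ⟨M', u, h1, h2, h3⟩ := hCD V x y M S (iterP_ok _ _ _ _ _ hV) hset
    have hk : ∀ l, (l ≤ 8 ∨ 35 < l ∨ l = 34) → (iterP N tA sizeA tC sizeC).den y S l = S l :=
      fun l hl => Pr.den_keeps _ (iterP_keeps _ _ _ _ _ hl) S
    have hroot : root ((iterP N tA sizeA tC sizeC).den y S) = root S := by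
      simp [root, hk]
    have hdat : dat tA sizeA tC sizeC ((iterP N tA sizeA tC sizeC).den y S) = dat tA sizeA tC sizeC S :=
      dat_congr _ _ _ _ fun l hl => hk l (by omega)
    obtain ⟨M'', t, k1, k2, k3, k4⟩ := ih M' _ h2 (by rw [hk 0 (by omega), h0])
      -- The cells from `4 * V` on stay zero, as the next reset of the arrays requires.
      (fun k i hi => by
        rw [Pr.den_within (by omega) (by omega) hset.input_le _ (iterP_ok _ _ _ _ _ hV)
          (iterP_keeps _ _ _ _ _ (by omega)) (iterP_within _ _ _ _ _ y hV) S hset.store_le h0 _ _ hi,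
          hz k i hi])
      (by rw [hk 38 (by omega), h38]) hD'
      (by rw [hf, iterP_drv N tA sizeA tC sizeC y (by rw [h0]; exact hz) h38, h0])
      (by rw [hf, hroot, hdat])
    refine ⟨M'', _, .loop_step hv h1 k1, k2, k3, ?_⟩
    have := (hB V x M (hset.bounded (by norm_num))).2
    nlinarith

/-! #### Reading the input -/

/-- Write the values of `f` below `N` into the array `k`. -/
def tableP (k : ℕ) (f : ℕ → ℕ) : ℕ → Pr
  | 0 => .skip
  | N + 1 => .seq (tableP k f N) (.set k (.const N) (.const (f N)))

theorem tableP_den (y : ℕ → ℕ) (k : ℕ) (f : ℕ → ℕ) : ∀ (N : ℕ) (S : Store) (l i : ℕ),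
    (tableP k f N).den y S l i = if l = k ∧ i < N then f i else S l i
  | 0, S, l, i => by simp [tableP]
  | N + 1, S, l, i => by
    rw [tableP, Pr.den, Pr.den, Store.set_apply, tableP_den y k f N]
    simp only [Ex.eval]
    by_cases h1 : l = k
    · by_cases h2 : i = N
      · simp [h1, h2]
      · simp [h1, h2, show i ≤ N ↔ i < N by omega]
    · simp [h1]

theorem tableP_ok (k : ℕ) (f : ℕ → ℕ) {K V : ℕ} (hk : k < K) : ∀ N, (∀ i < N, f i ≤ V) →
    (tableP k f N).Ok K V
  | 0, _ => trivial
  | N + 1, h => ⟨tableP_ok k f hk N fun i hi => h i (by omega), hk, trivial, trivial, h N (by omega)⟩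

theorem tableP_within (y : ℕ → ℕ) (k : ℕ) (f : ℕ → ℕ) {V G : ℕ} : ∀ N, N ≤ G →
    (tableP k f N).Within y V G
  | 0, _ => trivial
  | N + 1, h => ⟨tableP_within y k f N (by omega), fun _ _ _ => h⟩

theorem tableP_keeps {k : ℕ} (f : ℕ → ℕ) {l : ℕ} (hl : l ≠ k) : ∀ N, (tableP k f N).Keeps l
  | 0 => trivial
  | N + 1 => ⟨tableP_keeps f hl N, hl⟩

/-- Read a clause, starting at the position in the array `40`, and store it with the number in the
array `41`. -/
def clauseP : Pr :=
  .seqs [.put 42 (.inp (.reg 40)), .put 40 (.cap (.add (.reg 40) (.const 1))),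
    .set 3 (.mul (.const 3) (.reg 41))
      (.ite (.lt (.const 0) (.reg 42)) (.inp (.reg 40)) (.cap (.add (.reg 1) (.reg 1)))),
    .set 3 (.add (.mul (.const 3) (.reg 41)) (.const 1))
      (.ite (.lt (.const 1) (.reg 42)) (.inp (.add (.reg 40) (.const 1))) (.cap (.add (.reg 1) (.reg 1)))),
    .set 3 (.add (.mul (.const 3) (.reg 41)) (.const 2))
      (.ite (.lt (.const 2) (.reg 42)) (.inp (.add (.reg 40) (.const 2))) (.cap (.add (.reg 1) (.reg 1)))),
    .put 40 (.cap (.add (.reg 40) (.reg 42)))]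

/-- Read a formula, starting at the position in the array `40`. -/
def formulaP : Pr :=
  .seqs [.put 2 (.inp (.reg 40)), .put 40 (.cap (.add (.reg 40) (.const 1))), .loop 41 (.reg 2) clauseP,
    -- The additional variable `n` gets the value 1, which makes the padding literal `2 * n` false.
    -- The array `28` starts the search.
    .set 34 (.reg 1) (.const 1), .put 28 (.const 1)]

theorem encodeClause_getD {n : ℕ} (C : List (Literal n)) (l : List ℕ) {q : ℕ} (hq : q < C.length)
    (d : ℕ) : (encodeClause C ++ l).getD (q + 1) 0 = (C.map encodeLiteral).getD q d := by
  rw [encodeClause, List.cons_append, List.getD_cons_succ, List.getD_append _ _ _ _ (by simpa using hq),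
    List.getD_eq_getElem _ _ (by simpa using hq), List.getD_eq_getElem _ _ (by simpa using hq)]

theorem encodeClause_skip {n : ℕ} (C : List (Literal n)) (l : List ℕ) (i : ℕ) :
    (encodeClause C ++ l).getD (C.length + 1 + i) 0 = l.getD i 0 := by
  rw [List.getD_append_right _ _ _ _ (by simp [encodeClause])]
  congr 1
  simp [encodeClause]

/-- The loop counts downwards while the input is read forwards, so the first clause gets the highest
number. The second statement lets the induction pass: later rounds do not touch the clause just
stored. -/
theorem clauses_den {n V : ℕ} (y : ℕ → ℕ) (hn : n + n ≤ V) : ∀ (L : List (List (Literal n))) (p : ℕ)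
    (S : Store), (∀ C ∈ L, C.length ≤ 3) → S 0 0 = V → S 1 0 = n → S 40 0 = p →
    p + (L.flatMap encodeClause).length ≤ V →
    (∀ i < (L.flatMap encodeClause).length, y (p + i) = (L.flatMap encodeClause).getD i 0) →
    (∀ z < L.length, ∀ q < 3, loopDown (clauseP.den y) 41 L.length S 3 (3 * z + q) =
      ((L.getD (L.length - 1 - z) []).map encodeLiteral).getD q (2 * n)) ∧
    ∀ z, 3 * L.length ≤ z → loopDown (clauseP.den y) 41 L.length S 3 z = S 3 z
  | [], p, S, _, _, _, _, _, _ => by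
    refine ⟨fun z hz => absurd hz (by simp), fun z _ => ?_⟩
    rw [List.length_nil, loopDown, Store.set_ne _ _ _ (by norm_num)]
  | C :: L, p, S, hL, h0, h1, h40, hp, hy => by
    have hC := hL C (by simp)
    set rest := L.flatMap encodeClause with hrest
    have hflat : (C :: L).flatMap encodeClause = encodeClause C ++ rest := by simp [hrest]
    have hlen : (encodeClause C ++ rest).length = C.length + 1 + rest.length := by
      simp [encodeClause]; omega
    rw [hflat, hlen] at hp hy
    have y0 : y p = C.length := by
      have := hy 0 (by omega)
      simpa [encodeClause] using this
    have yq : ∀ q < C.length, y (p + 1 + q) = (C.map encodeLiteral).getD q (2 * n) := by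
      intro q hq
      have := hy (q + 1) (by omega)
      rw [encodeClause_getD C rest hq (2 * n)] at this
      rw [← this]; congr 1; omega
    have ypad : ∀ q, ¬ q < C.length → (C.map encodeLiteral).getD q (2 * n) = 2 * n := by
      intro q hq
      rw [List.getD_eq_default _ _ (by simpa using hq)]
    set T := clauseP.den y (S.set 41 0 L.length) with hT
    have hTkeep : ∀ l, l ≠ 42 → l ≠ 40 → l ≠ 3 → l ≠ 41 → T l = S l := by
      intro l a1 a2 a3 a4
      rw [hT, Pr.den_keeps, Store.set_ne _ _ _ a4]
      simp [clauseP, Pr.seqs, Pr.put, a1, a2, a3]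
    have hT40 : T 40 0 = p + (C.length + 1) := by
      simp [hT, clauseP, Store.set_apply, h0, h40, y0]
      omega
    have hT3 : ∀ i, T 3 i = if i = 3 * L.length + 2 then (C.map encodeLiteral).getD 2 (2 * n) else
        if i = 3 * L.length + 1 then (C.map encodeLiteral).getD 1 (2 * n) else
        if i = 3 * L.length then (C.map encodeLiteral).getD 0 (2 * n) else S 3 i := by
      intro i
      have m1 : min (p + 1) V = p + 1 := by omega
      have m2 : min (n + n) V = 2 * n := by omega
      have key : ∀ q, (if q < C.length then y (p + 1 + q) else 2 * n) =
          (C.map encodeLiteral).getD q (2 * n) := by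
        intro q
        split_ifs with hq
        exacts [yq q hq, (ypad q hq).symm]
      have key0 := key 0
      rw [add_zero] at key0
      rw [← key 2, ← key 1, ← key0]
      simp only [hT, clauseP, Pr.den_seqs_cons, Pr.den_seqs_nil, Pr.den_put, Pr.den]
      simp [Store.set_apply, h0, h1, h40, y0, m1, m2]
      simp only [← List.length_eq_zero_iff, Nat.pos_iff_ne_zero, ite_not]
    obtain ⟨ih1, ih2⟩ := clauses_den y hn L (p + (C.length + 1)) T (fun C hC => hL C (by simp [hC]))
      (by rw [hTkeep 0 (by norm_num) (by norm_num) (by norm_num) (by norm_num), h0])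
      (by rw [hTkeep 1 (by norm_num) (by norm_num) (by norm_num) (by norm_num), h1]) hT40
      (by rw [← hrest]; omega) (by
        intro i hi
        rw [← hrest] at hi ⊢
        have := hy (C.length + 1 + i) (by omega)
        rw [encodeClause_skip] at this
        rw [← this]; congr 1; omega)
    rw [List.length_cons, loopDown, ← hT]
    constructor
    · intro z hz q hq
      rcases Nat.lt_succ_iff_lt_or_eq.1 hz with hz | rfl
      · rw [ih1 z hz q hq, show L.length + 1 - 1 - z = (L.length - 1 - z) + 1 by omega,
          List.getD_cons_succ]
      · rw [ih2 _ (by omega), hT3, show L.length + 1 - 1 - L.length = 0 by omega, List.getD_cons_zero]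
        interval_cases q <;> simp
    · intro z hz
      rw [ih2 z (by omega), hT3, if_neg (by omega), if_neg (by omega), if_neg (by omega)]

theorem clauseP_keeps {l : ℕ} (h1 : l ≠ 42) (h2 : l ≠ 40) (h3 : l ≠ 3) : clauseP.Keeps l := by
  simp [clauseP, Pr.seqs, Pr.put, h1, h2, h3]

theorem formulaP_keeps {l : ℕ} (hl : l ≠ 2 ∧ l ≠ 3 ∧ l ≠ 28 ∧ l ≠ 34 ∧ l ≠ 40 ∧ l ≠ 41 ∧ l ≠ 42) :
    formulaP.Keeps l := by
  have := clauseP_keeps hl.2.2.2.2.2.2 hl.2.2.2.2.1 hl.2.1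
  simp [formulaP, Pr.seqs, Pr.put, hl, this]

theorem formulaP_den {n V : ℕ} (y : ℕ → ℕ) (hn : n + n ≤ V) (F : CNF3 n) {p : ℕ} {S : Store}
    (h0 : S 0 0 = V) (h1 : S 1 0 = n) (h40 : S 40 0 = p) (hp : p + (encodeFormula F).length ≤ V)
    (hy : ∀ i < (encodeFormula F).length, y (p + i) = (encodeFormula F).getD i 0) :
    formulaP.den y S 2 0 = F.clauses.length ∧
    (∀ z < F.clauses.length, ∀ q < 3, formulaP.den y S 3 (3 * z + q) =
      ((F.clauses.getD (F.clauses.length - 1 - z) []).map encodeLiteral).getD q (2 * n)) ∧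
    formulaP.den y S 34 = Function.update (S 34) n 1 ∧ formulaP.den y S 28 0 = 1 := by
  have hlen : (encodeFormula F).length = (F.clauses.flatMap encodeClause).length + 1 := by
    simp [encodeFormula]
  have y0 : y p = F.clauses.length := by
    have := hy 0 (by omega)
    simpa [encodeFormula] using this
  simp only [formulaP, Pr.den_seqs_cons, Pr.den_seqs_nil, Pr.den_put]
  have e40 : (Ex.inp (.reg 40)).eval y S = F.clauses.length := by simp [h40, y0]
  rw [e40]
  set T := (S.set 2 0 F.clauses.length).set 40 0
    ((Ex.cap (.add (.reg 40) (.const 1))).eval y (S.set 2 0 F.clauses.length)) with hT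
  have T2 : T 2 0 = F.clauses.length := by simp [hT, Store.set_apply]
  have T40 : T 40 0 = p + 1 := by
    simp [hT, Store.set_apply, h0, h40]; omega
  have T0 : T 0 0 = V := by simp [hT, Store.set_apply, h0]
  have T1 : T 1 0 = n := by simp [hT, Store.set_apply, h1]
  have T34 : T 34 = S 34 := by simp [hT, Store.set_ne]
  clear_value T
  have hcl := clauses_den y hn F.clauses (p + 1) T F.width_le T0 T1 T40 (by omega) (by
    intro i hi
    have := hy (i + 1) (by omega)
    rw [encodeFormula, List.getD_cons_succ] at this
    rw [← this]; congr 1; omega)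
  have hkeep : ∀ l, l ≠ 42 → l ≠ 40 → l ≠ 3 → l ≠ 41 →
      (Pr.loop 41 (.reg 2) clauseP).den y T l = T l := fun l a1 a2 a3 a4 =>
    Pr.den_keeps (.loop 41 (.reg 2) clauseP) ⟨a4, clauseP_keeps a1 a2 a3⟩ T
  have hW3 : (Pr.loop 41 (.reg 2) clauseP).den y T 3 =
      loopDown (clauseP.den y) 41 F.clauses.length T 3 := by
    rw [Pr.den, Ex.eval_reg, T2]
  set W := (Pr.loop 41 (.reg 2) clauseP).den y T with hW
  have W1 : W 1 0 = n := by rw [hkeep 1 (by norm_num) (by norm_num) (by norm_num) (by norm_num), T1]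
  have W2 : W 2 0 = F.clauses.length := by
    rw [hkeep 2 (by norm_num) (by norm_num) (by norm_num) (by norm_num), T2]
  have W34 : W 34 = S 34 := by
    rw [hkeep 34 (by norm_num) (by norm_num) (by norm_num) (by norm_num), T34]
  clear_value W
  refine ⟨?_, fun z hz q hq => ?_, ?_, ?_⟩
  · simp [Store.set_apply, W2]
  · rw [← hcl.1 z hz q hq, ← hW3]
    simp [Store.set_apply]
  · simp [Store.set_eq, Store.set_ne, W1, W34]
  · simp [Store.set_apply]

theorem formulaP_ok {V : ℕ} (hV : 4 ≤ V) : formulaP.Ok 48 V := by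
  simp [formulaP, clauseP, Pr.seqs, Pr.put, Ex.reg]
  omega

theorem formulaP_within (y : ℕ → ℕ) {V : ℕ} (hV : 4 ≤ V) : formulaP.Within y V (4 * V) := by
  simp only [formulaP, clauseP, Pr.seqs, Pr.put, Pr.Within, Ex.eval_reg, Ex.eval, and_true]
  and_intros
  all_goals
    intro S hS hS0
    have h1 := hS 41 0
    have h2 := hS 1 0
    omega

end Search


namespace Search

open Finset

/-! ### Correctness of the search -/

variable {I : Data}

/-- Everything the search accepts comes from a satisfying assignment. -/
theorem accepts_sound {B : ℝ} (hI : I.Valid B) {N : ℕ} {σ : St}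
    (hA : DFS.Accepts N (step I) St.st σ) (hst : σ.st = 0) (h : Inv I σ) :
    ∃ f : ℕ → ℕ, (∀ z < I.c, ¬ I.False f z) ∧ (∀ x, f x ≤ 1) ∧ f I.n = 1 ∧
      (σ.ph ≠ 0 → ∀ α, ham I.n α f ≤ ham I.n α σ.val + σ.k + flipped σ) := by
  induction hA with
  | leaf h2 => omega
  | @inner σ d h0 _ hA ih =>
    by_cases h1 : (step I d σ).st = 0
    · obtain ⟨f, f1, f2, f3, f4⟩ := ih h1 (step_spec hI h h1).1
      refine ⟨f, f1, f2, f3, fun hph α => ?_⟩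
      obtain ⟨r1, r2⟩ := reach_step α h hph h1
      exact (f4 r1 α).trans r2
    · have h2 : (step I d σ).st = 2 := by
        cases hA with
        | leaf h2 => exact h2
        | inner h _ _ => exact absurd h h1
      obtain ⟨f1, f2, f3, f4⟩ := accept_spec hst h h2
      exact ⟨σ.cur, f1, f2, f3, fun _ α => (f4 α).trans (by omega)⟩

theorem accepts_complete {B : ℝ} (hI : I.Valid B) {β : ℕ → ℕ} (hβ : ∀ x, β x ≤ 1)
    (hsat : ∀ z < I.c, ¬ I.False β z) {N : ℕ} (hN : 9 ≤ N) (hA : I.sizeA ≤ N) (hC : I.sizeC ≤ N)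
    {σ : St} (h : Inv I σ) (hst : σ.st = 0) (hG : Good I β σ) : DFS.Accepts N (step I) St.st σ := by
  induction hf : fuel I σ using Nat.strong_induction_on generalizing σ with
  | _ f ih =>
  obtain ⟨d, hd, h2 | ⟨h0, hG'⟩⟩ := good_step hI hβ hsat h hst hG hN hA hC
  · exact .inner hst hd (.leaf h2)
  · obtain ⟨h1, h3⟩ := step_spec hI h h0
    exact .inner hst hd (ih _ (by omega) h1 h0 hG' rfl)

/-- A bound for the number of steps of the search. -/
noncomputable def stepCount (I : Data) (B : ℝ) (N : ℕ) (σ : St) : ℝ :=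
  -- An inner node has potential at least 1 and the total does not grow downwards, so each level has
  -- at most `potential` inner nodes, and `fuel` bounds the number of levels. The factor `2 * N`
  -- pays for the children.
  1 + 2 * N * (fuel I σ + 1) * potential I B σ

theorem search_terminates {B : ℝ} (hI : I.Valid B) {N cap : ℕ} (hN : 9 ≤ N) (hA : I.sizeA ≤ N)
    (hC : I.sizeC ≤ N) (hcap : N ≤ cap) {σ : St} (h : Inv I σ) (hfuel : fuel I σ < cap) {D : DFS.State}
    (hlen : D.len = 0) (hrun : D.run = 1) (hdir : D.dir = 0) (hans : D.ans = 0) :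
    ∃ m D', DFS.Runs (DFS.iter N cap σ (step I) St.st) DFS.State.run m D D' ∧
      (m : ℝ) ≤ stepCount I B N σ + 1 ∧ D'.run = 0 ∧
      (DFS.Accepts N (step I) St.st σ → D'.ans = 1) ∧
      (¬ DFS.Accepts N (step I) St.st σ → D'.ans = 0) := by
  refine DFS.search (P := Inv I) (fuel := fuel I) (cnt := stepCount I B N) (by omega) hcap
    (fun τ d hτ _ hd => step_spec hI hτ hd) (fun τ hτ h0 => ?_) (fun τ h0 => ?_) (fun _ => h) hfuel
    hlen hrun hdir hans
  · have hp := potential_step hI hN hA hC hτ h0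
    have h1 := one_le_potential (I := I) hI.one_le h0
    have hN0 : (0 : ℝ) ≤ 2 * N := by positivity
    have hstep : ∀ d, stepCount I B N (step I d τ) + 1 ≤
        2 + 2 * N * fuel I τ * potential I B (step I d τ) := by
      intro d
      have hpn := potential_nonneg (I := I) hI.one_le (step I d τ)
      by_cases hd : (step I d τ).st = 0
      · obtain ⟨_, h3⟩ := step_spec hI hτ hd
        have h4 : (fuel I (step I d τ) : ℝ) + 1 ≤ fuel I τ := by exact_mod_cast h3
        have := mul_le_mul_of_nonneg_right (mul_le_mul_of_nonneg_left h4 hN0) hpn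
        rw [stepCount]
        linarith
      · have : potential I B (step I d τ) = 0 := by rw [potential, if_neg hd]
        rw [stepCount, this]
        norm_num
    calc 1 + ∑ d ∈ range N, (stepCount I B N (step I d τ) + 1)
        ≤ 1 + ∑ d ∈ range N, (2 + 2 * N * fuel I τ * potential I B (step I d τ)) :=
          add_le_add_right (sum_le_sum fun d _ => hstep d) 1
      _ = 1 + 2 * N + 2 * N * fuel I τ * ∑ d ∈ range N, potential I B (step I d τ) := by
          rw [sum_add_distrib, ← mul_sum]; simp; ring
      _ ≤ 1 + 2 * N + 2 * N * fuel I τ * potential I B τ := by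
          have : 0 ≤ 2 * (N : ℝ) * fuel I τ := by positivity
          have := mul_le_mul_of_nonneg_left hp this
          linarith
      _ ≤ _ := by
          have := mul_le_mul_of_nonneg_left h1 hN0
          rw [stepCount]
          linarith
  · rw [stepCount]
    have : potential I B τ = 0 := by rw [potential, if_neg h0]
    rw [this]
    norm_num

/-! #### Formulas -/

/-- The clauses of the data are those of the formula, in reverse order. -/
structure Describes (I : Data) {n : ℕ} (F : CNF3 n) : Prop where
  n_eq : I.n = n
  c_eq : I.c = F.clauses.length
  lit_eq : ∀ z < I.c, ∀ q < 3, I.lit (3 * z + q) =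
    ((F.clauses.getD (F.clauses.length - 1 - z) []).map encodeLiteral).getD q (2 * n)

theorem encodeLiteral_lt {n : ℕ} (l : Literal n) : encodeLiteral l < 2 * n := by
  have h1 := l.1.2
  have h2 : l.2.toNat ≤ 1 := Bool.toNat_le _
  unfold encodeLiteral
  omega

theorem encodeLiteral_div {n : ℕ} (l : Literal n) : encodeLiteral l / 2 = l.1 := by
  have h2 : l.2.toNat ≤ 1 := Bool.toNat_le _
  unfold encodeLiteral
  omega

theorem encodeLiteral_mod {n : ℕ} (l : Literal n) : encodeLiteral l % 2 = l.2.toNat := by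
  have h2 : l.2.toNat ≤ 1 := Bool.toNat_le _
  unfold encodeLiteral
  omega

theorem toNat_inj {a b : Bool} : a.toNat = b.toNat ↔ a = b := by
  cases a <;> cases b <;> simp

theorem encodeLiteral_injective {n : ℕ} : Function.Injective (encodeLiteral (n := n)) := by
  intro l l' h
  have h1 : (l.1 : ℕ) = l'.1 := by rw [← encodeLiteral_div, h, encodeLiteral_div]
  have h2 : l.2.toNat = l'.2.toNat := by rw [← encodeLiteral_mod, h, encodeLiteral_mod]
  exact Prod.ext (Fin.ext h1) (toNat_inj.1 h2)

/-- A clause is determined by three optional literals, and no clause is listed twice. This is why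
the time can be bounded in `n` alone rather than in the input length. -/
theorem clauses_length_le {n : ℕ} (F : CNF3 n) : F.clauses.length ≤ (2 * n + 1) ^ 3 := by
  have hinj : ∀ C ∈ F.clauses, ∀ C' ∈ F.clauses,
      (fun q : Fin 3 => C[(q : ℕ)]?) = (fun q : Fin 3 => C'[(q : ℕ)]?) → C = C' := by
    intro C hC C' hC' h
    apply List.ext_getElem?
    intro i
    by_cases hi : i < 3
    · exact congrFun h ⟨i, hi⟩
    · have h1 := F.width_le C hC
      have h2 := F.width_le C' hC'
      rw [List.getElem?_eq_none (by omega), List.getElem?_eq_none (by omega)]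
  have hnd : (F.clauses.map fun (C : List (Literal n)) (q : Fin 3) => C[(q : ℕ)]?).Nodup :=
    F.clauses_nodup.map_on hinj
  have := hnd.length_le_card
  simpa [mul_comm] using this

variable {n : ℕ} {F : CNF3 n}

theorem Describes.mem (h : Describes I F) {z : ℕ} (hz : z < I.c) :
    F.clauses.getD (F.clauses.length - 1 - z) [] ∈ F.clauses := by
  have := h.c_eq
  rw [List.getD_eq_getElem _ _ (by omega)]
  exact List.getElem_mem _

theorem Describes.lit_le (h : Describes I F) : ∀ z < I.c, ∀ q < 3, I.lit (3 * z + q) ≤ 2 * I.n := by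
  intro z hz q hq
  rw [h.lit_eq z hz q hq, h.n_eq]
  set C := F.clauses.getD (F.clauses.length - 1 - z) []
  by_cases hC : q < C.length
  · rw [List.getD_eq_getElem _ _ (by simpa using hC), List.getElem_map]
    exact (encodeLiteral_lt _).le
  · rw [List.getD_eq_default _ _ (by simpa using hC)]

theorem Describes.nodup (h : Describes I F) : ∀ z < I.c, ∀ q < 3, ∀ q' < 3,
    I.lit (3 * z + q) = I.lit (3 * z + q') → I.lit (3 * z + q) < 2 * I.n → q = q' := by
  intro z hz q hq q' hq' he hlt
  rw [h.lit_eq z hz q hq] at he hlt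
  rw [h.lit_eq z hz q' hq'] at he
  rw [h.n_eq] at hlt
  have hnd := F.literals_nodup _ (h.mem hz)
  set C := F.clauses.getD (F.clauses.length - 1 - z) []
  have hC : q < C.length := by
    by_contra hC
    rw [List.getD_eq_default _ _ (by simpa using hC)] at hlt
    omega
  have hC' : q' < C.length := by
    by_contra hC'
    rw [he, List.getD_eq_default _ _ (by simpa using hC')] at hlt
    omega
  rw [List.getD_eq_getElem _ _ (by simpa using hC), List.getD_eq_getElem _ _ (by simpa using hC')] at he
  exact ((hnd.map encodeLiteral_injective).getElem_inj_iff).1 he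

theorem Describes.false_iff (h : Describes I F) {f : ℕ → ℕ} (hf : f n = 1) {z : ℕ} (hz : z < I.c) :
    I.False f z ↔ ∀ l ∈ F.clauses.getD (F.clauses.length - 1 - z) [], f l.1 ≠ l.2.toNat := by
  have hw := F.width_le _ (h.mem hz)
  have hlit := h.lit_eq z hz
  set C := F.clauses.getD (F.clauses.length - 1 - z) []
  rw [Data.false_iff]
  constructor
  · intro hF l hl
    obtain ⟨q, hq, rfl⟩ := List.getElem_of_mem hl
    have h1 := hF q (by omega)
    rw [hlit q (by omega), List.getD_eq_getElem _ _ (by simpa using hq), List.getElem_map, LitFalse,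
      encodeLiteral_div, encodeLiteral_mod] at h1
    exact h1
  · intro hF q hq
    rw [hlit q hq]
    by_cases hC : q < C.length
    · rw [List.getD_eq_getElem _ _ (by simpa using hC), List.getElem_map, LitFalse,
        encodeLiteral_div, encodeLiteral_mod]
      exact hF _ (List.getElem_mem _)
    · rw [List.getD_eq_default _ _ (by simpa using hC), LitFalse, Nat.mul_div_cancel_left _ (by norm_num),
        hf]
      omega

/-- Assignments as functions on all natural numbers. -/
def extend (β : Assignment n) (x : ℕ) : ℕ := if h : x < n then (β ⟨x, h⟩).toNat else 1

theorem extend_le (β : Assignment n) (x : ℕ) : extend β x ≤ 1 := by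
  unfold extend; split_ifs
  exacts [Bool.toNat_le _, le_rfl]

theorem extend_self (β : Assignment n) : extend β n = 1 := by simp [extend]

theorem extend_val (β : Assignment n) (i : Fin n) : extend β i = (β i).toNat := by simp [extend]

theorem Describes.not_false (h : Describes I F) {β : Assignment n} (hβ : F.SatisfiedBy β) :
    ∀ z < I.c, ¬ I.False (extend β) z := by
  intro z hz hF
  rw [h.false_iff (extend_self β) hz] at hF
  obtain ⟨l, hl, he⟩ := hβ _ (h.mem hz)
  apply hF l hl
  rw [extend_val, he]

theorem Describes.satisfiedBy (h : Describes I F) {f : ℕ → ℕ} (hf : ∀ z < I.c, ¬ I.False f z)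
    (hle : ∀ x, f x ≤ 1) (hn : f n = 1) : F.SatisfiedBy fun i => decide (f i = 1) := by
  intro C hC
  obtain ⟨i, hi, rfl⟩ := List.getElem_of_mem hC
  have hc := h.c_eq
  have hz := hf (F.clauses.length - 1 - i) (by omega)
  rw [h.false_iff hn (by omega), show F.clauses.length - 1 - (F.clauses.length - 1 - i) = i by omega,
    List.getD_eq_getElem _ _ hi] at hz
  push Not at hz
  obtain ⟨l, hl, he⟩ := hz
  refine ⟨l, hl, ?_⟩
  have := hle l.1
  cases hb : l.2 <;> simp [he, hb]

theorem ham_eq {f g : ℕ → ℕ} (α β : Assignment n) (hf : ∀ i : Fin n, f i = (α i).toNat)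
    (hg : ∀ i : Fin n, g i = (β i).toNat) : ham n f g = hammingDist α β := by
  rw [ham, hammingDist, card_filter, sum_range, ← card_filter]
  congr 1
  ext i
  simp only [mem_filter, hf, hg, ne_eq, toNat_inj]

end Search


/-! ### The codes as constants of the program, and the store before the search -/

namespace Search

open Finset HL

/-- The two codes on which the search relies. -/
structure Codes where
  tA : ℕ
  sizeA : ℕ
  rad : ℕ → ℕ
  bit : ℕ → ℕ
  tC : ℕ
  sizeC : ℕ
  sw : ℕ → ℕ
  ex : ℕ → ℕ
  pos : ℕ → ℕ
  tA_pos : 0 < tA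
  tC_pos : 0 < tC
  bit_le : ∀ x, bit x ≤ 1
  -- The table is written up to this index only; with zeros beyond, the array equals `bit` as a
  -- function.
  bit_zero : ∀ x, sizeA * tA ≤ x → bit x = 0
  pos_lt : ∀ x, pos x < 3
  pos_zero : ∀ x, sizeC * tC ≤ x → pos x = 0
  coverA : ∀ β : ℕ → ℕ, (∀ q, β q ≤ 1) → ∃ d < sizeA, #{q ∈ range tA | bit (d * tA + q) ≠ β q} ≤ rad d
  coverC : ∀ Q : ℕ → ℕ → Prop, (∀ q, ∃ p < 3, Q q p) → ∃ d < sizeC, open Classical in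
    #{q ∈ range tC | ¬ Q q (pos (d * tC + q))} ≤ sw d ∧
    #{q ∈ range tC | Q q (pos (d * tC + q)) ∧ 2 ≤ #{p ∈ range 3 | Q q p}} ≤ ex d
  costA : ∑ d ∈ range sizeA, ballBase ^ rad d ≤ (1.439 : ℝ) ^ tA
  costC : ∑ d ∈ range sizeC, (10 : ℝ) ^ sw d * (4 / ballBase) ^ ex d ≤ ballBase ^ tC

theorem exists_codes : Nonempty Codes := by
  obtain ⟨tA, sizeA, rad, bit, a1, a2, a3, a4, a5⟩ := exists_boolean_code
  obtain ⟨tC, sizeC, sw, ex, pos, c1, c2, c3, c4, c5⟩ := exists_clause_code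
  exact ⟨⟨tA, sizeA, rad, bit, tC, sizeC, sw, ex, pos, a1, c1, a2, a3, c2, c3, a4, c4, a5, c5⟩⟩

namespace Codes

variable (c : Codes)

/-- The number of choices in a step of the search. -/
def width : ℕ := 9 + c.sizeA + c.sizeC

/-- A bound for all constants. -/
def bound : ℕ := 100 + c.width + c.tA + c.tC + c.sizeA * c.tA + c.sizeC * c.tC +
  ∑ d ∈ range c.sizeA, c.rad d + ∑ d ∈ range c.sizeC, c.sw d + ∑ d ∈ range c.sizeC, c.ex d

/-- The bound for all numbers in the computation, for formulas with `n` variables. -/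
def capacity (n : ℕ) : ℕ := (n + c.bound) ^ 8

theorem bound_ge : 100 ≤ c.bound := by
  unfold bound; omega

theorem le_capacity (n : ℕ) : (n + c.bound) ^ 2 ≤ c.capacity n :=
  Nat.pow_le_pow_right (by have := c.bound_ge; omega) (by norm_num)

theorem linear_le_capacity (n : ℕ) : 100 * (n + c.bound) ≤ c.capacity n := by
  refine le_trans ?_ (c.le_capacity n)
  rw [sq]
  exact Nat.mul_le_mul_right _ (by have := c.bound_ge; omega)

theorem clauses_le_capacity (n : ℕ) : 100 * (2 * n + 1) ^ 3 + n ≤ c.capacity n := by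
  have h := c.bound_ge
  have h1 : 2 * n + 1 ≤ 2 * (n + c.bound) := by omega
  have h2 : (2 * n + 1) ^ 3 ≤ (2 * (n + c.bound)) ^ 3 := Nat.pow_le_pow_left h1 3
  have h3 : 1 ≤ n + c.bound := by omega
  have h4 : 100 ≤ n + c.bound := by omega
  calc 100 * (2 * n + 1) ^ 3 + n ≤ 100 * (2 * (n + c.bound)) ^ 3 + (n + c.bound) ^ 3 := by
        have : n + c.bound ≤ (n + c.bound) ^ 3 := Nat.le_self_pow (by norm_num) _
        omega
    _ = 801 * (n + c.bound) ^ 3 := by ring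
    _ ≤ (100 * 100) * (n + c.bound) ^ 3 := Nat.mul_le_mul_right _ (by norm_num)
    _ ≤ ((n + c.bound) * (n + c.bound)) * (n + c.bound) ^ 3 :=
        Nat.mul_le_mul_right _ (Nat.mul_le_mul h4 h4)
    _ = (n + c.bound) ^ 5 := by ring
    _ ≤ _ := Nat.pow_le_pow_right h3 (by norm_num)

/-- Pairs of clauses are enumerated by a single number, so the square of the number of clauses must
fit. It has degree 6 in `n`, for which the exponent 8 leaves room. -/
theorem sq_le_capacity (n : ℕ) : (2 * n + 1) ^ 3 * (2 * n + 1) ^ 3 ≤ c.capacity n := by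
  have h := c.bound_ge
  have h1 : 2 * n + 1 ≤ 2 * (n + c.bound) := by omega
  have h4 : 100 ≤ n + c.bound := by omega
  calc (2 * n + 1) ^ 3 * (2 * n + 1) ^ 3 = (2 * n + 1) ^ 6 := by ring
    _ ≤ (2 * (n + c.bound)) ^ 6 := Nat.pow_le_pow_left h1 6
    _ = 64 * (n + c.bound) ^ 6 := by ring
    _ ≤ (100 * 100) * (n + c.bound) ^ 6 := Nat.mul_le_mul_right _ (by norm_num)
    _ ≤ ((n + c.bound) * (n + c.bound)) * (n + c.bound) ^ 6 :=
        Nat.mul_le_mul_right _ (Nat.mul_le_mul h4 h4)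
    _ = _ := by rw [capacity]; ring

theorem rad_le {d : ℕ} (hd : d < c.sizeA) : c.rad d ≤ c.bound := by
  have := single_le_sum (f := c.rad) (fun _ _ => Nat.zero_le _) (mem_range.2 hd)
  unfold bound; omega

theorem sw_le {d : ℕ} (hd : d < c.sizeC) : c.sw d ≤ c.bound := by
  have := single_le_sum (f := c.sw) (fun _ _ => Nat.zero_le _) (mem_range.2 hd)
  unfold bound; omega

theorem ex_le {d : ℕ} (hd : d < c.sizeC) : c.ex d ≤ c.bound := by
  have := single_le_sum (f := c.ex) (fun _ _ => Nat.zero_le _) (mem_range.2 hd)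
  unfold bound; omega

/-- Store the codes. -/
def tablesP : Pr :=
  .seqs [tableP 4 c.rad c.sizeA, tableP 5 c.bit (c.sizeA * c.tA), tableP 6 c.sw c.sizeC,
    tableP 7 c.ex c.sizeC, tableP 8 c.pos (c.sizeC * c.tC)]

theorem tablesP_keeps {l : ℕ} (hl : l < 4 ∨ 8 < l) : c.tablesP.Keeps l := by
  simp only [tablesP, Pr.seqs, Pr.Keeps, and_true]
  exact ⟨tableP_keeps _ (by omega) _, tableP_keeps _ (by omega) _, tableP_keeps _ (by omega) _,
    tableP_keeps _ (by omega) _, tableP_keeps _ (by omega) _⟩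

theorem tablesP_ok (n : ℕ) : c.tablesP.Ok 48 (c.capacity n) := by
  have h := c.linear_le_capacity n
  have hb := c.bound_ge
  simp only [tablesP, Pr.seqs, Pr.Ok, and_true]
  refine ⟨tableP_ok _ _ (by norm_num) _ fun d hd => ?_, tableP_ok _ _ (by norm_num) _ fun d hd => ?_,
    tableP_ok _ _ (by norm_num) _ fun d hd => ?_, tableP_ok _ _ (by norm_num) _ fun d hd => ?_,
    tableP_ok _ _ (by norm_num) _ fun d hd => ?_⟩
  · have := c.rad_le hd; omega
  · have := c.bit_le d; omega
  · have := c.sw_le hd; omega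
  · have := c.ex_le hd; omega
  · have := c.pos_lt d; omega

theorem tablesP_within (y : ℕ → ℕ) (n : ℕ) :
    c.tablesP.Within y (c.capacity n) (4 * c.capacity n) := by
  have h := c.linear_le_capacity n
  have hb : c.width + c.sizeA * c.tA + c.sizeC * c.tC ≤ c.bound := by unfold bound; omega
  have hw : c.sizeA + c.sizeC ≤ c.width := by unfold width; omega
  simp only [tablesP, Pr.seqs, Pr.Within, and_true]
  exact ⟨tableP_within _ _ _ _ (by omega), tableP_within _ _ _ _ (by omega),
    tableP_within _ _ _ _ (by omega), tableP_within _ _ _ _ (by omega), tableP_within _ _ _ _ (by omega)⟩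

/-- The store before the search. -/
structure Ready {n : ℕ} (F : CNF3 n) (val : ℕ → ℕ) (k ph : ℕ) (S : Store) : Prop where
  cap : S 0 0 = c.capacity n
  n_eq : S 1 0 = n
  c_eq : S 2 0 = F.clauses.length
  lit : ∀ z < F.clauses.length, ∀ q < 3, S 3 (3 * z + q) =
      ((F.clauses.getD (F.clauses.length - 1 - z) []).map encodeLiteral).getD q (2 * n)
  rad : ∀ d < c.sizeA, S 4 d = c.rad d
  bit : S 5 = c.bit
  sw : ∀ d < c.sizeC, S 6 d = c.sw d
  ex : ∀ d < c.sizeC, S 7 d = c.ex d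
  pos : S 8 = c.pos
  drv : drv S = ⟨0, 0, 0, 1, 0⟩
  val : S 34 = Function.update val n 1
  k_eq : S 36 0 = k
  ph_eq : S 37 0 = ph
  zero : S 38 = 0
  far : ∀ k i, 4 * c.capacity n ≤ i → S k i = 0

/-- The data of the search in the store. -/
def data (S : Store) : Data := dat c.tA c.sizeA c.tC c.sizeC S

variable {c} {n : ℕ} {F : CNF3 n} {val : ℕ → ℕ} {k ph : ℕ} {S : Store}

theorem Ready.describes (h : c.Ready F val k ph S) : Describes (c.data S) F where
  n_eq := h.n_eq
  c_eq := h.c_eq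
  lit_eq := by
    have : (c.data S).c = F.clauses.length := h.c_eq
    rw [this]
    exact h.lit

theorem Ready.valid (h : c.Ready F val k ph S) : (c.data S).Valid 1.439 where
  lit_le := h.describes.lit_le
  nodup := h.describes.nodup
  sq_le := by
    change S 2 0 * S 2 0 ≤ S 0 0
    rw [h.c_eq, h.cap]
    exact (Nat.mul_le_mul (clauses_length_le F) (clauses_length_le F)).trans (c.sq_le_capacity n)
  n_le := by
    change S 1 0 + c.tA + c.tC + 3 ≤ S 0 0
    rw [h.n_eq, h.cap]
    have h1 := c.linear_le_capacity n
    have h2 : 100 + c.tA + c.tC ≤ c.bound := by unfold bound; omega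
    omega
  tA_pos := c.tA_pos
  tC_pos := c.tC_pos
  bit_le := by
    change ∀ x, S 5 x ≤ 1
    rw [h.bit]; exact c.bit_le
  pos_lt := by
    change ∀ x, S 8 x < 3
    rw [h.pos]; exact c.pos_lt
  coverA := by
    change ∀ β : ℕ → ℕ, (∀ q, β q ≤ 1) → ∃ d < c.sizeA,
      #{q ∈ range c.tA | S 5 (d * c.tA + q) ≠ β q} ≤ S 4 d
    intro β hβ
    obtain ⟨d, hd, hh⟩ := c.coverA β hβ
    refine ⟨d, hd, ?_⟩
    rw [h.bit, h.rad d hd]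
    exact hh
  coverC := by
    intro Q hQ
    obtain ⟨d, hd, h1, h2⟩ := c.coverC Q hQ
    refine ⟨d, hd, ?_⟩
    change _ ≤ S 6 d ∧ _ ≤ S 7 d
    rw [h.sw d hd, h.ex d hd, show (c.data S).pos = c.pos from h.pos]
    exact ⟨h1, h2⟩
  costA := by
    change ∑ d ∈ range c.sizeA, ballBase ^ S 4 d ≤ 1.439 ^ c.tA
    rw [sum_congr rfl fun d hd => by rw [h.rad d (mem_range.1 hd)]]
    exact c.costA
  costC := by
    change ∑ d ∈ range c.sizeC, 10 ^ S 6 d * (4 / ballBase) ^ S 7 d ≤ ballBase ^ c.tC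
    rw [sum_congr rfl fun d hd => by rw [h.sw d (mem_range.1 hd), h.ex d (mem_range.1 hd)]]
    exact c.costC
  one_le := by norm_num

theorem Ready.root_val (h : c.Ready F val k ph S) (x : ℕ) :
    (root S).val x = if x = n then 1 else val x := by
  change S 34 x = _
  rw [h.val, Function.update_apply]

theorem Ready.root_mark (h : c.Ready F val k ph S) (x : ℕ) :
    (root S).mark x = if x = n then 1 else 0 := by
  change Function.update (0 : ℕ → ℕ) (S 1 0) 1 x = _
  rw [h.n_eq, Function.update_apply]
  rfl

theorem Ready.inv (h : c.Ready F val k ph S) (hph : ph ≤ 1) (hval : ∀ x, val x ≤ 1) :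
    Inv (c.data S) (root S) := by
  have h1 : (root S).ph = ph := h.ph_eq
  have hn : (c.data S).n = n := h.n_eq
  refine Inv.of_early (by omega) (fun x => ?_) ?_ ?_ (fun _ x hx => ?_) rfl (fun x => ?_)
  · rw [h.root_val]; split_ifs
    exacts [le_rfl, hval x]
  · rw [hn, h.root_val, if_pos rfl]
  · rw [hn, h.root_mark, if_pos rfl]
  · rw [hn] at hx
    rw [h.root_mark, if_neg hx]
  · rw [h.root_mark]; split_ifs <;> omega

theorem width_ge : 9 ≤ c.width ∧ c.sizeA ≤ c.width ∧ c.sizeC ≤ c.width := by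
  unfold width; omega

theorem Ready.sound_sat (h : c.Ready F val k ph S) (hph : ph ≤ 1) (hval : ∀ x, val x ≤ 1)
    (hA : DFS.Accepts c.width (step (c.data S)) St.st (root S)) :
    ∃ β : Assignment n, F.SatisfiedBy β ∧ (ph = 1 → ∀ α : Assignment n,
      (∀ i : Fin n, val i = (α i).toNat) → hammingDist α β ≤ k) := by
  have hn : (c.data S).n = n := h.n_eq
  obtain ⟨f, f1, f2, f3, f4⟩ := accepts_sound h.valid hA rfl (h.inv hph hval)
  rw [hn] at f3 f4
  refine ⟨_, h.describes.satisfiedBy f1 f2 f3, fun hp α hα => ?_⟩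
  have hk : (root S).k = k := h.k_eq
  have := f4 (by rw [show (root S).ph = ph from h.ph_eq]; omega) (root S).val
  have hfl : flipped (root S) = 0 := by
    rw [flipped, if_neg (by rw [show (root S).ph = ph from h.ph_eq]; omega)]; rfl
  have hself : ham n (root S).val (root S).val = 0 := by simp [ham]
  rw [hfl, hself, hk, zero_add, add_zero] at this
  refine le_trans (le_of_eq ?_) this
  symm
  refine ham_eq α _ (fun i => ?_) fun i => ?_
  · rw [h.root_val, if_neg (by omega), hα]
  · have := f2 i
    by_cases h1 : f i = 1
    · simp [h1]
    · simp [show f i = 0 by omega]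

theorem Ready.complete (h : c.Ready F val k ph S) (hph : ph ≤ 1) (hval : ∀ x, val x ≤ 1)
    {β : Assignment n} (hβ : F.SatisfiedBy β) (hd : ph = 1 → ∃ α : Assignment n,
      (∀ i : Fin n, val i = (α i).toNat) ∧ hammingDist α β ≤ k) :
    DFS.Accepts c.width (step (c.data S)) St.st (root S) := by
  have hn : (c.data S).n = n := h.n_eq
  have hp : (root S).ph = ph := h.ph_eq
  refine accepts_complete h.valid (extend_le β) (h.describes.not_false hβ) width_ge.1 width_ge.2.1
    width_ge.2.2 (h.inv hph hval) rfl ⟨fun x hx => ?_, fun _ => ⟨?_, ?_⟩, fun h1 => ?_, ?_, ?_, ?_, ?_, ?_⟩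
  · rw [h.root_mark] at hx
    split_ifs at hx with hxn
    rw [h.root_val, if_pos hxn, hxn, extend_self]
  · exact Nat.zero_le _
  · have hi : (root S).i = 0 := rfl
    rw [hi, pending_zero]
    simp
  · obtain ⟨α, hα, hle⟩ := hd (by omega)
    rw [hn, show (root S).k = k from h.k_eq]
    refine le_trans ?_ hle
    rw [← ham_eq (f := (root S).val) (g := extend β) α β (fun i => by
      rw [h.root_val, if_neg (by omega), hα]) (extend_val β)]
    exact card_le_card fun x hx => by
      rw [mem_filter] at hx ⊢
      exact ⟨hx.1, hx.2.2⟩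
  all_goals intro h1; omega

theorem Ready.stepCount_le (h : c.Ready F val k ph S) (hph : ph ≤ 1) (hval : ∀ x, val x ≤ 1) :
    stepCount (c.data S) 1.439 c.width (root S) ≤
      1 + 2 * c.width * (5 * (n + 2) + 1) * (ballBase ^ k * (ballBase ^ c.tC *
        if ph = 0 then 1.439 ^ (n + c.tA) else 1)) := by
  have hn : (c.data S).n = n := h.n_eq
  have hp : (root S).ph = ph := h.ph_eq
  have hf := fuel_le (h.inv hph hval)
  rw [hn] at hf
  have hf' : (fuel (c.data S) (root S) : ℝ) ≤ 5 * (n + 2) := by exact_mod_cast hf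
  have hpot : potential (c.data S) 1.439 (root S) ≤ ballBase ^ k * (ballBase ^ c.tC *
        if ph = 0 then 1.439 ^ (n + c.tA) else 1) := by
    rw [potential, if_pos (show (root S).st = 0 from rfl), hp, show (root S).k = k from h.k_eq, hn,
      show (root S).s = 0 from rfl, show (root S).j = 0 from rfl, show (root S).i = 0 from rfl,
      show (c.data S).tC = c.tC from rfl, show (c.data S).tA = c.tA from rfl,
      show rem c.tA 0 = c.tA by simp [rem], pow_zero, pow_zero, one_mul, one_mul, Nat.sub_zero]
    refine le_of_eq ?_
    congr 1
    split_ifs <;> first | rfl | omega | rw [mul_one]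
  rw [stepCount]
  have := potential_nonneg (I := c.data S) (B := 1.439) (by norm_num) (root S)
  gcongr

/-- The store after the first instructions. -/
def start (V n k ph : ℕ) : Store := ((((0 : Store).set 0 0 V).set 1 0 n).set 36 0 k).set 37 0 ph

theorem start_apply (V n k ph l i : ℕ) : start V n k ph l i = if i = 0 then
    if l = 0 then V else if l = 1 then n else if l = 36 then k else if l = 37 then ph else 0 else 0 := by
  simp only [start, Store.set_apply]
  split_ifs <;> first | rfl | omega

/-- Store the codes, run `b`, which prepares the assignment and the position of the formula, and read
the formula. -/
def preludeP (c : Codes) (b : Pr) : Pr := .seqs [c.tablesP, b, formulaP]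

theorem preludeP_ok {b : Pr} (hb : b.Ok 48 (c.capacity n)) : (c.preludeP b).Ok 48 (c.capacity n) := by
  have h := c.linear_le_capacity n
  have := c.bound_ge
  exact ⟨c.tablesP_ok n, hb, formulaP_ok (by omega), trivial⟩

theorem ready_prelude {p : ℕ} {y : ℕ → ℕ} {b : Pr} (hok : b.Ok 48 (c.capacity n))
    (hw : b.Within y (c.capacity n) (4 * c.capacity n))
    (hkeep : ∀ l, l ≠ 34 → l ≠ 40 → l ≠ 41 → b.Keeps l)
    (hb : ∀ T : Store, T 1 0 = n → T 34 = 0 → T 40 = 0 → b.den y T 34 = val ∧ b.den y T 40 0 = p)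
    (hp : p + (encodeFormula F).length ≤ c.capacity n)
    (hy : ∀ i < (encodeFormula F).length, y (p + i) = (encodeFormula F).getD i 0)
    (hyV : ∀ i, y i ≤ c.capacity n) (hk : k ≤ c.capacity n) (hph : ph ≤ 1) :
    c.Ready F val k ph ((c.preludeP b).den y (start (c.capacity n) n k ph)) := by
  have hlin := c.linear_le_capacity n
  have hbd := c.bound_ge
  set V := c.capacity n with hV
  set S₀ := start V n k ph with hS₀
  have hS0 : ∀ l i, S₀ l i ≤ V := by
    intro l i
    rw [hS₀, start_apply]
    split_ifs <;> omega
  set S₁ := c.tablesP.den y S₀ with hS₁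
  set S₂ := b.den y S₁ with hS₂
  have hden : (c.preludeP b).den y S₀ = formulaP.den y S₂ := rfl
  have t1 : ∀ l, (l < 4 ∨ 8 < l) → S₁ l = S₀ l := fun l hl => Pr.den_keeps _ (c.tablesP_keeps hl) _
  have t2 : ∀ l, l ≠ 34 → l ≠ 40 → l ≠ 41 → S₂ l = S₁ l := fun l h1 h2 h3 =>
    Pr.den_keeps _ (hkeep l h1 h2 h3) _
  have t3 : ∀ l, (l ≠ 2 ∧ l ≠ 3 ∧ l ≠ 28 ∧ l ≠ 34 ∧ l ≠ 40 ∧ l ≠ 41 ∧ l ≠ 42) →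
      formulaP.den y S₂ l = S₂ l := fun l hl => Pr.den_keeps _ (formulaP_keeps hl) _
  have s0 : ∀ l, l ≠ 0 → l ≠ 1 → l ≠ 36 → l ≠ 37 → S₀ l = 0 := by
    intro l h1 h2 h3 h4
    funext i
    rw [hS₀, start_apply]
    split_ifs <;> rfl
  have keep : ∀ l, l ≠ 34 → l ≠ 40 → l ≠ 41 → l ≠ 2 → l ≠ 3 → l ≠ 28 → l ≠ 42 → (l < 4 ∨ 8 < l) →
      formulaP.den y S₂ l = S₀ l := fun l h1 h2 h3 h4 h5 h6 h7 h8 => by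
    rw [t3 l ⟨h4, h5, h6, h1, h2, h3, h7⟩, t2 l h1 h2 h3, t1 l h8]
  have tab : ∀ l i, S₁ l i = if l = 8 ∧ i < c.sizeC * c.tC then c.pos i else
      if l = 7 ∧ i < c.sizeC then c.ex i else if l = 6 ∧ i < c.sizeC then c.sw i else
      if l = 5 ∧ i < c.sizeA * c.tA then c.bit i else
      if l = 4 ∧ i < c.sizeA then c.rad i else S₀ l i := by
    intro l i
    simp only [hS₁, tablesP, Pr.den_seqs_cons, Pr.den_seqs_nil, tableP_den]
  have tab' : ∀ l i, 4 ≤ l → l ≤ 8 → formulaP.den y S₂ l i = S₁ l i := by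
    intro l i h1 h2
    rw [t3 l (by omega), t2 l (by omega) (by omega) (by omega)]
  have b1 : S₁ 1 0 = n := by rw [t1 1 (by omega), hS₀, start_apply]; simp
  obtain ⟨b34, b40⟩ := hb S₁ b1 (by rw [t1 _ (by omega), s0 _] <;> omega)
    (by rw [t1 _ (by omega), s0 _] <;> omega)
  obtain ⟨f1, f2, f3, f4⟩ := formulaP_den (S := S₂) y (V := V) (n := n) (by omega) F
    (by rw [t2 _ (by omega) (by omega) (by omega), t1 _ (by omega), hS₀, start_apply]; simp)
    (by rw [t2 _ (by omega) (by omega) (by omega), b1]) b40 hp hy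
  rw [hden]
  constructor
  · rw [keep 0 (by omega) (by omega) (by omega) (by omega) (by omega) (by omega) (by omega) (by omega),
      hS₀, start_apply]; simp [hV]
  · rw [keep 1 (by omega) (by omega) (by omega) (by omega) (by omega) (by omega) (by omega) (by omega),
      hS₀, start_apply]; simp
  · exact f1
  · exact f2
  · intro d hd
    rw [tab' 4 d (by omega) (by omega), tab]; simp [hd]
  · funext d
    rw [tab' 5 d (by omega) (by omega), tab, s0 5 (by omega) (by omega) (by omega) (by omega)]
    by_cases hd : d < c.sizeA * c.tA
    · simp [hd]
    · simp [hd, c.bit_zero d (by omega)]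
  · intro d hd
    rw [tab' 6 d (by omega) (by omega), tab]; simp [hd]
  · intro d hd
    rw [tab' 7 d (by omega) (by omega), tab]; simp [hd]
  · funext d
    rw [tab' 8 d (by omega) (by omega), tab, s0 8 (by omega) (by omega) (by omega) (by omega)]
    by_cases hd : d < c.sizeC * c.tC
    · simp [hd]
    · simp [hd, c.pos_zero d (by omega)]
  · have z : ∀ l, 24 < l → l < 30 → l ≠ 28 → formulaP.den y S₂ l = 0 := fun l h1 h2 h3 => by
      rw [keep l (by omega) (by omega) (by omega) (by omega) (by omega) (by omega) (by omega) (by omega),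
        s0 l (by omega) (by omega) (by omega) (by omega)]
    simp only [Search.drv, f4, z 25 (by omega) (by omega) (by omega), z 26 (by omega) (by omega) (by omega),
      z 27 (by omega) (by omega) (by omega), z 29 (by omega) (by omega) (by omega)]
    rfl
  · rw [f3, hS₂, b34]
  · rw [keep 36 (by omega) (by omega) (by omega) (by omega) (by omega) (by omega) (by omega) (by omega),
      hS₀, start_apply]; simp
  · rw [keep 37 (by omega) (by omega) (by omega) (by omega) (by omega) (by omega) (by omega) (by omega),
      hS₀, start_apply]; simp
  · rw [keep 38 (by omega) (by omega) (by omega) (by omega) (by omega) (by omega) (by omega) (by omega),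
      s0 38 (by omega) (by omega) (by omega) (by omega)]
  · intro l i hi
    rw [← hden, Pr.den_within (by omega) (by omega) hyV _ (preludeP_ok hok)
      ⟨c.tablesP_keeps (by omega), hkeep 0 (by omega) (by omega) (by omega), formulaP_keeps (by omega), trivial⟩
      ⟨c.tablesP_within y n, hw, formulaP_within y (by omega), trivial⟩ S₀ hS0
      (by rw [hS₀, start_apply]; simp [hV]) _ _ hi, hS₀, start_apply, if_neg (by omega)]

end Codes

end Search


namespace Search

open Finset HL

/-! #### The machine program -/

/-- The number of variables. -/
def varsE : RAM.Expr := .inp (.add (.const 0) (.const 0))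

/-- The radius, or the number of variables if that is smaller. -/
def radiusE : RAM.Expr :=
  .sub (.inp (.add (.const 1) (.const 0))) (.sub (.inp (.add (.const 1) (.const 0))) varsE)

/-- The eighth power of the value of `e`. -/
def pow8E (e : RAM.Expr) : RAM.Expr :=
  .mul (.mul (.mul e e) (.mul e e)) (.mul (.mul e e) (.mul e e))

namespace Codes

variable (c : Codes)

/-- Initialise the registers that hold the bound, the number of variables, the radius, which is the
value of `e`, and the phase. -/
def registersP (e : RAM.Expr) (ph : ℕ) : RAM.Prog :=
  .seq (.store (.const 0) (pow8E (.add varsE (.const c.bound)))) (.seq (.store (.const 1) varsE)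
    (.seq (.store (.const 36) e) (.store (.const 37) (.const ph))))

/-- Only this part reads the radius, which no function of `n` bounds. Therefore the time is
expressed in a bound `U` for all input words. -/
theorem registersP_exec {e : RAM.Expr} (he : e.Shifted 0) (ph : ℕ) : ∃ C : ℕ, ∀ (x : List ℕ) (n k U : ℕ),
    x.getD 0 0 = n → (∀ M, e.val x M = k) → (∀ i, x.getD i 0 ≤ U) → c.capacity n ≤ U → k ≤ U →
    ph ≤ U → ∃ M t, RAM.Exec x (c.registersP e ph) (fun _ => 0) M t ∧
      Represents 48 M (start (c.capacity n) n k ph) ∧ t ≤ C * (U + 1) ^ 2 := by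
  have hv : varsE.Shifted 0 := ⟨rfl, trivial⟩
  obtain ⟨C₁, h₁⟩ := RAM.store_le 0 (a := .const 0) (e := pow8E (.add varsE (.const c.bound))) trivial
    (by simp [pow8E, RAM.Expr.Shifted, hv])
  obtain ⟨C₂, h₂⟩ := RAM.store_le 0 (a := .const 1) (e := varsE) trivial hv
  obtain ⟨C₃, h₃⟩ := RAM.store_le 0 (a := .const 36) (e := e) trivial he
  obtain ⟨C₄, h₄⟩ := RAM.store_le 0 (a := .const 37) (e := .const ph) trivial trivial
  refine ⟨C₁ + C₂ + C₃ + C₄ + 3, fun x n k U hn hk hx hU hkU hph => ?_⟩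
  have hnU : n ≤ U := by have := c.linear_le_capacity n; omega
  have hvars : ∀ M, varsE.val x M = n := fun M => hn
  have hcap : ∀ M, (pow8E (.add varsE (.const c.bound))).val x M = c.capacity n := by
    intro M
    simp only [pow8E, RAM.Expr.val, hvars, capacity]
    ring
  have upd : ∀ {M : RAM.Mem}, RAM.Bounded 0 U x M → ∀ a {v : ℕ}, v ≤ U →
      RAM.Bounded 0 U x (Function.update M a v) := by
    intro M hM a v hv
    refine ⟨hM.inp, fun b => ?_⟩
    rw [Function.update_apply]
    split_ifs
    exacts [hv, hM.mem b]
  have B₀ : RAM.Bounded 0 U x fun _ => 0 := ⟨fun i _ => hx i, fun _ => Nat.zero_le _⟩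
  obtain ⟨t₁, l₁, E₁⟩ := h₁ U x _ B₀
  rw [hcap] at E₁
  have B₁ := upd B₀ 0 hU
  obtain ⟨t₂, l₂, E₂⟩ := h₂ U x _ B₁
  rw [hvars] at E₂
  have B₂ := upd B₁ 1 hnU
  obtain ⟨t₃, l₃, E₃⟩ := h₃ U x _ B₂
  rw [hk] at E₃
  have B₃ := upd B₂ 36 hkU
  obtain ⟨t₄, l₄, E₄⟩ := h₄ U x _ B₃
  refine ⟨_, _, .seq E₁ (.seq E₂ (.seq E₃ E₄)), ?_, ?_⟩
  · have R₀ : Represents 48 (fun _ => 0) (0 : Store) := fun _ _ _ => rfl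
    have R₁ := R₀.update (k := 0) (by norm_num) 0 (c.capacity n)
    have R₂ := R₁.update (k := 1) (by norm_num) 0 n
    have R₃ := R₂.update (k := 36) (by norm_num) 0 k
    exact R₃.update (k := 37) (by norm_num) 0 ph
  · have e3 : 1 ≤ (U + 1) ^ 2 := Nat.one_le_pow _ _ (by omega)
    nlinarith

/-- The whole program. -/
def program (o : ℕ) (b : Pr) (e : RAM.Expr) (ph : ℕ) : RAM.Prog :=
  .seq (c.registersP e ph) (.seq ((c.preludeP b).comp o 48)
    (.seq (.loop (.mem (.const 28)) ((iterP c.width c.tA c.sizeA c.tC c.sizeC).comp o 48))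
      (.store (.const 0) (.mem (.const 29)))))

theorem sum_le_mul {a b d e K : ℝ} (ha : 0 ≤ a) (hb : 0 ≤ b) (hd : 0 ≤ d) (he : 0 ≤ e) (hK : 0 ≤ K) :
    4 * a + b + K * d + e + 3 ≤ (a + b + d + e + 3) * (K + 7) := by
  nlinarith [mul_nonneg ha hK, mul_nonneg hb hK, mul_nonneg he hK]

/-- The dependence of the first part on `r` is removed by `V + r + 1 ≤ (V + 1) * (r + 1)` and `hr`,
at the price of a factor `4 * T`. The other parts are polynomial in `V`, up to the number `m` of
search steps. -/
theorem time_le {C₁ C₂ C₃ C₄ D₂ D₃ V r m w t₁ t₂ t₃ t₄ : ℕ} {g : ℕ} {T : ℝ} (hT1 : 1 ≤ T)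
    (hr : ((r : ℝ) + 1) ^ 2 ≤ 4 * T) (hm1 : (m : ℝ) + 1 ≤ (3 + 22 * w * g) * ((V + 1) * T))
    (l₁ : t₁ ≤ C₁ * (V + r + 1) ^ 2) (l₂ : t₂ ≤ C₂ * (V + 1) ^ D₂)
    (l₃ : t₃ ≤ (m + 1) * (C₃ * (V + 1) ^ D₃)) (l₄ : t₄ ≤ C₄ * (V + 1) ^ 2) :
    ((t₁ + (t₂ + (t₃ + t₄ + 1) + 1) + 1 : ℕ) : ℝ) ≤
      (C₁ + C₂ + C₃ + C₄ + 3) * (10 + 22 * w * g) * ((V : ℝ) + 1) ^ (2 + D₂ + D₃ + 1) * T := by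
  have hV1 : (1 : ℝ) ≤ (V : ℝ) + 1 := by
    have : (0 : ℝ) ≤ V := by positivity
    linarith
  set K : ℝ := 3 + 22 * w * g with hK
  have hK3 : 3 ≤ K := by rw [hK]; have : (0:ℝ) ≤ 22 * w * g := by positivity
                         linarith
  set W : ℝ := (V + 1) ^ (2 + D₂ + D₃ + 1) with hW
  have hWd : ∀ d ≤ 2 + D₂ + D₃ + 1, ((V : ℝ) + 1) ^ d ≤ W := fun d hd => pow_le_pow_right₀ hV1 hd
  have hW1 : 1 ≤ W := one_le_pow₀ hV1
  have q₁ : (t₁ : ℝ) ≤ C₁ * (W * (4 * T)) := by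
    have a1 : (t₁ : ℝ) ≤ C₁ * ((V : ℝ) + r + 1) ^ 2 := by exact_mod_cast l₁
    have a2 : ((V : ℝ) + r + 1) ^ 2 ≤ W * (4 * T) := by
      calc ((V : ℝ) + r + 1) ^ 2 ≤ (((V : ℝ) + 1) * (r + 1)) ^ 2 := by
            have h1 : (0 : ℝ) ≤ V := by positivity
            have h2 : (0 : ℝ) ≤ r := by positivity
            gcongr
            nlinarith
        _ = ((V : ℝ) + 1) ^ 2 * (r + 1) ^ 2 := by ring
        _ ≤ _ := by
            have := hWd 2 (by omega)
            gcongr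
    exact a1.trans (by gcongr)
  have q₂ : (t₂ : ℝ) ≤ C₂ * (W * T) := by
    have a1 : (t₂ : ℝ) ≤ C₂ * ((V : ℝ) + 1) ^ D₂ := by exact_mod_cast l₂
    have a2 := hWd D₂ (by omega)
    have a3 : W ≤ W * T := le_mul_of_one_le_right (by linarith) hT1
    exact a1.trans (by gcongr; exact a2.trans a3)
  have q₃ : (t₃ : ℝ) ≤ C₃ * (K * (W * T)) := by
    have a1 : (t₃ : ℝ) ≤ (m + 1) * (C₃ * ((V : ℝ) + 1) ^ D₃) := by exact_mod_cast l₃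
    have a2 : (((V : ℝ) + 1) * T) * (V + 1) ^ D₃ ≤ W * T := by
      calc (((V : ℝ) + 1) * T) * (V + 1) ^ D₃ = (V + 1) ^ (D₃ + 1) * T := by ring
        _ ≤ _ := by
          have := hWd (D₃ + 1) (by omega)
          gcongr
    calc (t₃ : ℝ) ≤ (m + 1) * (C₃ * ((V : ℝ) + 1) ^ D₃) := a1
      _ ≤ (K * ((V + 1) * T)) * (C₃ * ((V : ℝ) + 1) ^ D₃) := by gcongr
      _ = C₃ * (K * ((((V : ℝ) + 1) * T) * (V + 1) ^ D₃)) := by ring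
      _ ≤ _ := by gcongr
  have q₄ : (t₄ : ℝ) ≤ C₄ * (W * T) := by
    have a1 : (t₄ : ℝ) ≤ C₄ * ((V : ℝ) + 1) ^ 2 := by exact_mod_cast l₄
    have a2 := hWd 2 (by omega)
    have a3 : W ≤ W * T := le_mul_of_one_le_right (by linarith) hT1
    exact a1.trans (by gcongr; exact a2.trans a3)
  have hWT : 1 ≤ W * T := by nlinarith
  push_cast
  calc (t₁ : ℝ) + (t₂ + (t₃ + t₄ + 1) + 1) + 1
      ≤ C₁ * (W * (4 * T)) + C₂ * (W * T) + C₃ * (K * (W * T)) + C₄ * (W * T) + 3 * (W * T) := by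
        linarith
    _ = (4 * C₁ + C₂ + K * C₃ + C₄ + 3) * (W * T) := by ring
    _ ≤ ((C₁ + C₂ + C₃ + C₄ + 3) * (K + 7)) * (W * T) := by
        refine mul_le_mul_of_nonneg_right ?_ (by linarith)
        exact sum_le_mul (by positivity) (by positivity) (by positivity) (by positivity) (by linarith)
    _ = _ := by rw [hK]; ring

/-- Serves both problems: `b` prepares the starting assignment and the position of the formula, and
for `ph = 0` the condition on the distance is void. `T` stands for the exponential factor. -/
theorem program_exec (o : ℕ) (b : Pr) {e : RAM.Expr} (he : e.Shifted 0) {ph : ℕ} (hph : ph ≤ 1) :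
    ∃ A E : ℕ, ∀ {n : ℕ} (F : CNF3 n) (val : ℕ → ℕ) (k p r : ℕ) (x : List ℕ) (y : ℕ → ℕ) (T : ℝ),
    (∀ x, val x ≤ 1) → b.Ok 48 (c.capacity n) → b.Within y (c.capacity n) (4 * c.capacity n) →
    (∀ l, l ≠ 34 → l ≠ 40 → l ≠ 41 → b.Keeps l) →
    (∀ T : Store, T 1 0 = n → T 34 = 0 → T 40 = 0 → b.den y T 34 = val ∧ b.den y T 40 0 = p) →
    p + (encodeFormula F).length ≤ c.capacity n →
    (∀ i < (encodeFormula F).length, y (p + i) = (encodeFormula F).getD i 0) →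
    (∀ i, y i ≤ c.capacity n) → k ≤ c.capacity n → Reads o x y → x.getD 0 0 = n →
    (∀ M, e.val x M = k) → (∀ i, x.getD i 0 ≤ c.capacity n + r) → ((r : ℝ) + 1) ^ 2 ≤ 4 * T →
    ballBase ^ k * (if ph = 0 then 1.439 ^ n else 1) ≤ T →
    RAM.DecidesWithin (c.program o b e ph) x (∃ β : Assignment n, F.SatisfiedBy β ∧ (ph = 1 →
      ∃ α : Assignment n, (∀ i : Fin n, val i = (α i).toNat) ∧ hammingDist α β ≤ k))
      (A * ((c.capacity n : ℝ) + 1) ^ E * T) := by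
  obtain ⟨C₁, h₁⟩ := c.registersP_exec he ph
  obtain ⟨C₂, D₂, h₂⟩ := (c.preludeP b).comp_exec o 48 (by norm_num)
  obtain ⟨C₃, D₃, h₃⟩ := search_exec o c.width c.tA c.sizeA c.tC c.sizeC
  obtain ⟨C₄, h₄⟩ := RAM.store_le o (a := .const 0) (e := .mem (.const 29)) trivial trivial
  -- The last factor bounds `ballBase ^ tC * 1.439 ^ tA`, the surplus of one block of each code in
  -- the potential. The number 22 comes from `2 * width * (5 * (n + 2) + 1)` and `5 * (n + 2) + 1 ≤
  -- 11 * (V + 1)`.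
  refine ⟨(C₁ + C₂ + C₃ + C₄ + 3) * (10 + 22 * c.width * (3 ^ c.tC * 2 ^ c.tA)),
    2 + D₂ + D₃ + 1, ?_⟩
  intro n F val k p r x y T hval hok hw hkeep hb hp hy hyV hkV hx hxn hk hxV hr hT
  have hlin := c.linear_le_capacity n
  have hbd := c.bound_ge
  obtain ⟨M₁, t₁, E₁, R₁, l₁⟩ := h₁ x n k (c.capacity n + r) hxn hk hxV (by omega) (by omega) (by omega)
  have hS0 : ∀ l i, start (c.capacity n) n k ph l i ≤ c.capacity n := by
    intro l i
    rw [start_apply]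
    split_ifs <;> omega
  obtain ⟨M₂, t₂, E₂, R₂, l₂⟩ := h₂ (c.capacity n) x y M₁ _ (preludeP_ok hok)
    ⟨hx, R₁, hyV, hS0, by omega⟩
  have hready : c.Ready F val k ph _ := ready_prelude hok hw hkeep hb hp hy hyV hkV hph
  set S := (c.preludeP b).den y (start (c.capacity n) n k ph)
  have hwidth : c.width ≤ c.bound := by unfold bound; omega
  have hfuel := fuel_le (hready.inv hph hval)
  rw [show (c.data S).n = n from hready.n_eq] at hfuel
  obtain ⟨m, D', hruns, hm, hD', hacc, hrej⟩ := search_terminates (D := drv S) hready.valid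
    (cap := c.capacity n) (N := c.width) width_ge.1 width_ge.2.1 width_ge.2.2 (by omega) (hready.inv hph hval)
    (by omega) (by rw [hready.drv]) (by rw [hready.drv]) (by rw [hready.drv]) (by rw [hready.drv])
  obtain ⟨M₃, t₃, E₃, h29, B₃, l₃⟩ := h₃ (c.capacity n) x y M₂ S (by omega) R₂ hready.cap hready.far
    hready.zero m D' hruns hD'
  obtain ⟨t₄, l₄, E₄⟩ := h₄ (c.capacity n) x M₃ B₃
  have hans : Function.update M₃ ((RAM.Expr.const 0).val x M₃) ((RAM.Expr.mem (.const 29)).val x M₃) 0 =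
      D'.ans := by
    simp [RAM.Expr.val, h29]
  refine ⟨_, _, .seq E₁ (.seq E₂ (.seq E₃ E₄)), ?_, fun hQ => ?_, fun hQ => ?_⟩
  · set V := c.capacity n
    have hcount := hready.stepCount_le hph hval
    have hpk : (1 : ℝ) ≤ ballBase ^ k := one_le_pow₀ (by linarith [lt_ballBase])
    have hpn : (1 : ℝ) ≤ if ph = 0 then 1.439 ^ n else 1 := by
      split_ifs
      exacts [one_le_pow₀ (by norm_num), le_rfl]
    have hT1 : 1 ≤ T := le_trans (by nlinarith) hT
    have hpot : ballBase ^ k * (ballBase ^ c.tC * if ph = 0 then (1.439 : ℝ) ^ (n + c.tA) else 1) ≤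
        3 ^ c.tC * 2 ^ c.tA * T := by
      have e1 : ballBase ^ c.tC ≤ 3 ^ c.tC :=
        pow_le_pow_left₀ ballBase_pos.le (by linarith [ballBase_lt]) _
      have e2 : (if ph = 0 then (1.439 : ℝ) ^ (n + c.tA) else 1) ≤
          2 ^ c.tA * if ph = 0 then 1.439 ^ n else 1 := by
        split_ifs
        · rw [pow_add, mul_comm]
          gcongr
          norm_num
        · rw [mul_one]
          exact one_le_pow₀ (by norm_num)
      have := ballBase_pos
      calc _ ≤ ballBase ^ k * (3 ^ c.tC * (2 ^ c.tA * if ph = 0 then (1.439 : ℝ) ^ n else 1)) := by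
            gcongr
        _ = 3 ^ c.tC * 2 ^ c.tA * (ballBase ^ k * if ph = 0 then (1.439 : ℝ) ^ n else 1) := by ring
        _ ≤ _ := by gcongr
    have hnV : (n : ℝ) ≤ V := by exact_mod_cast (by omega : n ≤ V)
    have hm1 : (m : ℝ) + 1 ≤ (3 + 22 * c.width * (3 ^ c.tC * 2 ^ c.tA)) * ((V + 1) * T) := by
      have e1 : (m : ℝ) + 1 ≤ 3 + 2 * c.width * (5 * (n + 2) + 1) * (3 ^ c.tC * 2 ^ c.tA * T) := by
        have : 2 * (c.width : ℝ) * (5 * (n + 2) + 1) * (ballBase ^ k * (ballBase ^ c.tC *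
          if ph = 0 then (1.439 : ℝ) ^ (n + c.tA) else 1)) ≤
          2 * c.width * (5 * (n + 2) + 1) * (3 ^ c.tC * 2 ^ c.tA * T) := by gcongr
        linarith
      have e2 : (5 * ((n : ℝ) + 2) + 1) ≤ 11 * (V + 1) := by
        have : (0 : ℝ) ≤ V := by positivity
        linarith
      have e3 : 1 ≤ ((V : ℝ) + 1) * T := by
        have : (0 : ℝ) ≤ V := by positivity
        nlinarith
      calc (m : ℝ) + 1 ≤ 3 + 2 * c.width * (5 * (n + 2) + 1) * (3 ^ c.tC * 2 ^ c.tA * T) := e1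
        _ ≤ 3 * ((V + 1) * T) + 2 * c.width * (11 * (V + 1)) * (3 ^ c.tC * 2 ^ c.tA * T) := by
            gcongr
            linarith
        _ = _ := by ring
    have := time_le (g := 3 ^ c.tC * 2 ^ c.tA) hT1 hr (by push_cast; exact hm1) l₁ l₂ l₃ l₄
    push_cast at this ⊢
    exact this
  · rw [hans]
    obtain ⟨β, hβ, hα⟩ := hQ
    exact hacc (hready.complete hph hval hβ hα)
  · rw [hans]
    refine hrej fun hA => hQ ?_
    obtain ⟨β, hβ, hα⟩ := hready.sound_sat hph hval hA
    refine ⟨β, hβ, fun h1 => ⟨fun i => decide (val i = 1), fun i => ?_, hα h1 _ fun i => ?_⟩⟩ <;>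
    · have := hval i
      by_cases h : val i = 1
      · simp [h]
      · simp [show val i = 0 by omega]

end Codes

/-! #### The two problems -/

theorem encodeFormula_length_le {n : ℕ} (F : CNF3 n) :
    (encodeFormula F).length ≤ 1 + 4 * F.clauses.length := by
  have : ∀ L : List (List (Literal n)), (∀ C ∈ L, C.length ≤ 3) →
      (L.flatMap encodeClause).length ≤ 4 * L.length := by
    intro L hL
    induction L with
    | nil => simp
    | cons C L ih =>
      have h1 := hL C (by simp)
      have h2 := ih fun C hC => hL C (by simp [hC])
      simp only [List.flatMap_cons, List.length_append, encodeClause, List.length_cons, List.length_map]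
      omega
  have := this F.clauses F.width_le
  simp only [encodeFormula, List.length_cons]
  omega

theorem encodeFormula_getD_le {n : ℕ} (F : CNF3 n) (i : ℕ) :
    (encodeFormula F).getD i 0 ≤ F.clauses.length + 2 * n + 3 := by
  by_cases hi : i < (encodeFormula F).length
  · rw [List.getD_eq_getElem _ _ hi]
    have hm := List.getElem_mem hi
    generalize (encodeFormula F)[i] = v at hm
    rw [encodeFormula, List.mem_cons, List.mem_flatMap] at hm
    rcases hm with rfl | ⟨C, hC, hv⟩
    · omega
    · rw [encodeClause, List.mem_cons, List.mem_map] at hv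
      rcases hv with rfl | ⟨l, _, rfl⟩
      · have := F.width_le C hC; omega
      · have := encodeLiteral_lt l; omega
  · rw [List.getD_eq_default _ _ (by omega)]; omega

theorem Codes.formula_le_capacity (c : Codes) {n : ℕ} (F : CNF3 n) :
    n + (encodeFormula F).length ≤ c.capacity n ∧ ∀ i, (encodeFormula F).getD i 0 ≤ c.capacity n := by
  have h1 := clauses_length_le F
  have h2 := encodeFormula_length_le F
  have h3 := c.clauses_le_capacity n
  have h4 : 2 * n + 1 ≤ (2 * n + 1) ^ 3 := Nat.le_self_pow (by norm_num) _
  exact ⟨by omega, fun i => (encodeFormula_getD_le F i).trans (by omega)⟩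

/-- Read the `n` bits of the assignment. -/
def assignmentP : Pr :=
  .seqs [.loop 41 (.reg 1) (.set 34 (.reg 41) (.inp (.reg 41))), .put 40 (.reg 1)]

theorem assignmentP_den (y : ℕ → ℕ) (T : Store) (h : T 34 = 0) :
    assignmentP.den y T 34 = (fun i => if i < T 1 0 then y i else 0) ∧
      assignmentP.den y T 40 0 = T 1 0 := by
  have key : ∀ N (T : Store), loopDown ((Pr.set 34 (.reg 41) (.inp (.reg 41))).den y) 41 N T 34 =
      fun i => if i < N then y i else T 34 i := by
    intro N
    induction N with
    | zero => intro T; funext i; simp [loopDown, Store.set_ne]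
    | succ N ih =>
      intro T
      funext i
      rw [loopDown, ih]
      simp only [Pr.den, Ex.eval_reg, Ex.eval, Store.set_apply, true_and, if_true]
      split_ifs <;> first | rfl | omega | (subst_vars; rfl)
  simp only [assignmentP, Pr.den_seqs_cons, Pr.den_seqs_nil, Pr.den_put]
  constructor
  · rw [Store.set_ne _ _ _ (by norm_num), Pr.den, key, h]
    rfl
  · rw [Store.set_apply, if_pos ⟨rfl, rfl⟩, Ex.eval_reg,
      Pr.den_keeps (.loop 41 (.reg 1) (.set 34 (.reg 41) (.inp (.reg 41)))) (by simp)]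

/-- Pays for reading a huge radius: `r + 1 ≤ 2 * (3 / 2) ^ r` by Bernoulli's inequality, and `(3 /
2) ^ 2 < ballBase`. -/
theorem sq_le_four_mul_pow (r : ℕ) : ((r : ℝ) + 1) ^ 2 ≤ 4 * ballBase ^ r := by
  have h1 : (r : ℝ) + 1 ≤ 2 * (3 / 2) ^ r := by
    have := one_add_mul_le_pow (a := (1 / 2 : ℝ)) (by norm_num) r
    norm_num at this ⊢
    linarith
  calc ((r : ℝ) + 1) ^ 2 ≤ (2 * (3 / 2) ^ r) ^ 2 := by gcongr
    _ = 4 * ((3 / 2) ^ 2) ^ r := by rw [mul_pow, ← pow_mul, ← pow_mul, mul_comm r]; norm_num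
    _ ≤ 4 * ballBase ^ r := by
        gcongr
        linarith [lt_ballBase]

/-- The polynomial that bounds the running time. -/
noncomputable def Codes.timePolynomial (c : Codes) (A E : ℕ) : Polynomial ℕ :=
  .C A * ((.X + .C c.bound) ^ 8 + 1) ^ E

theorem Codes.timePolynomial_eval (c : Codes) (A E n : ℕ) :
    (((c.timePolynomial A E).eval n : ℕ) : ℝ) = A * ((c.capacity n : ℝ) + 1) ^ E := by
  simp [timePolynomial, capacity]

/-- The search starts in the pair phase, with the given assignment. No distance exceeds `n`, so the
budget may be `min r n`, which fits the capacity whatever `r` is; the words `n` and `r` are skipped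
afterwards. -/
theorem ballSatInTime : BallSatInTime ballBase := by
  obtain ⟨c⟩ := exists_codes
  obtain ⟨A, E, h⟩ := c.program_exec 2 assignmentP (e := radiusE)
    (by simp [RAM.Expr.Shifted, varsE, radiusE]) (ph := 1) le_rfl
  refine ⟨c.program 2 assignmentP radiusE 1, c.timePolynomial A E, fun I => ?_⟩
  obtain ⟨n, F, α, r⟩ := I
  rw [c.timePolynomial_eval]
  obtain ⟨hcap, hword⟩ := c.formula_le_capacity F
  have hlin := c.linear_le_capacity n
  have hbd := c.bound_ge
  set x := (BallInstance.mk n F α r).encode with hx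
  set y : ℕ → ℕ := fun i => x.getD (i + 2) 0 with hy
  have hyα : ∀ i : Fin n, y i = (α i).toNat := by
    intro i
    simp only [hy, hx, BallInstance.encode, List.cons_append, List.getD_cons_succ]
    rw [List.getD_append _ _ _ _ (by simp), List.getD_eq_getElem _ _ (by simp)]
    simp
  have hyF : ∀ i, y (n + i) = (encodeFormula F).getD i 0 := by
    intro i
    simp only [hy, hx, BallInstance.encode, List.cons_append, List.getD_cons_succ]
    rw [List.getD_append_right _ _ _ _ (by simp)]
    simp
  have hyle : ∀ i, y i ≤ c.capacity n := by
    intro i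
    by_cases hi : i < n
    · have := hyα ⟨i, hi⟩
      have := Bool.toNat_le (α ⟨i, hi⟩)
      simp only at *
      omega
    · have := hyF (i - n)
      rw [show n + (i - n) = i by omega] at this
      rw [this]; exact hword _
  have hval : ∀ i, (fun i => if i < n then y i else 0) i ≤ 1 := by
    intro i
    dsimp only
    split_ifs with hi
    · rw [hyα ⟨i, hi⟩]; exact Bool.toNat_le _
    · omega
  have := h F (fun i => if i < n then y i else 0) (r - (r - n)) n r x y (ballBase ^ r) hval
    (by simp [assignmentP, Pr.seqs, Pr.put, Ex.reg]) ?_ ?_ ?_ hcap (fun i _ => hyF i) hyle (by omega)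
    (fun _ => rfl) rfl (fun _ => rfl) ?_ (sq_le_four_mul_pow r) ?_
  · convert this using 1
    refine exists_congr fun β => and_congr_right fun _ => ?_
    have hα : (∀ i : Fin n, (fun i => if i < n then y i else 0) (i : ℕ) = (α i).toNat) := by
      intro i
      simp [hyα]
    have hn : hammingDist α β ≤ n := by simpa using hammingDist_le_card_fintype (x := α) (y := β)
    constructor
    · intro hle _
      exact ⟨α, hα, by dsimp only at hle; omega⟩
    · intro hex
      obtain ⟨α', hα', hle⟩ := hex rfl
      have : α' = α := by
        funext i
        have := (hα' i).symm.trans (hα i)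
        exact toNat_inj.1 this
      subst this
      dsimp only
      omega
  · simp only [assignmentP, Pr.seqs, Pr.put, Pr.Within, Ex.eval_reg, Ex.eval, and_true]
    refine ⟨fun S hS _ => ?_, fun _ _ _ => by omega⟩
    have := hS 41 0
    omega
  · intro l h1 h2 h3
    simp [assignmentP, Pr.seqs, Pr.put, h1, h2, h3]
  · intro S h1 h34 _
    have := assignmentP_den y S h34
    rwa [h1] at this
  · intro i
    rcases i with _ | _ | i
    · change n ≤ _; omega
    · change r ≤ _; omega
    · exact (hyle i).trans (by omega)
  · rw [if_neg (by norm_num), mul_one]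
    exact pow_le_pow_right₀ (by linarith [lt_ballBase]) (by omega)

/-- The search starts with budget `0` in the phase that chooses the assignment; the budget is built
up from the radii of the code words. -/
theorem satInTime : SatInTime 1.439 := by
  obtain ⟨c⟩ := exists_codes
  obtain ⟨A, E, h⟩ := c.program_exec 1 .skip (e := .const 0) trivial (ph := 0) (by norm_num)
  refine ⟨c.program 1 .skip (.const 0) 0, c.timePolynomial A E, fun I => ?_⟩
  obtain ⟨n, F⟩ := I
  rw [c.timePolynomial_eval]
  obtain ⟨hcap, hword⟩ := c.formula_le_capacity F
  have hlin := c.linear_le_capacity n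
  have hbd := c.bound_ge
  have hone : (1 : ℝ) ≤ 1.439 ^ n := one_le_pow₀ (by norm_num)
  have := h F 0 0 0 0 (SatInstance.mk n F).encode (fun i => (encodeFormula F).getD i 0) (1.439 ^ n)
    (fun _ => Nat.zero_le _) trivial trivial (fun _ _ _ _ => trivial)
    (fun T _ h34 h40 => ⟨h34, by rw [Pr.den, h40]; rfl⟩) (by omega)
    (fun i _ => by rw [zero_add]) hword (by omega) (fun _ => rfl) rfl (fun _ => rfl) ?_
    (by rw [Nat.cast_zero]; linarith) (by simp)
  · convert this using 1
    exact exists_congr fun β => by simp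
  · intro i
    rcases i with _ | i
    · change n ≤ _; omega
    · exact hword i

end Search

theorem theorem1 :
    (∃ a : ℝ, IsGreatest {x : ℝ | x ^ 2 - x - 4 = 0} a ∧ |a - 2.562| < 0.0005 ∧
      BallSatInTime a) ∧
    SatInTime 1.439 := by
  have h1 := lt_ballBase
  have h2 := ballBase_lt
  have h3 := ballBase_sq
  refine ⟨⟨ballBase, ⟨?_, fun x hx => ?_⟩, ?_, Search.ballSatInTime⟩, Search.satInTime⟩
  · change ballBase ^ 2 - ballBase - 4 = 0
    linarith
  · have hx : x ^ 2 - x - 4 = 0 := hx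
    by_contra hlt
    push Not at hlt
    nlinarith
  · rw [abs_lt]
    constructor <;> norm_num at * <;> linarith
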